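/- Let $\mathfrak{g}=\mathfrak{sl}_2\otimes_{\mathbb{C}}\mathbb{C}[x]/(x^2)$ be the Takiff Lie algebra of $\mathfrak{sl}_2=\langle e,h,f\rangle$ over $\mathbb{C}$, with bracket $[a\otimes x^i,b\otimes x^j]=[a,b]\otimes x^{i+j}$, and write $\overline{a}=a\otimes x$. Let $\overline{\mathfrak{h}}=\langle h,\overline{h}\rangle$ and $\overline{\mathfrak{b}}=\langle h,\overline{h},e,\overline{e}\rangle$, and let $\alpha\in\overline{\mathfrak{h}}^*$ be given by $\alpha(h)=2$, $\alpha(\overline{h})=0$. Let $\widetilde{\mathcal{O}}$ be the category of finitely generated $\mathfrak{g}$-modules on which $U(\overline{\mathfrak{b}})$ acts locally finitely. For $\xi\subset\overline{\mathfrak{h}}^*$ let $\widetilde{\mathcal{O}}(\xi)$ be its full subcategory of modules whose support (the set of $\mu$ such that some nonzero vector is killed by a power of $h-\mu(h)$ and by a power of $\overline{h}-\mu(\overline{h})$) is contained in $\xi$. For $\mu\in\overline{\mathfrak{h}}^*$ let $L(\mu)$ be the unique simple quotient of the Verma module $\Delta(\mu)=U(\mathfrak{g})\otimes_{U(\overline{\mathfrak{b}})}\mathbb{C}_\mu$,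 where $e$ and $\overline{e}$ act by zero on $\mathbb{C}_\mu$. Let $\lambda\in\overline{\mathfrak{h}}^*$ be such that $\lambda(\overline{h})=0$ and $\lambda(h)\notin\mathbb{Z}$, and put $\xi=\lambda+\mathbb{Z}\alpha$. Consider the Gabriel quiver of $\widetilde{\mathcal{O}}(\xi)$: its vertices are the isomorphism classes of simple objects, and the number of arrows from $L$ to $S$ is $\dim_{\mathbb{C}}\mathrm{Ext}^1(L,S)$. Its vertices are exactly the pairwise distinct classes of $L(\lambda+n\alpha)$, $n\in\mathbb{Z}$. It has exactly two loops at each vertex, exactly one arrow from $L(\lambda+n\alpha)$ to $L(\lambda+(n+1)\alpha)$ and exactly one arrow from $L(\lambda+(n+1)\alpha)$ to $L(\lambda+n\alpha)$ for each $n\in\mathbb{Z}$, and no other arrows. Moreover, for all $\mu,\nu\in\xi$, $$\mathrm{Ext}^1_{\widetilde{\mathcal{O}}}(L(\mu),L(\nu))\cong\begin{cases}\mathbb{C}^2,&\nu=\mu,\\ \mathbb{C},&\nu=\mu\pm\alpha,\\ 0,&\text{otherwise.}\end{cases}$$ -/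

import Mathlib

open CategoryTheory CategoryTheory.Limits
open scoped TensorProduct

noncomputable section

/-! ### The Takiff Lie algebra of `sl₂` -/

/-- The complex Lie algebra `sl₂`. -/
abbrev SlTwo : Type := LieAlgebra.SpecialLinear.sl (Fin 2) ℂ

namespace SlTwo

/-- The standard basis vector `e`. -/
def e : SlTwo := ⟨!![0, 1; 0, 0],
  LinearMap.mem_ker.2 (by simp [Matrix.trace_fin_two])⟩

/-- The standard basis vector `h`. -/
def h : SlTwo := ⟨!![1, 0; 0, -1],
  LinearMap.mem_ker.2 (by simp [Matrix.trace_fin_two])⟩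

/-- The standard basis vector `f`. -/
def f : SlTwo := ⟨!![0, 0; 1, 0],
  LinearMap.mem_ker.2 (by simp [Matrix.trace_fin_two])⟩

lemma lie_e_f : ⁅e, f⁆ = h := by
  apply Subtype.ext
  rw [LieAlgebra.SpecialLinear.sl_bracket]
  ext i j
  fin_cases i <;> fin_cases j <;> simp [e, f, h]

lemma lie_h_e : ⁅h, e⁆ = (2 : ℂ) • e := by
  apply Subtype.ext
  rw [LieAlgebra.SpecialLinear.sl_bracket]
  ext i j
  fin_cases i <;> fin_cases j <;> simp [e, h, one_add_one_eq_two]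

lemma lie_h_f : ⁅h, f⁆ = (-2 : ℂ) • f := by
  apply Subtype.ext
  rw [LieAlgebra.SpecialLinear.sl_bracket]
  ext i j
  fin_cases i <;> fin_cases j <;> simp [f, h]
  norm_num

lemma eq_comb (x : SlTwo) : x = x.1 0 1 • e + x.1 0 0 • h + x.1 1 0 • f := by
  have hx : x.1 0 0 + x.1 1 1 = 0 := by
    have := LinearMap.mem_ker.1 x.2
    simpa [Matrix.trace_fin_two] using this
  apply Subtype.ext
  ext i j
  fin_cases i <;> fin_cases j <;> simp [e, f, h]
  linear_combination hx

end SlTwo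

/-- The Takiff Lie algebra `sl₂ ⊗ ℂ[x]/(x²)`, a Lie algebra over `ℂ` with bracket
`[a ⊗ s, b ⊗ t] = [a, b] ⊗ st`; the factor `ℂ[x]/(x²)` is written first. -/
abbrev Takiff : Type := DualNumber ℂ ⊗[ℂ] SlTwo

/-- The universal enveloping algebra of the Takiff Lie algebra. Modules over the Takiff Lie
algebra are the modules over this ring. -/
abbrev UTakiff : Type := UniversalEnvelopingAlgebra ℂ Takiff

namespace Takiff

attribute [local instance 100] LieRing.ofAssociativeRing

/-- The element `a ⊗ 1` of the universal enveloping algebra. -/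
def lo (a : SlTwo) : UTakiff := UniversalEnvelopingAlgebra.ι ℂ ((1 : DualNumber ℂ) ⊗ₜ[ℂ] a)

/-- The element `a ⊗ x` of the universal enveloping algebra. -/
def hi (a : SlTwo) : UTakiff :=
  UniversalEnvelopingAlgebra.ι ℂ ((DualNumber.eps : DualNumber ℂ) ⊗ₜ[ℂ] a)

/-- `e` in the universal enveloping algebra. -/
abbrev E : UTakiff := lo SlTwo.e
/-- `h` in the universal enveloping algebra. -/
abbrev H : UTakiff := lo SlTwo.h
/-- `f` in the universal enveloping algebra. -/
abbrev F : UTakiff := lo SlTwo.f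
/-- `e ⊗ x` in the universal enveloping algebra. -/
abbrev Eb : UTakiff := hi SlTwo.e
/-- `h ⊗ x` in the universal enveloping algebra. -/
abbrev Hb : UTakiff := hi SlTwo.h
/-- `f ⊗ x` in the universal enveloping algebra. -/
abbrev Fb : UTakiff := hi SlTwo.f

lemma lo_smul (c : ℂ) (a : SlTwo) : lo (c • a) = c • lo a := by
  simp [lo, TensorProduct.tmul_smul]

lemma hi_smul (c : ℂ) (a : SlTwo) : hi (c • a) = c • hi a := by
  simp [hi, TensorProduct.tmul_smul]

lemma lo_add (a b : SlTwo) : lo (a + b) = lo a + lo b := by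
  simp [lo, TensorProduct.tmul_add]

lemma hi_add (a b : SlTwo) : hi (a + b) = hi a + hi b := by
  simp [hi, TensorProduct.tmul_add]

lemma lo_mul_lo (a b : SlTwo) : lo a * lo b = lo b * lo a + lo ⁅a, b⁆ := by
  have := LieHom.map_lie (UniversalEnvelopingAlgebra.ι ℂ : Takiff →ₗ⁅ℂ⁆ UTakiff)
    ((1 : DualNumber ℂ) ⊗ₜ[ℂ] a) ((1 : DualNumber ℂ) ⊗ₜ[ℂ] b)
  rw [LieAlgebra.ExtendScalars.bracket_tmul, LieRing.of_associative_ring_bracket, one_mul] at this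
  simp only [lo, this]
  abel

lemma lo_mul_hi (a b : SlTwo) : lo a * hi b = hi b * lo a + hi ⁅a, b⁆ := by
  have := LieHom.map_lie (UniversalEnvelopingAlgebra.ι ℂ : Takiff →ₗ⁅ℂ⁆ UTakiff)
    ((1 : DualNumber ℂ) ⊗ₜ[ℂ] a) ((DualNumber.eps : DualNumber ℂ) ⊗ₜ[ℂ] b)
  rw [LieAlgebra.ExtendScalars.bracket_tmul, LieRing.of_associative_ring_bracket, one_mul] at this
  simp only [lo, hi, this]
  abel

lemma hi_mul_hi (a b : SlTwo) : hi a * hi b = hi b * hi a := by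
  have := LieHom.map_lie (UniversalEnvelopingAlgebra.ι ℂ : Takiff →ₗ⁅ℂ⁆ UTakiff)
    ((DualNumber.eps : DualNumber ℂ) ⊗ₜ[ℂ] a) ((DualNumber.eps : DualNumber ℂ) ⊗ₜ[ℂ] b)
  rw [LieAlgebra.ExtendScalars.bracket_tmul, LieRing.of_associative_ring_bracket, DualNumber.eps_mul_eps] at this
  simp only [TensorProduct.zero_tmul, map_zero] at this
  exact (sub_eq_zero.1 this.symm)

lemma H_mul_E : H * E = E * H + (2 : ℂ) • E := by rw [lo_mul_lo, SlTwo.lie_h_e, lo_smul]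
lemma H_mul_F : H * F = F * H + (-2 : ℂ) • F := by rw [lo_mul_lo, SlTwo.lie_h_f, lo_smul]
lemma E_mul_F : E * F = F * E + H := by rw [lo_mul_lo, SlTwo.lie_e_f]
lemma H_mul_Eb : H * Eb = Eb * H + (2 : ℂ) • Eb := by rw [lo_mul_hi, SlTwo.lie_h_e, hi_smul]
lemma H_mul_Fb : H * Fb = Fb * H + (-2 : ℂ) • Fb := by rw [lo_mul_hi, SlTwo.lie_h_f, hi_smul]
lemma H_mul_Hb : H * Hb = Hb * H := by simpa [hi] using lo_mul_hi SlTwo.h SlTwo.h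
lemma E_mul_Fb : E * Fb = Fb * E + Hb := by rw [lo_mul_hi, SlTwo.lie_e_f]
lemma F_mul_Fb : F * Fb = Fb * F := by simpa [hi] using lo_mul_hi SlTwo.f SlTwo.f
lemma Hb_mul_Fb : Hb * Fb = Fb * Hb := hi_mul_hi _ _
lemma Eb_mul_Fb : Eb * Fb = Fb * Eb := hi_mul_hi _ _
lemma Hb_mul_F : Hb * F = F * Hb + (-2 : ℂ) • Fb := by
  have := lo_mul_hi SlTwo.f SlTwo.h
  rw [← lie_skew, SlTwo.lie_h_f, ← neg_smul, hi_smul] at this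
  rw [this, add_assoc, ← add_smul]
  simp
lemma Eb_mul_F : Eb * F = F * Eb + Hb := by
  have := lo_mul_hi SlTwo.f SlTwo.e
  rw [← lie_skew, SlTwo.lie_e_f, ← neg_one_smul ℂ, hi_smul] at this
  rw [this]
  simp

/-- The subalgebra `U(b̄)` of the universal enveloping algebra, where `b̄` is the Borel subalgebra
with basis `h, h ⊗ x, e, e ⊗ x`. -/
def borelEnv : Subalgebra ℂ UTakiff := Algebra.adjoin ℂ {H, Hb, E, Eb}


lemma ι_tmul (d : DualNumber ℂ) (a : SlTwo) :
    UniversalEnvelopingAlgebra.ι ℂ (d ⊗ₜ[ℂ] a) =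
      TrivSqZeroExt.fst d • lo a + TrivSqZeroExt.snd d • hi a := by
  have hd : d = TrivSqZeroExt.fst d • (1 : DualNumber ℂ) +
      TrivSqZeroExt.snd d • (DualNumber.eps : DualNumber ℂ) := by
    ext <;> simp
  conv_lhs => rw [hd]
  rw [TensorProduct.add_tmul, ← TensorProduct.smul_tmul', ← TensorProduct.smul_tmul', map_add,
    map_smul, map_smul]
  rfl

/-- A subalgebra containing the six standard basis vectors is everything. -/
lemma subalgebra_eq_top (S : Subalgebra ℂ UTakiff) (hE : E ∈ S) (hH : H ∈ S) (hF : F ∈ S)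
    (hEb : Eb ∈ S) (hHb : Hb ∈ S) (hFb : Fb ∈ S) : S = ⊤ := by
  have hlo (a : SlTwo) : lo a ∈ S := by
    rw [SlTwo.eq_comb a, lo_add, lo_add, lo_smul, lo_smul, lo_smul]
    exact S.add_mem (S.add_mem (S.smul_mem hE _) (S.smul_mem hH _)) (S.smul_mem hF _)
  have hhi (a : SlTwo) : hi a ∈ S := by
    rw [SlTwo.eq_comb a, hi_add, hi_add, hi_smul, hi_smul, hi_smul]
    exact S.add_mem (S.add_mem (S.smul_mem hEb _) (S.smul_mem hHb _)) (S.smul_mem hFb _)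
  have hι (x : Takiff) : UniversalEnvelopingAlgebra.ι ℂ x ∈ S := by
    induction x using TensorProduct.induction_on with
    | zero => simp
    | tmul d a =>
      rw [ι_tmul]
      exact S.add_mem (S.smul_mem (hlo a) _) (S.smul_mem (hhi a) _)
    | add x y hx hy =>
      rw [map_add]
      exact S.add_mem hx hy
  let g : Takiff →ₗ⁅ℂ⁆ S :=
    { toFun := fun x => ⟨UniversalEnvelopingAlgebra.ι ℂ x, hι x⟩
      map_add' := fun x y => Subtype.ext (map_add _ x y)
      map_smul' := fun c x => Subtype.ext (map_smul _ c x)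
      map_lie' := fun {x y} => Subtype.ext (LieHom.map_lie (UniversalEnvelopingAlgebra.ι ℂ) x y) }
  have hg : S.val.comp (UniversalEnvelopingAlgebra.lift ℂ g) = AlgHom.id ℂ UTakiff := by
    apply UniversalEnvelopingAlgebra.hom_ext
    ext x
    change S.val (UniversalEnvelopingAlgebra.lift ℂ g (UniversalEnvelopingAlgebra.ι ℂ x)) = _
    rw [UniversalEnvelopingAlgebra.lift_ι_apply]
    rfl
  refine Algebra.eq_top_iff.2 fun u => ?_
  have := congrArg (fun φ : UTakiff →ₐ[ℂ] UTakiff => φ u) hg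
  change ((UniversalEnvelopingAlgebra.lift ℂ g u : S) : UTakiff) = u at this
  rw [← this]
  exact (UniversalEnvelopingAlgebra.lift ℂ g u).2

/-! ### Local finiteness, weight spaces -/

/-- Weights, i.e. linear functionals `μ` on the span of `h` and `h ⊗ x`, written as the pair
`(μ(h), μ(h ⊗ x))`. -/
abbrev Weight : Type := ℂ × ℂ

/-- The root `α`, with `α(h) = 2` and `α(h ⊗ x) = 0`. -/
def rootα : Weight := (2, 0)

/-- The coset `μ + ℤα`. -/
def rootCoset (μ : Weight) : Set Weight := {ν | ∃ n : ℤ, ν = μ + n • rootα}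

lemma smul_smul_swap {M : Type*} [AddCommGroup M] [Module UTakiff M] {a b d : UTakiff}
    (h : a * b = b * a + d) (v : M) : a • b • v = b • a • v + d • v := by
  rw [← mul_smul, h, add_smul, mul_smul]

lemma smul_smul_comm' {M : Type*} [AddCommGroup M] [Module UTakiff M] {a b : UTakiff}
    (h : a * b = b * a) (v : M) : a • b • v = b • a • v := by
  rw [← mul_smul, h, mul_smul]

/-- A subalgebra generated by two commuting elements is noetherian. -/
lemma isNoetherianRing_adjoin_pair {R : Type*} [Ring R] [Algebra ℂ R] {a b : R}
    (h : a * b = b * a) : IsNoetherianRing (Algebra.adjoin ℂ {a, b}) := by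
  have hcomm : ∀ x ∈ ({a, b} : Set R), ∀ y ∈ ({a, b} : Set R), x * y = y * x := by
    rintro x (rfl | rfl) y (rfl | rfl)
    exacts [rfl, h, h.symm, rfl]
  have := Algebra.isMulCommutative_adjoin ℂ hcomm
  have hft : Algebra.FiniteType ℂ (Algebra.adjoin ℂ {a, b}) :=
    (Subalgebra.fg_iff_finiteType _).1
      ⟨(Set.toFinite ({a, b} : Set R)).toFinset, by rw [Set.Finite.coe_toFinset]⟩
  let : CommRing (Algebra.adjoin ℂ {a, b}) :=
    { (inferInstance : Ring (Algebra.adjoin ℂ {a, b})) with mul_comm := mul_comm' }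
  exact Algebra.FiniteType.isNoetherianRing ℂ (Algebra.adjoin ℂ {a, b})

/-- The subspace generated by a finite dimensional subspace under a noetherian subalgebra. -/
lemma exists_closure {R M : Type*} [Ring R] [Algebra ℂ R] [AddCommGroup M] [Module ℂ M]
    [Module R M] [IsScalarTower ℂ R M] (A : Subalgebra ℂ R) (hA : IsNoetherianRing A)
    (V : Submodule ℂ M) (hV : V.FG) :
    ∃ W : Submodule ℂ M, V ≤ W ∧ (∀ a ∈ A, ∀ w ∈ W, a • w ∈ W) ∧
      (∀ W' : Submodule ℂ M, V ≤ W' → (∀ a ∈ A, ∀ w ∈ W', a • w ∈ W') → W ≤ W') ∧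
      (W = ⊤ → IsNoetherian R M) := by
  let W : Submodule A M := Submodule.span A (V : Set M)
  refine ⟨W.restrictScalars ℂ, fun v hv => Submodule.subset_span hv,
    fun a ha w hw => W.smul_mem ⟨a, ha⟩ hw, fun W' h1 h2 w hw => ?_, fun hW => ?_⟩
  · change w ∈ Submodule.span A (V : Set M) at hw
    induction hw using Submodule.span_induction with
    | mem v hv => exact h1 hv
    | zero => exact Submodule.zero_mem _
    | add x y _ _ hx hy => exact Submodule.add_mem _ hx hy
    | smul a x _ hx => exact h2 a.1 a.2 x hx
  · have hWfg : W.FG := by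
      obtain ⟨T, hT⟩ := hV
      refine ⟨T, le_antisymm (Submodule.span_mono ?_) (Submodule.span_le.2 ?_)⟩
      · rw [← hT]
        exact Submodule.subset_span
      · intro v hv
        rw [← hT] at hv
        exact Submodule.span_subset_span ℂ A (T : Set M) hv
    have hW' : W = ⊤ := by
      refine Submodule.eq_top_iff'.2 fun m => ?_
      change m ∈ W.restrictScalars ℂ
      exact hW ▸ Submodule.mem_top
    have hfin : Module.Finite A M := ⟨hW' ▸ hWfg⟩
    have : IsNoetherian A M := isNoetherian_of_isNoetherianRing_of_finite A M
    exact isNoetherian_of_tower A this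

section Modules

variable {M N : Type*} [AddCommGroup M] [Module ℂ M] [Module UTakiff M] [IsScalarTower ℂ UTakiff M]
  [AddCommGroup N] [Module ℂ N] [Module UTakiff N] [IsScalarTower ℂ UTakiff N]

/-- The subspace `U(b̄)m`. -/
def borelOrbit (m : M) : Submodule ℂ M :=
  (Subalgebra.toSubmodule borelEnv).map
    ((LinearMap.toSpanSingleton UTakiff M m).restrictScalars ℂ)

variable (M) in
/-- The action of `U(b̄)` on the module is locally finite. -/
def LocallyBorelFinite : Prop := ∀ m : M, (borelOrbit m).FG

variable (M) in
/-- The generalized weight space `M^μ`: the vectors killed by some power of `h - μ(h)` and by some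
power of `h ⊗ x - μ(h ⊗ x)`. -/
def genWeightSpace (μ : Weight) : Submodule ℂ M :=
  (Algebra.lsmul ℂ ℂ M H).maxGenEigenspace μ.1 ⊓ (Algebra.lsmul ℂ ℂ M Hb).maxGenEigenspace μ.2

variable (M) in
/-- The support of a module. -/
def weightSupport : Set Weight := {μ | genWeightSpace M μ ≠ ⊥}

lemma mem_borelOrbit {m n : M} : n ∈ borelOrbit m ↔ ∃ u ∈ borelEnv, u • m = n := by
  simp [borelOrbit]

/-- Stability of a subspace under the Borel subalgebra. -/
structure BorelStable (V : Submodule ℂ M) : Prop where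
  H : ∀ v ∈ V, H • v ∈ V
  Hb : ∀ v ∈ V, Hb • v ∈ V
  E : ∀ v ∈ V, E • v ∈ V
  Eb : ∀ v ∈ V, Eb • v ∈ V

lemma borelStable_borelOrbit (m : M) : BorelStable (borelOrbit m) := by
  have key (b : UTakiff) (hb : b ∈ ({H, Hb, E, Eb} : Set UTakiff)) (v : M)
      (hv : v ∈ borelOrbit m) : b • v ∈ borelOrbit m := by
    obtain ⟨u, hu, rfl⟩ := mem_borelOrbit.1 hv
    exact mem_borelOrbit.2
      ⟨b * u, borelEnv.mul_mem (Algebra.subset_adjoin hb) hu, mul_smul _ _ _⟩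
  exact ⟨key _ (by simp), key _ (by simp), key _ (by simp), key _ (by simp)⟩

lemma mem_borelOrbit_self (m : M) : m ∈ borelOrbit m :=
  mem_borelOrbit.2 ⟨1, borelEnv.one_mem, one_smul _ _⟩

/-- The subalgebra of elements preserving a subspace. -/
def stabilizer (V : Submodule ℂ M) : Subalgebra ℂ UTakiff where
  carrier := {u | ∀ v ∈ V, u • v ∈ V}
  mul_mem' {a b} ha hb v hv := by
    rw [mul_smul]
    exact ha _ (hb _ hv)
  add_mem' {a b} ha hb v hv := by
    rw [add_smul]
    exact V.add_mem (ha _ hv) (hb _ hv)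
  algebraMap_mem' c v hv := by
    rw [algebraMap_smul]
    exact V.smul_mem c hv

lemma borelOrbit_le {V : Submodule ℂ M} (hV : BorelStable V) {m : M} (hm : m ∈ V) :
    borelOrbit m ≤ V := by
  have h : borelEnv ≤ stabilizer V := by
    refine Algebra.adjoin_le ?_
    rintro u (rfl | rfl | rfl | rfl)
    exacts [hV.H, hV.Hb, hV.E, hV.Eb]
  intro n hn
  obtain ⟨u, hu, rfl⟩ := mem_borelOrbit.1 hn
  exact h hu m hm

lemma fg_borelOrbit_of_mem {V : Submodule ℂ M} (hV : BorelStable V) (hfg : V.FG) {m : M}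
    (hm : m ∈ V) : (borelOrbit m).FG :=
  hfg.of_le (borelOrbit_le hV hm)

lemma BorelStable.sup {V W : Submodule ℂ M} (hV : BorelStable V) (hW : BorelStable W) :
    BorelStable (V ⊔ W) := by
  have key (b : UTakiff) (h1 : ∀ v ∈ V, b • v ∈ V) (h2 : ∀ v ∈ W, b • v ∈ W) :
      ∀ v ∈ V ⊔ W, b • v ∈ V ⊔ W := by
    intro v hv
    obtain ⟨x, hx, y, hy, rfl⟩ := Submodule.mem_sup.1 hv
    rw [smul_add]
    exact Submodule.add_mem_sup (h1 x hx) (h2 y hy)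
  exact ⟨key _ hV.H hW.H, key _ hV.Hb hW.Hb, key _ hV.E hW.E, key _ hV.Eb hW.Eb⟩

/-- A `BorelStable` subspace enlarged by its images under `f` and `f ⊗ x` is again stable. -/
lemma BorelStable.enlarge {V : Submodule ℂ M} (hV : BorelStable V) :
    BorelStable (V ⊔ (V.map (Algebra.lsmul ℂ ℂ M F) ⊔ V.map (Algebra.lsmul ℂ ℂ M Fb))) := by
  set W := V ⊔ (V.map (Algebra.lsmul ℂ ℂ M F) ⊔ V.map (Algebra.lsmul ℂ ℂ M Fb)) with hW
  have h0 {v : M} (hv : v ∈ V) : v ∈ W := (le_sup_left : V ≤ W) hv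
  have h1 {v : M} (hv : v ∈ V) : F • v ∈ W :=
    (le_sup_left.trans le_sup_right : V.map (Algebra.lsmul ℂ ℂ M F) ≤ W) ⟨v, hv, rfl⟩
  have h2 {v : M} (hv : v ∈ V) : Fb • v ∈ W :=
    (le_sup_right.trans le_sup_right : V.map (Algebra.lsmul ℂ ℂ M Fb) ≤ W) ⟨v, hv, rfl⟩
  have key (b : UTakiff) (k0 : ∀ v ∈ V, b • v ∈ W) (k1 : ∀ v ∈ V, b • F • v ∈ W)
      (k2 : ∀ v ∈ V, b • Fb • v ∈ W) : ∀ v ∈ W, b • v ∈ W := by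
    have : W ≤ W.comap (Algebra.lsmul ℂ ℂ M b) := by
      refine sup_le (fun v hv => k0 v hv) (sup_le ?_ ?_)
      · rintro _ ⟨v, hv, rfl⟩
        exact k1 v hv
      · rintro _ ⟨v, hv, rfl⟩
        exact k2 v hv
    exact this
  refine ⟨key _ (fun v hv => h0 (hV.H v hv)) ?_ ?_, key _ (fun v hv => h0 (hV.Hb v hv)) ?_ ?_,
    key _ (fun v hv => h0 (hV.E v hv)) ?_ ?_, key _ (fun v hv => h0 (hV.Eb v hv)) ?_ ?_⟩ <;>
    intro v hv
  · rw [smul_smul_swap H_mul_F, smul_assoc]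
    exact W.add_mem (h1 (hV.H v hv)) (W.smul_mem _ (h1 hv))
  · rw [smul_smul_swap H_mul_Fb, smul_assoc]
    exact W.add_mem (h2 (hV.H v hv)) (W.smul_mem _ (h2 hv))
  · rw [smul_smul_swap Hb_mul_F, smul_assoc]
    exact W.add_mem (h1 (hV.Hb v hv)) (W.smul_mem _ (h2 hv))
  · rw [smul_smul_comm' Hb_mul_Fb]
    exact h2 (hV.Hb v hv)
  · rw [smul_smul_swap E_mul_F]
    exact W.add_mem (h1 (hV.E v hv)) (h0 (hV.H v hv))
  · rw [smul_smul_swap E_mul_Fb]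
    exact W.add_mem (h2 (hV.E v hv)) (h0 (hV.Hb v hv))
  · rw [smul_smul_swap Eb_mul_F]
    exact W.add_mem (h1 (hV.Eb v hv)) (h0 (hV.Hb v hv))
  · rw [smul_smul_comm' Eb_mul_Fb]
    exact h2 (hV.Eb v hv)

variable (M) in
/-- The vectors on which the Borel subalgebra acts locally finitely. -/
def locallyFinitePart : Submodule ℂ M where
  carrier := {m | (borelOrbit m).FG}
  zero_mem' := fg_borelOrbit_of_mem (V := ⊥)
    ⟨by simp, by simp, by simp, by simp⟩ Submodule.fg_bot (Submodule.zero_mem _)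
  add_mem' {a b} ha hb :=
    fg_borelOrbit_of_mem ((borelStable_borelOrbit a).sup (borelStable_borelOrbit b)) (ha.sup hb)
      (Submodule.add_mem_sup (mem_borelOrbit_self a) (mem_borelOrbit_self b))
  smul_mem' c a ha :=
    fg_borelOrbit_of_mem (borelStable_borelOrbit a) ha
      (Submodule.smul_mem _ c (mem_borelOrbit_self a))

/-- The locally finite part is a submodule over the enveloping algebra. -/
lemma smul_mem_locallyFinitePart (u : UTakiff) {m : M} (hm : m ∈ locallyFinitePart M) :
    u • m ∈ locallyFinitePart M := by
  have key {b : UTakiff} {v : M} (hv : (borelOrbit v).FG)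
      (h : b • v ∈ borelOrbit v ⊔ ((borelOrbit v).map (Algebra.lsmul ℂ ℂ M F) ⊔
        (borelOrbit v).map (Algebra.lsmul ℂ ℂ M Fb))) : (borelOrbit (b • v)).FG :=
    fg_borelOrbit_of_mem (borelStable_borelOrbit v).enlarge
      (hv.sup ((hv.map _).sup (hv.map _))) h
  have hst (v : M) := borelStable_borelOrbit v
  have hv0 (v : M) := mem_borelOrbit_self v
  have htop : stabilizer (locallyFinitePart M) = ⊤ := by
    apply subalgebra_eq_top
    · exact fun v hv => key hv (Submodule.mem_sup_left ((hst v).E _ (hv0 v)))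
    · exact fun v hv => key hv (Submodule.mem_sup_left ((hst v).H _ (hv0 v)))
    · exact fun v hv => key hv (Submodule.mem_sup_right
        (Submodule.mem_sup_left ⟨v, hv0 v, rfl⟩))
    · exact fun v hv => key hv (Submodule.mem_sup_left ((hst v).Eb _ (hv0 v)))
    · exact fun v hv => key hv (Submodule.mem_sup_left ((hst v).Hb _ (hv0 v)))
    · exact fun v hv => key hv (Submodule.mem_sup_right
        (Submodule.mem_sup_right ⟨v, hv0 v, rfl⟩))
  have : u ∈ stabilizer (locallyFinitePart M) := htop ▸ Algebra.mem_top
  exact this m hm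

/-- A module generated by locally finite vectors is locally finite. -/
lemma locallyBorelFinite_of_span {S : Set M} (hS : Submodule.span UTakiff S = ⊤)
    (h : ∀ s ∈ S, (borelOrbit s).FG) : LocallyBorelFinite M := by
  intro m
  have hm : m ∈ Submodule.span UTakiff S := hS ▸ Submodule.mem_top
  change m ∈ locallyFinitePart M
  induction hm using Submodule.span_induction with
  | mem s hs => exact h s hs
  | zero => exact Submodule.zero_mem _
  | add x y _ _ hx hy => exact Submodule.add_mem _ hx hy
  | smul u x _ hx => exact smul_mem_locallyFinitePart u hx

lemma map_smul_complex (g : M →ₗ[UTakiff] N) (c : ℂ) (m : M) : g (c • m) = c • g m := by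
  rw [← algebraMap_smul UTakiff c m, map_smul, algebraMap_smul]

/-- A homomorphism of modules as a complex linear map. -/
def toComplexLinear (g : M →ₗ[UTakiff] N) : M →ₗ[ℂ] N where
  toFun := g
  map_add' := map_add g
  map_smul' := map_smul_complex g

lemma borelOrbit_map (g : M →ₗ[UTakiff] N) (m : M) :
    borelOrbit (g m) = (borelOrbit m).map (toComplexLinear g) := by
  ext n
  simp only [mem_borelOrbit, Submodule.mem_map]
  constructor
  · rintro ⟨u, hu, rfl⟩
    exact ⟨u • m, ⟨u, hu, rfl⟩, map_smul g u m⟩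
  · rintro ⟨_, ⟨u, hu, rfl⟩, rfl⟩
    exact ⟨u, hu, (map_smul g u m).symm⟩

lemma LocallyBorelFinite.of_surjective (hM : LocallyBorelFinite M) (g : M →ₗ[UTakiff] N)
    (hg : Function.Surjective g) : LocallyBorelFinite N := by
  intro n
  obtain ⟨m, rfl⟩ := hg n
  rw [borelOrbit_map]
  exact (hM m).map _

lemma LocallyBorelFinite.of_injective (hN : LocallyBorelFinite N) (g : M →ₗ[UTakiff] N)
    (hg : Function.Injective g) : LocallyBorelFinite M := by
  intro m
  have := hN (g m)
  rw [borelOrbit_map] at this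
  exact Submodule.fg_of_fg_map_injective (toComplexLinear g) hg this

lemma LocallyBorelFinite.prod (hM : LocallyBorelFinite M) (hN : LocallyBorelFinite N) :
    LocallyBorelFinite (M × N) := by
  rintro ⟨m, n⟩
  refine ((hM m).prod (hN n)).of_le ?_
  intro x hx
  obtain ⟨u, hu, rfl⟩ := mem_borelOrbit.1 hx
  exact ⟨mem_borelOrbit.2 ⟨u, hu, rfl⟩, mem_borelOrbit.2 ⟨u, hu, rfl⟩⟩

/-- A finitely generated locally finite module is noetherian: it is finitely generated over the
commutative algebra generated by `f` and `f ⊗ x`. -/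
lemma isNoetherian_of_locallyBorelFinite [Module.Finite UTakiff M] (hM : LocallyBorelFinite M) :
    IsNoetherian UTakiff M := by
  classical
  obtain ⟨S, hS⟩ := Module.Finite.fg_top (R := UTakiff) (M := M)
  let V : Submodule ℂ M := ⨆ s ∈ S, borelOrbit s
  have hVfg : V.FG := Submodule.fg_biSup S _ fun s _ => hM s
  have hSV : ∀ s ∈ S, s ∈ V := fun s hs =>
    (le_iSup₂_of_le s hs le_rfl : borelOrbit s ≤ V) (mem_borelOrbit_self s)
  have hV : BorelStable V := by
    have key (b : UTakiff) (hb : ∀ s, ∀ v ∈ borelOrbit (M := M) s, b • v ∈ borelOrbit s) :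
        ∀ v ∈ V, b • v ∈ V := by
      have : V ≤ V.comap (Algebra.lsmul ℂ ℂ M b) :=
        iSup₂_le fun s hs v hv =>
          (le_iSup₂_of_le s hs le_rfl : borelOrbit s ≤ V) (hb s v hv)
      exact this
    exact ⟨key _ fun s => (borelStable_borelOrbit s).H, key _ fun s => (borelStable_borelOrbit s).Hb,
      key _ fun s => (borelStable_borelOrbit s).E, key _ fun s => (borelStable_borelOrbit s).Eb⟩
  let A : Subalgebra ℂ UTakiff := Algebra.adjoin ℂ {F, Fb}
  obtain ⟨WC, hVW, hAW, hmin, hnoeth⟩ :=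
    exists_closure A (isNoetherianRing_adjoin_pair F_mul_Fb) V hVfg
  have hF : ∀ w ∈ WC, F • w ∈ WC := hAW F (Algebra.subset_adjoin (by simp))
  have hFb : ∀ w ∈ WC, Fb • w ∈ WC := hAW Fb (Algebra.subset_adjoin (by simp))
  have hB : ∀ w ∈ WC, H • w ∈ WC ∧ Hb • w ∈ WC ∧ E • w ∈ WC ∧ Eb • w ∈ WC := by
    let W' : Submodule ℂ M := WC ⊓ (WC.comap (Algebra.lsmul ℂ ℂ M H) ⊓
      (WC.comap (Algebra.lsmul ℂ ℂ M Hb) ⊓ (WC.comap (Algebra.lsmul ℂ ℂ M E) ⊓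
        WC.comap (Algebra.lsmul ℂ ℂ M Eb))))
    have hW' (w : M) : w ∈ W' ↔ w ∈ WC ∧ H • w ∈ WC ∧ Hb • w ∈ WC ∧ E • w ∈ WC ∧ Eb • w ∈ WC := by
      simp [W']
    have hFW (w : M) (hw : w ∈ W') : F • w ∈ W' := by
      rw [hW'] at hw ⊢
      obtain ⟨h0, h1, h2, h3, h4⟩ := hw
      rw [smul_smul_swap H_mul_F, smul_smul_swap Hb_mul_F, smul_smul_swap E_mul_F,
        smul_smul_swap Eb_mul_F, smul_assoc, smul_assoc]
      exact ⟨hF _ h0, WC.add_mem (hF _ h1) (WC.smul_mem _ (hF _ h0)),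
        WC.add_mem (hF _ h2) (WC.smul_mem _ (hFb _ h0)), WC.add_mem (hF _ h3) h1,
        WC.add_mem (hF _ h4) h2⟩
    have hFbW (w : M) (hw : w ∈ W') : Fb • w ∈ W' := by
      rw [hW'] at hw ⊢
      obtain ⟨h0, h1, h2, h3, h4⟩ := hw
      rw [smul_smul_swap H_mul_Fb, smul_smul_comm' Hb_mul_Fb, smul_smul_swap E_mul_Fb,
        smul_smul_comm' Eb_mul_Fb, smul_assoc]
      exact ⟨hFb _ h0, WC.add_mem (hFb _ h1) (WC.smul_mem _ (hFb _ h0)), hFb _ h2,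
        WC.add_mem (hFb _ h3) h2, hFb _ h4⟩
    have hAW' : A ≤ stabilizer W' := by
      refine Algebra.adjoin_le ?_
      rintro u (rfl | rfl)
      exacts [hFW, hFbW]
    have hVW' : V ≤ W' := fun v hv => (hW' v).2 ⟨hVW hv, hVW (hV.H v hv), hVW (hV.Hb v hv),
      hVW (hV.E v hv), hVW (hV.Eb v hv)⟩
    exact fun w hw => ((hW' w).1 (hmin W' hVW' hAW' hw)).2
  have htop : stabilizer WC = ⊤ :=
    subalgebra_eq_top _ (fun w hw => (hB w hw).2.2.1) (fun w hw => (hB w hw).1) hF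
      (fun w hw => (hB w hw).2.2.2) (fun w hw => (hB w hw).2.1) hFb
  refine hnoeth (Submodule.eq_top_iff'.2 fun m => ?_)
  have hm : m ∈ Submodule.span UTakiff (S : Set M) := hS ▸ Submodule.mem_top
  induction hm using Submodule.span_induction with
  | mem s hs => exact hVW (hSV s hs)
  | zero => exact Submodule.zero_mem _
  | add x y _ _ hx hy => exact Submodule.add_mem _ hx hy
  | smul u x _ hx =>
    have : u ∈ stabilizer WC := htop ▸ Algebra.mem_top
    exact this x hx

/-! #### Weight spaces under homomorphisms -/

/-- A linear map intertwining two endomorphisms respects their generalized eigenspaces. -/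
lemma map_mem_maxGenEigenspace {A B : Type*} [AddCommGroup A] [Module ℂ A] [AddCommGroup B]
    [Module ℂ B] (g : A →ₗ[ℂ] B) (x : Module.End ℂ A) (y : Module.End ℂ B)
    (h : ∀ a, g (x a) = y (g a)) (c : ℂ) {a : A} :
    (a ∈ x.maxGenEigenspace c → g a ∈ y.maxGenEigenspace c) ∧
      (Function.Injective g → g a ∈ y.maxGenEigenspace c → a ∈ x.maxGenEigenspace c) := by
  have key (k : ℕ) (a : A) : g (((x - c • (1 : Module.End ℂ A)) ^ k) a) =
      ((y - c • (1 : Module.End ℂ B)) ^ k) (g a) := by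
    induction k generalizing a with
    | zero => simp
    | succ k ih =>
      rw [pow_succ, pow_succ, Module.End.mul_apply, Module.End.mul_apply, ih]
      simp [h]
  simp only [Module.End.mem_maxGenEigenspace]
  refine ⟨fun ⟨k, hk⟩ => ⟨k, ?_⟩, fun hg ⟨k, hk⟩ => ⟨k, hg ?_⟩⟩
  · rw [← key, hk, map_zero]
  · rw [key, hk, map_zero]

lemma map_mem_genWeightSpace (g : M →ₗ[UTakiff] N) {μ : Weight} {m : M}
    (hm : m ∈ genWeightSpace M μ) : g m ∈ genWeightSpace N μ :=
  ⟨(map_mem_maxGenEigenspace (toComplexLinear g) _ _ (fun a => map_smul g H a) _).1 hm.1,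
    (map_mem_maxGenEigenspace (toComplexLinear g) _ _ (fun a => map_smul g Hb a) _).1 hm.2⟩

lemma weightSupport_subset_of_injective (g : M →ₗ[UTakiff] N) (hg : Function.Injective g) :
    weightSupport M ⊆ weightSupport N := by
  intro μ hμ
  obtain ⟨m, hm, hm0⟩ := (Submodule.ne_bot_iff _).1 hμ
  exact (Submodule.ne_bot_iff _).2
    ⟨g m, map_mem_genWeightSpace g hm, fun h => hm0 (hg (h.trans (map_zero g).symm))⟩

lemma weightSupport_prod : weightSupport (M × N) ⊆ weightSupport M ∪ weightSupport N := by
  intro μ hμ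
  obtain ⟨⟨m, n⟩, hmn, h0⟩ := (Submodule.ne_bot_iff _).1 hμ
  by_cases hm : m = 0
  · refine Or.inr ((Submodule.ne_bot_iff _).2
      ⟨n, map_mem_genWeightSpace (LinearMap.snd UTakiff M N) hmn, ?_⟩)
    rintro rfl
    exact h0 (by rw [hm]; rfl)
  · exact Or.inl ((Submodule.ne_bot_iff _).2
      ⟨m, map_mem_genWeightSpace (LinearMap.fst UTakiff M N) hmn, hm⟩)

variable (M) in
/-- The actions of `h` and of `h ⊗ x`. -/
def cartanFamily : Fin 2 → Module.End ℂ M := ![Algebra.lsmul ℂ ℂ M H, Algebra.lsmul ℂ ℂ M Hb]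

lemma iInf_cartanFamily (χ : Fin 2 → ℂ) :
    ⨅ i, (cartanFamily M i).maxGenEigenspace (χ i) = genWeightSpace M (χ 0, χ 1) := by
  ext m
  simp only [Submodule.mem_iInf, Fin.forall_fin_two]
  rfl

lemma commute_cartanFamily (i j : Fin 2) : Commute (cartanFamily M i) (cartanFamily M j) := by
  have h : Commute (Algebra.lsmul ℂ ℂ M H) (Algebra.lsmul ℂ ℂ M Hb) := by
    have := congrArg (Algebra.lsmul ℂ ℂ M) H_mul_Hb
    rwa [map_mul, map_mul] at this
  fin_cases i <;> fin_cases j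
  exacts [Commute.refl _, h, h.symm, Commute.refl _]

lemma iSup_genWeightSpace (hM : LocallyBorelFinite M) :
    ⨆ χ : Fin 2 → ℂ, genWeightSpace M (χ 0, χ 1) = ⊤ := by
  simp only [← iInf_cartanFamily]
  refine Submodule.eq_top_iff'.2 fun m => ?_
  have hfin : FiniteDimensional ℂ (borelOrbit m) := Module.Finite.iff_fg.2 (hM m)
  have hst (i : Fin 2) : Set.MapsTo (cartanFamily M i) (borelOrbit m) (borelOrbit m) := by
    fin_cases i
    exacts [(borelStable_borelOrbit m).H, (borelStable_borelOrbit m).Hb]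
  have htop := Module.End.iSup_iInf_maxGenEigenspace_eq_top_of_iSup_maxGenEigenspace_eq_top_of_commute
    (fun i => (cartanFamily M i).restrict (hst i))
    (fun i j _ => by
      ext v
      exact congrArg (fun φ : Module.End ℂ M => φ v) (commute_cartanFamily i j).eq)
    (fun i => Module.End.iSup_maxGenEigenspace_eq_top _)
  have hm : m ∈ (⊤ : Submodule ℂ (borelOrbit m)).map (borelOrbit m).subtype :=
    ⟨⟨m, mem_borelOrbit_self m⟩, trivial, rfl⟩
  rw [← htop, Submodule.map_iSup] at hm
  have hle (χ : Fin 2 → ℂ) :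
      (⨅ i, Module.End.maxGenEigenspace ((cartanFamily M i).restrict (hst i)) (χ i)).map
        (borelOrbit m).subtype ≤ ⨅ i, (cartanFamily M i).maxGenEigenspace (χ i) := by
    rw [← Submodule.inf_iInf_maxGenEigenspace_of_forall_mapsTo]
    exact inf_le_right
  exact iSup_mono hle hm

lemma weightSupport_subset_of_surjective (hM : LocallyBorelFinite M) (g : M →ₗ[UTakiff] N)
    (hg : Function.Surjective g) : weightSupport N ⊆ weightSupport M := by
  intro μ hμ hμM
  apply hμ
  have hind : iSupIndep fun χ : Fin 2 → ℂ => genWeightSpace N (χ 0, χ 1) := by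
    simp only [← iInf_cartanFamily]
    exact Module.End.independent_iInf_maxGenEigenspace_of_forall_mapsTo _ fun i j φ =>
      Module.End.mapsTo_maxGenEigenspace_of_comm (commute_cartanFamily j i) φ
  have hdis := hind ![μ.1, μ.2]
  refine hdis.eq_bot_of_le ?_
  intro n _
  obtain ⟨m, rfl⟩ := hg n
  have hm : m ∈ ⨆ χ : Fin 2 → ℂ, genWeightSpace M (χ 0, χ 1) :=
    iSup_genWeightSpace hM ▸ Submodule.mem_top
  have hle : ⨆ χ : Fin 2 → ℂ, genWeightSpace M (χ 0, χ 1) ≤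
      (⨆ (χ : Fin 2 → ℂ) (_ : χ ≠ ![μ.1, μ.2]), genWeightSpace N (χ 0, χ 1)).comap
        (toComplexLinear g) := by
    refine iSup_le fun χ m hm => ?_
    by_cases hχ : χ = ![μ.1, μ.2]
    · subst hχ
      have h0 : m ∈ genWeightSpace M μ := hm
      rw [hμM] at h0
      rw [(Submodule.mem_bot ℂ).1 h0]
      exact Submodule.zero_mem _
    · exact (le_iSup₂_of_le χ hχ le_rfl :
        genWeightSpace N (χ 0, χ 1) ≤ _) (map_mem_genWeightSpace g hm)
  exact hle hm

end Modules

/-! ### Thick category `O` and its blocks -/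

section Categories

attribute [local instance] ModuleCat.moduleOfAlgebraModule ModuleCat.isScalarTower_of_algebra_moduleCat

/-- Membership in thick category `O`: the finitely generated modules on which `U(b̄)` acts locally
finitely. -/
def thickO : ObjectProperty (ModuleCat.{0} UTakiff) :=
  fun M => Module.Finite UTakiff M ∧ LocallyBorelFinite M

/-- Membership in the full subcategory of thick category `O` of modules with support in `ξ`. -/
def thickBlock (ξ : Set Weight) : ObjectProperty (ModuleCat.{0} UTakiff) :=
  fun M => thickO M ∧ weightSupport M ⊆ ξ

/-- Thick category `O`. -/
abbrev ThickO : Type 1 := thickO.FullSubcategory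

/-- The category of modules in thick category `O` whose support is contained in `ξ`. -/
abbrev ThickBlock (ξ : Set Weight) : Type 1 := (thickBlock ξ).FullSubcategory

lemma thickO_of_injective {X Y : ModuleCat.{0} UTakiff} (g : X →ₗ[UTakiff] Y)
    (hg : Function.Injective g) (hY : thickO Y) : thickO X := by
  have := hY.1
  have := isNoetherian_of_locallyBorelFinite hY.2
  exact ⟨Module.Finite.of_injective g hg, hY.2.of_injective g hg⟩

lemma thickO_of_surjective {X Y : ModuleCat.{0} UTakiff} (g : X →ₗ[UTakiff] Y)
    (hg : Function.Surjective g) (hX : thickO X) : thickO Y := by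
  have := hX.1
  exact ⟨Module.Finite.of_surjective g hg, hX.2.of_surjective g hg⟩

instance : thickO.IsClosedUnderSubobjects where
  prop_of_mono g _ hY := thickO_of_injective g.hom ((ModuleCat.mono_iff_injective g).1 ‹_›) hY

instance : thickO.IsClosedUnderQuotients where
  prop_of_epi g _ hX := thickO_of_surjective g.hom ((ModuleCat.epi_iff_surjective g).1 ‹_›) hX

instance (ξ : Set Weight) : (thickBlock ξ).IsClosedUnderSubobjects where
  prop_of_mono g _ hY :=
    ⟨thickO.prop_of_mono g hY.1, (weightSupport_subset_of_injective g.hom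
      ((ModuleCat.mono_iff_injective g).1 ‹_›)).trans hY.2⟩

instance (ξ : Set Weight) : (thickBlock ξ).IsClosedUnderQuotients where
  prop_of_epi g _ hX :=
    ⟨thickO.prop_of_epi g hX.1, (weightSupport_subset_of_surjective hX.1.2 g.hom
      ((ModuleCat.epi_iff_surjective g).1 ‹_›)).trans hX.2⟩

lemma thickBlock_of_subsingleton (ξ : Set Weight) (X : ModuleCat.{0} UTakiff) [Subsingleton X] :
    thickBlock ξ X := by
  refine ⟨⟨inferInstance, fun m => ?_⟩, fun μ hμ => ?_⟩
  · rw [Subsingleton.elim (borelOrbit m) ⊥]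
    exact Submodule.fg_bot
  · exact absurd (Subsingleton.elim _ _) hμ

lemma containsZero_of_subsingleton (P : ObjectProperty (ModuleCat.{0} UTakiff))
    (h : ∀ X : ModuleCat.{0} UTakiff, Subsingleton X → P X) : P.ContainsZero where
  exists_zero := ⟨ModuleCat.of UTakiff PUnit, ModuleCat.isZero_of_subsingleton _,
    h _ (inferInstanceAs (Subsingleton PUnit))⟩

instance : thickO.ContainsZero :=
  containsZero_of_subsingleton _ fun X _ => (thickBlock_of_subsingleton ∅ X).1

instance (ξ : Set Weight) : (thickBlock ξ).ContainsZero :=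
  containsZero_of_subsingleton _ fun X _ => thickBlock_of_subsingleton ξ X

/-- A module with two jointly injective maps to modules in thick category `O`. -/
lemma thickO_of_jointly_injective {X Y Z : ModuleCat.{0} UTakiff} (p : Z →ₗ[UTakiff] X)
    (q : Z →ₗ[UTakiff] Y) (h : Function.Injective (p.prod q)) (hX : thickO X) (hY : thickO Y) :
    thickO Z ∧ weightSupport Z ⊆ weightSupport X ∪ weightSupport Y := by
  have := hX.1
  have := hY.1
  have := isNoetherian_of_locallyBorelFinite hX.2
  have := isNoetherian_of_locallyBorelFinite hY.2
  exact ⟨⟨Module.Finite.of_injective _ h, (hX.2.prod hY.2).of_injective _ h⟩,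
    (weightSupport_subset_of_injective _ h).trans weightSupport_prod⟩

lemma closedUnderFiniteProducts (P : ObjectProperty (ModuleCat.{0} UTakiff)) [P.ContainsZero]
    [P.IsClosedUnderIsomorphisms]
    (h : ∀ (X Y Z : ModuleCat.{0} UTakiff) (p : Z →ₗ[UTakiff] X) (q : Z →ₗ[UTakiff] Y),
      Function.Injective (p.prod q) → P X → P Y → P Z) : P.IsClosedUnderFiniteProducts := by
  have : P.IsClosedUnderBinaryProducts := by
    refine ⟨?_⟩
    rintro Z ⟨pr⟩
    have hfst := pr.prop_diag_obj ⟨WalkingPair.left⟩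
    have hsnd := pr.prop_diag_obj ⟨WalkingPair.right⟩
    refine h _ _ Z (pr.π.app ⟨WalkingPair.left⟩).hom (pr.π.app ⟨WalkingPair.right⟩).hom ?_ hfst hsnd
    intro a b hab
    have h1 := congrArg Prod.fst hab
    have h2 := congrArg Prod.snd hab
    let u (z : Z) : ModuleCat.of UTakiff UTakiff ⟶ Z :=
      ModuleCat.ofHom (LinearMap.toSpanSingleton UTakiff Z z)
    have huv : u a = u b := by
      apply pr.isLimit.hom_ext
      rintro ⟨_ | _⟩
      · ext
        simpa [u] using h1
      · ext
        simpa [u] using h2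
    have := congrArg (fun φ => φ.hom (1 : UTakiff)) huv
    simpa [u] using this
  exact ObjectProperty.IsClosedUnderFiniteProducts.mk'

instance : thickO.IsClosedUnderFiniteProducts :=
  closedUnderFiniteProducts _ fun _ _ _ p q h hX hY => (thickO_of_jointly_injective p q h hX hY).1

instance (ξ : Set Weight) : (thickBlock ξ).IsClosedUnderFiniteProducts :=
  closedUnderFiniteProducts _ fun _ _ _ p q h hX hY =>
    ⟨(thickO_of_jointly_injective p q h hX.1 hY.1).1,
      (thickO_of_jointly_injective p q h hX.1 hY.1).2.trans (Set.union_subset hX.2 hY.2)⟩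

/-! ### Verma modules and simple highest weight modules -/

/-- The left ideal of the enveloping algebra generated by `e`, `e ⊗ x`, `h - μ(h)` and
`h ⊗ x - μ(h ⊗ x)`. -/
def vermaIdeal (μ : Weight) : Submodule UTakiff UTakiff :=
  Submodule.span UTakiff
    {E, Eb, H - algebraMap ℂ UTakiff μ.1, Hb - algebraMap ℂ UTakiff μ.2}

/-- The Verma module `Δ(μ)`, i.e. the module induced from the one-dimensional module of the Borel
subalgebra on which `h`, `h ⊗ x` act via `μ` and `e`, `e ⊗ x` act by zero. -/
abbrev Verma (μ : Weight) : Type := UTakiff ⧸ vermaIdeal μ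

/-- The sum of all proper submodules of the Verma module. -/
def vermaRadical (μ : Weight) : Submodule UTakiff (Verma μ) := sSup {N | N ≠ ⊤}

/-- The simple quotient `L(μ)` of the Verma module. -/
def simpleModule (μ : Weight) : ModuleCat.{0} UTakiff :=
  ModuleCat.of UTakiff (Verma μ ⧸ vermaRadical μ)

/-- A module generated by a highest weight vector is in thick category `O`. -/
lemma thickO_of_highestWeight (X : ModuleCat.{0} UTakiff) (μ : Weight) (v : X)
    (hv : Submodule.span UTakiff {v} = ⊤) (hE : E • v = 0) (hEb : Eb • v = 0)
    (hH : H • v = μ.1 • v) (hHb : Hb • v = μ.2 • v) : thickO X := by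
  refine ⟨⟨{v}, by simpa using hv⟩, locallyBorelFinite_of_span hv ?_⟩
  intro s hs
  rw [Set.mem_singleton_iff.1 hs]
  have key (b : UTakiff) (c : ℂ) (hb : b • v = c • v) :
      ∀ w ∈ Submodule.span ℂ {v}, b • w ∈ Submodule.span ℂ {v} := by
    intro w hw
    obtain ⟨r, rfl⟩ := Submodule.mem_span_singleton.1 hw
    rw [smul_comm, hb]
    exact Submodule.smul_mem _ _ (Submodule.smul_mem _ _ (Submodule.mem_span_singleton_self v))
  exact fg_borelOrbit_of_mem (V := Submodule.span ℂ {v})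
    ⟨key _ _ hH, key _ _ hHb, key _ 0 (by rw [hE, zero_smul]), key _ 0 (by rw [hEb, zero_smul])⟩
    (Submodule.fg_span_singleton v) (Submodule.mem_span_singleton_self v)

lemma thickO_simpleModule (μ : Weight) : thickO (simpleModule μ) := by
  have hz {u : UTakiff} (hu : u ∈ vermaIdeal μ) :
      u • ((vermaRadical μ).mkQ ((vermaIdeal μ).mkQ 1)) = 0 := by
    rw [← map_smul, ← map_smul, smul_eq_mul, mul_one, Submodule.mkQ_apply (vermaIdeal μ),
      (Submodule.Quotient.mk_eq_zero _).2 hu, map_zero]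
  refine thickO_of_highestWeight (simpleModule μ) μ
    ((vermaRadical μ).mkQ ((vermaIdeal μ).mkQ 1)) ?_ ?_ ?_ ?_ ?_
  · refine Submodule.eq_top_iff'.2 fun x => ?_
    obtain ⟨y, rfl⟩ := (vermaRadical μ).mkQ_surjective x
    obtain ⟨u, rfl⟩ := (vermaIdeal μ).mkQ_surjective y
    refine Submodule.mem_span_singleton.2 ⟨u, ?_⟩
    exact (by rw [← map_smul, ← map_smul, smul_eq_mul, mul_one] :
      u • ((vermaRadical μ).mkQ ((vermaIdeal μ).mkQ 1)) =
        (vermaRadical μ).mkQ ((vermaIdeal μ).mkQ u))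
  · exact hz (Submodule.subset_span (by simp))
  · exact hz (Submodule.subset_span (by simp))
  · have := hz (u := H - algebraMap ℂ UTakiff μ.1) (Submodule.subset_span (by simp))
    rw [sub_smul] at this
    exact sub_eq_zero.1 this
  · have := hz (u := Hb - algebraMap ℂ UTakiff μ.2) (Submodule.subset_span (by simp))
    rw [sub_smul] at this
    exact sub_eq_zero.1 this

/-- `L(μ)` as an object of thick category `O`. -/
def simpleO (μ : Weight) : ThickO := ⟨simpleModule μ, thickO_simpleModule μ⟩

end Categories

end Takiff

/-! ### First extension spaces and Gabriel quivers -/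

section Gabriel

universe v u

variable {C : Type u} [Category.{v} C] [Abelian C]

/-- The first extension group in an abelian category. -/
def ExtOne (X Y : C) : Type (max u v) :=
  letI := HasExt.standard C
  Abelian.Ext X Y 1

instance (X Y : C) : AddCommGroup (ExtOne X Y) :=
  letI := HasExt.standard C
  inferInstanceAs (AddCommGroup (Abelian.Ext X Y 1))

instance [Linear ℂ C] (X Y : C) : Module ℂ (ExtOne X Y) :=
  letI := HasExt.standard C
  inferInstanceAs (Module ℂ (Abelian.Ext X Y 1))

variable (C) in
/-- The vertices of the Gabriel quiver: isomorphism classes of simple objects. -/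
structure GabrielQuiver where
  /-- The isomorphism class. -/
  isoClass : Skeleton C
  /-- Its members are simple. -/
  simple : Simple ((fromSkeleton C).obj isoClass)

/-- A representative of a vertex. -/
def GabrielQuiver.rep (a : GabrielQuiver C) : C := (fromSkeleton C).obj a.isoClass

/-- The number of arrows from `L` to `S` is the dimension of `Ext¹(L, S)`. -/
instance [Linear ℂ C] : Quiver (GabrielQuiver C) where
  Hom a b := (Module.rank ℂ (ExtOne a.rep b.rep)).out

end Gabriel

/-- The vertices of the infinite line: the integers. -/
structure TwoLoopLine where
  /-- The position on the line. -/
  pos : ℤ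

/-- Two loops at every vertex, one arrow from each vertex to each of its two neighbours. -/
instance : Quiver TwoLoopLine where
  Hom i j := Fin (if j.pos = i.pos then 2
    else if j.pos = i.pos + 1 ∨ j.pos = i.pos - 1 then 1 else 0)

end

/-!
For a weight with `λ(h) = c` nonintegral and `λ(h ⊗ x) = 0`, the simple module `L(λ)` is the Verma
module `M(c)` of `sl₂`, simple as `c` is nonintegral, with `sl₂ ⊗ x` acting by zero. It is realized
on polynomials, `f` acting as `z`, `h` as `c - 2z∂` and `e` as `c∂ - z∂²`. The category does
not have enough projective objects, so `Ext¹(M(c), M(d))` is computed from a *universal extension*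
`0 → K → U → M(c) → 0` with `K = M(c) ⊕ M(c) ⊕ M(c + 2) ⊕ M(c - 2)`. Its extension class consists of
the deformation of the highest weight `c` (the first summand) and of the three homomorphisms of
`sl₂`-modules from `sl₂ ⊗ M(c)` to `M(c)`, `M(c + 2)` and `M(c - 2)`, by which `sl₂ ⊗ x` maps the
quotient into the kernel.

Two facts make `U` work like a projective cover. The map `U → M(c)` lifts through every extension of
`M(c)` by some `M(d)` (`Takiff.exists_lift_univExt`): a lift of the highest weight vector can be
chosen to be killed by `e`, since `e` is surjective on `M(d)` for nonintegral `d`, and the remaining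
relations leave one scalar for each summand of `K` isomorphic to `M(d)`. And every homomorphism from
`U` to some `M(d)` kills `K` (`Takiff.comp_univIncl_eq_zero`). It follows that
`Ext¹(M(c), M(d))` is `Hom(K, M(d))` (`nonempty_extOne_equiv_hom`), where the passage from `Ext¹` in
the derived category to actual extensions holds in any abelian category, by effacing a class along
an epimorphism (`exists_extension_comp_ext_one_eq_zero`). The dimension of `Hom(K, M(d))` is the
number of summands of `K` isomorphic to `M(d)`: two for `d = c`, one for `d = c ± 2`, and zero
otherwise.

All this happens inside thick category `O` and inside each block, because `U` belongs to both.
Finally, a simple object of the block contains a highest weight vector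
(`Takiff.exists_isHighestWeight`) and is therefore some `M(c + 2n)`
(`Takiff.nonempty_equiv_polyVerma`), and these are pairwise nonisomorphic.
-/

noncomputable section

/-! ### Extension groups from a relatively projective cover -/

section YonedaExt

universe w v u

variable {C : Type u} [Category.{v} C] [Abelian C]

open Abelian DerivedCategory

/-- A quasi-isomorphism onto an object in degree zero, from a complex living in degrees `≤ 0`, is an
epimorphism in degree zero. -/
lemma epi_f_of_quasiIso_single {X : C} {K : CochainComplex C ℤ} [K.IsStrictlyLE 0]
    (s : K ⟶ (CochainComplex.singleFunctor C 0).obj X) [QuasiIso s] : Epi (s.f 0) := by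
  let L := (CochainComplex.singleFunctor C 0).obj X
  have h1 : L.d (-1) 0 = 0 := (L.isZero_of_isStrictlyGE 0 (-1) (by omega)).eq_of_src _ _
  have h2 : L.d 0 1 = 0 := (L.isZero_of_isStrictlyLE 0 1 (by omega)).eq_of_tgt _ _
  have i1 : IsIso (L.homologyπ 0) := L.isIso_homologyπ (-1) 0 (by simp) h1
  have i2 : IsIso (L.iCycles 0) := L.isIso_iCycles 0 1 (by simp) h2
  have e1 : Epi (HomologicalComplex.cyclesMap s 0 ≫ L.homologyπ 0) := by
    rw [← HomologicalComplex.homologyπ_naturality]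
    infer_instance
  have e2 : Epi (HomologicalComplex.cyclesMap s 0) := by
    have : HomologicalComplex.cyclesMap s 0 =
      (HomologicalComplex.cyclesMap s 0 ≫ L.homologyπ 0) ≫ inv (L.homologyπ 0) := by simp
    rw [this]
    infer_instance
  have e3 : Epi (K.iCycles 0 ≫ s.f 0) := by
    rw [← HomologicalComplex.cyclesMap_i]
    exact epi_comp _ _
  exact epi_of_epi (K.iCycles 0) (s.f 0)

/-- Every class in `Ext¹(X, Y)` is effaced by an epimorphism onto `X`: represent it by a roof
`X ⟵ K ⟶ Y[1]` with `K` in degrees `≤ 0`, and take `K⁰ ⟶ X`. No enough-projectives assumption is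
needed. -/
lemma exists_epi_comp_ext_one_eq_zero [HasExt.{w} C] {X Y : C} (x : Ext X Y 1) :
    ∃ (E : C) (p : E ⟶ X), Epi p ∧ (Ext.mk₀ p).comp x (zero_add 1) = 0 := by
  let := HasDerivedCategory.standard C
  let eX := (singleFunctorIsoCompQ C 0)
  let Y₀ := (CochainComplex.singleFunctor C 0).obj Y
  let t : ((singleFunctor C 0).obj Y)⟦(1 : ℤ)⟧ ≅ Q.obj (Y₀⟦(1 : ℤ)⟧) :=
    (shiftFunctor (DerivedCategory C) (1 : ℤ)).mapIso (eX.app Y) ≪≫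
      (Q.commShiftIso (1 : ℤ)).symm.app Y₀
  let f : Q.obj ((CochainComplex.singleFunctor C 0).obj X) ⟶ Q.obj (Y₀⟦(1 : ℤ)⟧) :=
    (eX.app X).inv ≫ x.hom ≫ t.hom
  obtain ⟨K, hK, s, hs, g, hf⟩ := right_fac_of_isStrictlyLE f 0
  have hs' : QuasiIso s := by rwa [isIso_Q_map_iff_quasiIso] at hs
  have hepi := epi_f_of_quasiIso_single s
  let q (Z : C) : ((CochainComplex.singleFunctor C 0).obj Z).X 0 ≅ Z :=
    HomologicalComplex.singleObjXSelf (ComplexShape.up ℤ) 0 Z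
  let p : K.X 0 ⟶ X := s.f 0 ≫ (q X).hom
  let j : (CochainComplex.singleFunctor C 0).obj (K.X 0) ⟶ K :=
    HomologicalComplex.mkHomFromSingle (𝟙 _)
      (fun k hk => (K.isZero_of_isStrictlyLE 0 k (by simp at hk; omega)).eq_of_tgt _ _)
  have hj : j ≫ s = (CochainComplex.singleFunctor C 0).map p := by
    apply HomologicalComplex.from_single_hom_ext
    rw [HomologicalComplex.comp_f, HomologicalComplex.mkHomFromSingle_f, Category.comp_id]
    erw [HomologicalComplex.single_map_f_self]
    change (q _).hom ≫ s.f 0 = (q _).hom ≫ (s.f 0 ≫ (q X).hom) ≫ (q X).inv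
    rw [Category.assoc, Iso.hom_inv_id, Category.comp_id]
  -- `g` restricted to degree zero lands in the degree zero part of `Y[1]`, which vanishes
  have hg : j ≫ g = 0 := by
    apply HomologicalComplex.from_single_hom_ext
    exact (HomologicalComplex.isZero_single_obj_X (ComplexShape.up ℤ) 0 Y (0 + 1)
      (by simp)).eq_of_tgt _ _
  refine ⟨K.X 0, p, epi_comp (s.f 0) (q X).hom, ?_⟩
  have key : Q.map ((CochainComplex.singleFunctor C 0).map p) ≫ f = 0 := by
    rw [hf, ← hj, Q.map_comp, Category.assoc, IsIso.hom_inv_id_assoc, ← Q.map_comp, hg, Q.map_zero]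
  ext
  rw [Ext.comp_hom, Ext.mk₀_hom, Ext.zero_hom, ShiftedHom.mk₀_comp]
  rw [← cancel_mono t.hom, ← cancel_epi ((eX.app _).inv)]
  have hn := eX.inv.naturality p
  simpa [f, reassoc_of% hn] using! key

/-- Every class in `Ext¹(X, Y)` dies on the middle term of a short exact sequence with outer terms
`Y` and `X`: if `p'` effaces the class, the class comes from a morphism `kernel p' ⟶ Y`, along which
one pushes out. -/
lemma exists_extension_comp_ext_one_eq_zero [HasExt.{w} C] {X Y : C} (x : Ext X Y 1) :
    ∃ (E : C) (i : Y ⟶ E) (p : E ⟶ X) (hip : i ≫ p = 0),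
      (ShortComplex.mk i p hip).ShortExact ∧ (Ext.mk₀ p).comp x (zero_add 1) = 0 := by
  obtain ⟨E', p', hp', hx⟩ := exists_epi_comp_ext_one_eq_zero x
  have hS' : (ShortComplex.mk (kernel.ι p') p' (kernel.condition p')).ShortExact :=
    { exact := ShortComplex.exact_kernel p' }
  obtain ⟨y, rfl⟩ := Ext.contravariant_sequence_exact₃ hS' Y x hx (add_zero 1)
  obtain ⟨f, rfl⟩ := (Ext.mk₀_bijective _ _).2 y
  let p : pushout f (kernel.ι p') ⟶ X := pushout.desc 0 p' (by simp)
  have hip : pushout.inl f (kernel.ι p') ≫ p = 0 := pushout.inl_desc _ _ _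
  have hinr : pushout.inr f (kernel.ι p') ≫ p = p' := pushout.inr_desc _ _ _
  have hepi : Epi p := epi_of_epi_fac hinr
  have hex : (ShortComplex.mk _ p hip).Exact := by
    apply ShortComplex.exact_of_g_is_cokernel
    refine CokernelCofork.IsColimit.ofπ' _ _ fun {A} k hk => ?_
    have hk' : kernel.ι p' ≫ pushout.inr f (kernel.ι p') ≫ k = 0 := by
      rw [← pushout.condition_assoc, hk, comp_zero]
    refine ⟨hS'.exact.desc _ hk', ?_⟩
    apply pushout.hom_ext
    · rw [reassoc_of% hip, zero_comp]
      exact hk.symm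
    · rw [reassoc_of% hinr]
      exact hS'.exact.g_desc _ hk'
  have hS : (ShortComplex.mk _ p hip).ShortExact := { exact := hex }
  refine ⟨_, _, p, hip, hS, ?_⟩
  let φ : ShortComplex.mk (kernel.ι p') p' (kernel.condition p') ⟶ ShortComplex.mk _ p hip :=
    { τ₁ := f, τ₂ := pushout.inr _ _, τ₃ := 𝟙 X, comm₁₂ := pushout.condition,
      comm₂₃ := by simp [hinr] }
  have hφ := ShortComplex.ShortExact.extClass_naturality hS' hS φ
  dsimp only [φ] at hφ
  erw [hφ]
  rw [Ext.mk₀_id_comp]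
  exact hS.comp_extClass

/-- If `K → P → X` is a short exact sequence such that `P → X` lifts through every extension of `X`
by `Y`, and every morphism `P ⟶ Y` vanishes on `K`, then `Ext¹(X, Y)` is `Hom(K, Y)`. So `P` serves
as a substitute for a projective cover of `X` in a category that need not have one. -/
lemma nonempty_extOne_equiv_hom [Linear ℂ C] {S : ShortComplex C} (hS : S.ShortExact) {Y : C}
    (hlift : ∀ (E : C) (i : Y ⟶ E) (p : E ⟶ S.X₃) (hip : i ≫ p = 0),
      (ShortComplex.mk i p hip).ShortExact → ∃ l : S.X₂ ⟶ E, l ≫ p = S.g)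
    (hzero : ∀ k : S.X₂ ⟶ Y, S.f ≫ k = 0) :
    Nonempty (ExtOne S.X₃ Y ≃ₗ[ℂ] (S.X₁ ⟶ Y)) := by
  let := HasExt.standard C
  let Φ : (S.X₁ ⟶ Y) →ₗ[ℂ] Ext S.X₃ Y 1 :=
    (hS.extClass.precompOfLinear ℂ Y (add_zero 1)).comp
      (Ext.linearEquiv₀ (R := ℂ)).symm.toLinearMap
  have hΦ (k : S.X₁ ⟶ Y) : Φ k = hS.extClass.comp (Ext.mk₀ k) (add_zero 1) := rfl
  refine ⟨(LinearEquiv.ofBijective Φ ⟨?_, fun x => ?_⟩).symm⟩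
  · rw [injective_iff_map_eq_zero]
    intro k hk
    obtain ⟨y, hy⟩ := Ext.contravariant_sequence_exact₁ hS Y (Ext.mk₀ k) (add_zero 1) hk
    obtain ⟨m, rfl⟩ := (Ext.mk₀_bijective _ _).2 y
    rw [Ext.mk₀_comp_mk₀, hzero, Ext.mk₀_zero] at hy
    exact (Ext.mk₀_eq_zero_iff k).1 hy.symm
  · obtain ⟨E, i, p, hip, hE, hx⟩ := exists_extension_comp_ext_one_eq_zero x
    obtain ⟨l, hl⟩ := hlift E i p hip hE
    have hgx : (Ext.mk₀ S.g).comp x (zero_add 1) = 0 := by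
      rw [← hl, ← Ext.mk₀_comp_mk₀_assoc, hx, Ext.comp_zero]
    obtain ⟨y, hy⟩ := Ext.contravariant_sequence_exact₃ hS Y x hgx (add_zero 1)
    obtain ⟨k, rfl⟩ := (Ext.mk₀_bijective _ _).2 y
    exact ⟨k, hy⟩

end YonedaExt

/-! ### Modules over the Takiff algebra from operators -/

namespace Takiff

attribute [local instance 100] LieRing.ofAssociativeRing

section Operators

variable {M N : Type*} [AddCommGroup M] [Module ℂ M] [Module UTakiff M] [IsScalarTower ℂ UTakiff M]
  [AddCommGroup N] [Module ℂ N] [Module UTakiff N] [IsScalarTower ℂ UTakiff N]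

/-- A complex linear map commuting with the six basis vectors is a homomorphism of modules. -/
def homOfBasis (φ : M →ₗ[ℂ] N) (hE : ∀ m, φ (E • m) = E • φ m) (hH : ∀ m, φ (H • m) = H • φ m)
    (hF : ∀ m, φ (F • m) = F • φ m) (hEb : ∀ m, φ (Eb • m) = Eb • φ m)
    (hHb : ∀ m, φ (Hb • m) = Hb • φ m) (hFb : ∀ m, φ (Fb • m) = Fb • φ m) : M →ₗ[UTakiff] N where
  toFun := φ
  map_add' := map_add φ
  map_smul' u m := by
    let S : Subalgebra ℂ UTakiff :=
      { carrier := {u | ∀ m, φ (u • m) = u • φ m}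
        mul_mem' := fun {a b} ha hb m => by rw [mul_smul, ha, hb, mul_smul]
        add_mem' := fun {a b} ha hb m => by rw [add_smul, map_add, ha, hb, add_smul]
        algebraMap_mem' := fun c m => by rw [algebraMap_smul, algebraMap_smul, map_smul] }
    have hS : S = ⊤ := subalgebra_eq_top S hE hH hF hEb hHb hFb
    exact (hS ▸ Algebra.mem_top : u ∈ S) m

/-- Six operators satisfying the bracket relations of the basis vectors of the Takiff algebra; the
operators of `e ⊗ x`, `h ⊗ x`, `f ⊗ x` are called `eb`, `hb`, `fb`. -/
structure TakiffOperators (V : Type*) [AddCommGroup V] [Module ℂ V] where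
  (e h f eb hb fb : V →ₗ[ℂ] V)
  h_e : ∀ v, h (e v) = e (h v) + (2 : ℂ) • e v
  h_f : ∀ v, h (f v) = f (h v) - (2 : ℂ) • f v
  e_f : ∀ v, e (f v) = f (e v) + h v
  h_eb : ∀ v, h (eb v) = eb (h v) + (2 : ℂ) • eb v
  h_hb : ∀ v, h (hb v) = hb (h v)
  h_fb : ∀ v, h (fb v) = fb (h v) - (2 : ℂ) • fb v
  e_eb : ∀ v, e (eb v) = eb (e v)
  e_hb : ∀ v, e (hb v) = hb (e v) - (2 : ℂ) • eb v
  e_fb : ∀ v, e (fb v) = fb (e v) + hb v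
  f_eb : ∀ v, f (eb v) = eb (f v) - hb v
  f_hb : ∀ v, f (hb v) = hb (f v) + (2 : ℂ) • fb v
  f_fb : ∀ v, f (fb v) = fb (f v)
  eb_hb : ∀ v, eb (hb v) = hb (eb v)
  eb_fb : ∀ v, eb (fb v) = fb (eb v)
  hb_fb : ∀ v, hb (fb v) = fb (hb v)

namespace TakiffOperators

variable {V : Type*} [AddCommGroup V] [Module ℂ V] (T : TakiffOperators V)

/-- The action of `sl₂ ⊗ 1`. -/
def lowAction : SlTwo →ₗ[ℂ] Module.End ℂ V where
  toFun a := a.1 0 1 • T.e + a.1 0 0 • T.h + a.1 1 0 • T.f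
  map_add' a b := by
    have h (i j : Fin 2) : (a + b).1 i j = a.1 i j + b.1 i j := rfl
    rw [h, h, h]
    module
  map_smul' c a := by
    have h (i j : Fin 2) : (c • a).1 i j = c * a.1 i j := rfl
    rw [h, h, h, RingHom.id_apply]
    module

/-- The action of `sl₂ ⊗ x`. -/
def highAction : SlTwo →ₗ[ℂ] Module.End ℂ V where
  toFun a := a.1 0 1 • T.eb + a.1 0 0 • T.hb + a.1 1 0 • T.fb
  map_add' a b := by
    have h (i j : Fin 2) : (a + b).1 i j = a.1 i j + b.1 i j := rfl
    rw [h, h, h]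
    module
  map_smul' c a := by
    have h (i j : Fin 2) : (c • a).1 i j = c * a.1 i j := rfl
    rw [h, h, h, RingHom.id_apply]
    module

lemma low_apply (a : SlTwo) (v : V) :
    T.lowAction a v = a.1 0 1 • T.e v + a.1 0 0 • T.h v + a.1 1 0 • T.f v := rfl

lemma high_apply (a : SlTwo) (v : V) :
    T.highAction a v = a.1 0 1 • T.eb v + a.1 0 0 • T.hb v + a.1 1 0 • T.fb v := rfl

lemma lie_entries (a b : SlTwo) :
    ⁅a, b⁆.1 0 1 = 2 * (a.1 0 0 * b.1 0 1 - a.1 0 1 * b.1 0 0) ∧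
    ⁅a, b⁆.1 0 0 = a.1 0 1 * b.1 1 0 - a.1 1 0 * b.1 0 1 ∧
    ⁅a, b⁆.1 1 0 = 2 * (a.1 1 0 * b.1 0 0 - a.1 0 0 * b.1 1 0) := by
  have ha : a.1 1 1 = - a.1 0 0 := by
    have := LinearMap.mem_ker.1 a.2
    rw [Matrix.traceLinearMap_apply, Matrix.trace_fin_two] at this
    linear_combination this
  have hb : b.1 1 1 = - b.1 0 0 := by
    have := LinearMap.mem_ker.1 b.2
    rw [Matrix.traceLinearMap_apply, Matrix.trace_fin_two] at this
    linear_combination this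
  rw [LieAlgebra.SpecialLinear.sl_bracket]
  simp only [Matrix.sub_apply, Matrix.mul_apply, Fin.sum_univ_two, ha, hb]
  refine ⟨?_, ?_, ?_⟩ <;> ring

lemma low_low (a b : SlTwo) (v : V) :
    T.lowAction ⁅a, b⁆ v = T.lowAction a (T.lowAction b v) - T.lowAction b (T.lowAction a v) := by
  obtain ⟨h1, h2, h3⟩ := lie_entries a b
  simp only [low_apply, h1, h2, h3, map_add, map_smul, T.h_e, T.h_f, T.e_f]
  module

lemma low_high (a b : SlTwo) (v : V) :
    T.highAction ⁅a, b⁆ v =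
      T.lowAction a (T.highAction b v) - T.highAction b (T.lowAction a v) := by
  obtain ⟨h1, h2, h3⟩ := lie_entries a b
  simp only [low_apply, high_apply, h1, h2, h3, map_add, map_smul, T.h_eb, T.h_hb, T.h_fb,
    T.e_eb, T.e_hb, T.e_fb, T.f_eb, T.f_hb, T.f_fb]
  module

lemma high_high (a b : SlTwo) (v : V) :
    T.highAction a (T.highAction b v) = T.highAction b (T.highAction a v) := by
  simp only [high_apply, map_add, map_smul, T.eb_hb, T.eb_fb, T.hb_fb]
  module

/-- The action of the Takiff algebra as a linear map. -/
def action : Takiff →ₗ[ℂ] Module.End ℂ V :=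
  TensorProduct.lift
    ((LinearMap.lsmul ℂ (SlTwo →ₗ[ℂ] Module.End ℂ V)).flip T.lowAction ∘ₗ
        (TrivSqZeroExt.fstHom ℂ ℂ ℂ).toLinearMap +
      (LinearMap.lsmul ℂ (SlTwo →ₗ[ℂ] Module.End ℂ V)).flip T.highAction ∘ₗ
        TrivSqZeroExt.sndHom ℂ ℂ)

lemma action_tmul (d : DualNumber ℂ) (a : SlTwo) :
    T.action (d ⊗ₜ a) =
      TrivSqZeroExt.fst d • T.lowAction a + TrivSqZeroExt.snd d • T.highAction a := rfl

lemma action_lie (x y : Takiff) (v : V) :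
    T.action ⁅x, y⁆ v = T.action x (T.action y v) - T.action y (T.action x v) := by
  induction x using TensorProduct.induction_on with
  | zero =>
    have h : ⁅(0 : Takiff), y⁆ = 0 := zero_lie (L := Takiff) (M := Takiff) y
    simp [h]
  | add x₁ x₂ h₁ h₂ =>
    have h : ⁅x₁ + x₂, y⁆ = ⁅x₁, y⁆ + ⁅x₂, y⁆ := add_lie (L := Takiff) (M := Takiff) x₁ x₂ y
    simp only [h, map_add, LinearMap.add_apply, h₁, h₂]
    abel
  | tmul d a =>
    induction y using TensorProduct.induction_on with
    | zero =>
      have h : ⁅d ⊗ₜ[ℂ] a, (0 : Takiff)⁆ = 0 := lie_zero (L := Takiff) (M := Takiff) _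
      simp [h]
    | add y₁ y₂ h₁ h₂ =>
      have h : ⁅d ⊗ₜ[ℂ] a, y₁ + y₂⁆ = ⁅d ⊗ₜ[ℂ] a, y₁⁆ + ⁅d ⊗ₜ[ℂ] a, y₂⁆ :=
        lie_add (L := Takiff) (M := Takiff) _ y₁ y₂
      simp only [h, map_add, LinearMap.add_apply, h₁, h₂]
      abel
    | tmul d' b =>
      have h1 := T.low_low a b v
      have h2 := T.low_high a b v
      have h3 := T.low_high b a v
      rw [← lie_skew, map_neg, LinearMap.neg_apply] at h3
      have h4 := T.high_high a b v
      rw [LieAlgebra.ExtendScalars.bracket_tmul]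
      simp only [action_tmul, LinearMap.add_apply, LinearMap.smul_apply, map_add, map_smul,
        TrivSqZeroExt.fst_mul, TrivSqZeroExt.snd_mul, h4, smul_eq_mul, MulOpposite.smul_eq_mul_unop,
        MulOpposite.unop_op]
      linear_combination (norm := module) (TrivSqZeroExt.fst d * TrivSqZeroExt.fst d') • h1 +
        (TrivSqZeroExt.fst d * TrivSqZeroExt.snd d') • h2 -
        (TrivSqZeroExt.snd d * TrivSqZeroExt.fst d') • h3

/-- The representation of the Takiff algebra. -/
def lieHom : Takiff →ₗ⁅ℂ⁆ Module.End ℂ V :=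
  { T.action with
    map_lie' := fun {x y} => by
      ext v
      exact T.action_lie x y v }

/-- The action of the enveloping algebra. -/
def envHom : UTakiff →ₐ[ℂ] Module.End ℂ V := UniversalEnvelopingAlgebra.lift ℂ T.lieHom

/-- The module over the enveloping algebra on which the basis vectors act by the given operators. -/
@[reducible]
def toModule : Module UTakiff V := Module.compHom V T.envHom.toRingHom

lemma envHom_lo (a : SlTwo) : T.envHom (lo a) = T.lowAction a := by
  rw [envHom, lo, UniversalEnvelopingAlgebra.lift_ι_apply]
  change T.action _ = _
  simp [action_tmul]

lemma envHom_hi (a : SlTwo) : T.envHom (hi a) = T.highAction a := by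
  rw [envHom, hi, UniversalEnvelopingAlgebra.lift_ι_apply]
  change T.action _ = _
  simp [action_tmul]

lemma isScalarTower : @IsScalarTower ℂ UTakiff V _ T.toModule.toSMul _ := by
  let := T.toModule
  refine IsScalarTower.of_algebraMap_smul fun c v => ?_
  change T.envHom (algebraMap ℂ UTakiff c) v = c • v
  rw [AlgHom.commutes]
  rfl

lemma smul_eq (v : V) :
    letI := T.toModule
    E • v = T.e v ∧ H • v = T.h v ∧ F • v = T.f v ∧ Eb • v = T.eb v ∧ Hb • v = T.hb v ∧
      Fb • v = T.fb v := by
  let := T.toModule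
  have hlo (a : SlTwo) : lo a • v = T.lowAction a v := by
    change T.envHom _ v = _
    rw [envHom_lo]
  have hhi (a : SlTwo) : hi a • v = T.highAction a v := by
    change T.envHom _ v = _
    rw [envHom_hi]
  refine ⟨(hlo _).trans ?_, (hlo _).trans ?_, (hlo _).trans ?_, (hhi _).trans ?_, (hhi _).trans ?_,
    (hhi _).trans ?_⟩ <;> simp [low_apply, high_apply, SlTwo.e, SlTwo.h, SlTwo.f]

end TakiffOperators

end Operators

end Takiff

/-! ### Operators on polynomials -/

namespace Takiff

attribute [local instance 100] LieRing.ofAssociativeRing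

section Polynomials

open Polynomial

lemma C_two : (C (2 : ℂ) : ℂ[X]) = 2 := map_ofNat C 2

/-- The operator `c∂ - z∂²` on polynomials, by which `e` acts on the Verma module of `sl₂` with
highest weight `c`. -/
def polyE (c : ℂ) : ℂ[X] →ₗ[ℂ] ℂ[X] :=
  c • derivative - LinearMap.mulLeft ℂ X ∘ₗ derivative ∘ₗ derivative

/-- The operator `c - 2z∂`, by which `h` acts on the Verma module of `sl₂`. -/
def polyH (c : ℂ) : ℂ[X] →ₗ[ℂ] ℂ[X] :=
  c • LinearMap.id - (2 : ℂ) • (LinearMap.mulLeft ℂ X ∘ₗ derivative)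

/-- The operator of multiplication by `z`, by which `f` acts on the Verma module of `sl₂`. -/
def polyF : ℂ[X] →ₗ[ℂ] ℂ[X] := LinearMap.mulLeft ℂ X

lemma polyE_apply (c : ℂ) (p : ℂ[X]) :
    polyE c p = C c * derivative p - X * derivative (derivative p) := by
  simp [polyE, smul_eq_C_mul]

lemma polyH_apply (c : ℂ) (p : ℂ[X]) : polyH c p = C c * p - 2 * X * derivative p := by
  rw [mul_assoc, ← C_two]
  simp [polyH, smul_eq_C_mul]

lemma polyF_apply (p : ℂ[X]) : polyF p = X * p := rfl

lemma polyH_polyE (c : ℂ) (p : ℂ[X]) :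
    polyH c (polyE c p) = polyE c (polyH c p) + (2 : ℂ) • polyE c p := by
  simp only [polyE_apply, polyH_apply, smul_eq_C_mul, derivative_sub, derivative_mul, derivative_X,
    derivative_C, derivative_ofNat, C_two, derivative_add,
    zero_mul, one_mul, mul_one, zero_add]
  ring

lemma polyH_polyF (c : ℂ) (p : ℂ[X]) :
    polyH c (polyF p) = polyF (polyH c p) - (2 : ℂ) • polyF p := by
  simp only [polyF_apply, polyH_apply, smul_eq_C_mul, derivative_mul, derivative_X, C_two]
  ring

lemma polyE_polyF (c : ℂ) (p : ℂ[X]) : polyE c (polyF p) = polyF (polyE c p) + polyH c p := by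
  simp only [polyF_apply, polyE_apply, polyH_apply, derivative_mul, derivative_X, derivative_add,
    one_mul]
  ring

/-- The operators on the Verma module of `sl₂` of highest weight `c`, with `sl₂ ⊗ x` acting by
zero. -/
def polyOperators (c : ℂ) : TakiffOperators ℂ[X] where
  e := polyE c
  h := polyH c
  f := polyF
  eb := 0
  hb := 0
  fb := 0
  h_e := polyH_polyE c
  h_f := polyH_polyF c
  e_f := polyE_polyF c
  h_eb := by simp
  h_hb := by simp
  h_fb := by simp
  e_eb := by simp
  e_hb := by simp
  e_fb := by simp
  f_eb := by simp
  f_hb := by simp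
  f_fb := by simp
  eb_hb := by simp
  eb_fb := by simp
  hb_fb := by simp

/-- The highest weights of the four Verma modules in the kernel of the universal extension,
relative to the highest weight `c` of its quotient. -/
def layerShift : Fin 4 → ℂ := ![0, 0, 2, -2]

/-- The action of `e` on the direct sum of the four Verma modules. -/
def kernelE (c : ℂ) : (Fin 4 → ℂ[X]) →ₗ[ℂ] (Fin 4 → ℂ[X]) :=
  LinearMap.pi fun i => polyE (c + layerShift i) ∘ₗ LinearMap.proj i

/-- The action of `h` on the direct sum of the four Verma modules. -/
def kernelH (c : ℂ) : (Fin 4 → ℂ[X]) →ₗ[ℂ] (Fin 4 → ℂ[X]) :=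
  LinearMap.pi fun i => polyH (c + layerShift i) ∘ₗ LinearMap.proj i

/-- The action of `f` on the direct sum of the four Verma modules. -/
def kernelF : (Fin 4 → ℂ[X]) →ₗ[ℂ] (Fin 4 → ℂ[X]) :=
  LinearMap.pi fun i => polyF ∘ₗ LinearMap.proj i

/-- The operators on the direct sum of the four Verma modules, with `sl₂ ⊗ x` acting by zero. -/
def kernelOperators (c : ℂ) : TakiffOperators (Fin 4 → ℂ[X]) where
  e := kernelE c
  h := kernelH c
  f := kernelF
  eb := 0
  hb := 0
  fb := 0
  h_e v := funext fun _ => polyH_polyE _ _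
  h_f v := funext fun _ => polyH_polyF _ _
  e_f v := funext fun _ => polyE_polyF _ _
  h_eb := by simp
  h_hb := by simp
  h_fb := by simp
  e_eb := by simp
  e_hb := by simp
  e_fb := by simp
  f_eb := by simp
  f_hb := by simp
  f_fb := by simp
  eb_hb := by simp
  eb_fb := by simp
  hb_fb := by simp

/-- Multiplication by a polynomial. -/
abbrev mulP (p : ℂ[X]) : ℂ[X] →ₗ[ℂ] ℂ[X] := LinearMap.mulLeft ℂ p

/-- The part of the action of `e` on the universal extension that maps the quotient to the kernel:
the derivative of `polyE c` with respect to `c`, in the layer `0`. -/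
def cocycleE : ℂ[X] →ₗ[ℂ] (Fin 4 → ℂ[X]) := LinearMap.pi ![derivative, 0, 0, 0]

/-- The part of the action of `h` on the universal extension that maps the quotient to the kernel:
the derivative of `polyH c` with respect to `c`, in the layer `0`. -/
def cocycleH : ℂ[X] →ₗ[ℂ] (Fin 4 → ℂ[X]) := LinearMap.pi ![LinearMap.id, 0, 0, 0]

/-- The action of `e ⊗ x` on the universal extension. It maps the quotient to the layers `1`, `2`,
`3` by the three homomorphisms of `sl₂`-modules from `sl₂ ⊗ M(c)` to `M(c)`, `M(c + 2)`,
`M(c - 2)`; the first of them is the action map. -/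
def cocycleEb (c : ℂ) : ℂ[X] →ₗ[ℂ] (Fin 4 → ℂ[X]) :=
  LinearMap.pi ![0, polyE c,
    mulP (-C ((c + 1) * (c + 2))) + mulP (2 * C (c + 1) * X) ∘ₗ derivative -
      mulP (X ^ 2) ∘ₗ derivative ∘ₗ derivative,
    -derivative ∘ₗ derivative]

/-- The action of `h ⊗ x` on the universal extension, by the homomorphisms of `cocycleEb`. -/
def cocycleHb (c : ℂ) : ℂ[X] →ₗ[ℂ] (Fin 4 → ℂ[X]) :=
  LinearMap.pi ![0, polyH c, mulP (2 * C (c + 1) * X) - mulP (2 * X ^ 2) ∘ₗ derivative,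
    (-2 : ℂ) • derivative]

/-- The action of `f ⊗ x` on the universal extension, by the homomorphisms of `cocycleEb`. -/
def cocycleFb : ℂ[X] →ₗ[ℂ] (Fin 4 → ℂ[X]) :=
  LinearMap.pi ![0, polyF, mulP (X ^ 2), LinearMap.id]

/-- The block triangular operator with diagonal blocks `a`, `b` and off-diagonal block `θ`. -/
def blockOp {V W : Type*} [AddCommGroup V] [Module ℂ V] [AddCommGroup W] [Module ℂ W]
    (a : V →ₗ[ℂ] V) (θ : V →ₗ[ℂ] W) (b : W →ₗ[ℂ] W) : V × W →ₗ[ℂ] V × W :=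
  (a ∘ₗ LinearMap.fst ℂ V W).prod (θ ∘ₗ LinearMap.fst ℂ V W + b ∘ₗ LinearMap.snd ℂ V W)

set_option maxHeartbeats 2000000 in
/-- The operators on the universal extension. -/
def univOperators (c : ℂ) : TakiffOperators (ℂ[X] × (Fin 4 → ℂ[X])) := by
  refine
    { e := blockOp (polyE c) cocycleE (kernelE c)
      h := blockOp (polyH c) cocycleH (kernelH c)
      f := blockOp polyF 0 kernelF
      eb := blockOp 0 (cocycleEb c) 0
      hb := blockOp 0 (cocycleHb c) 0
      fb := blockOp 0 cocycleFb 0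
      h_e := ?_, h_f := ?_, e_f := ?_, h_eb := ?_, h_hb := ?_, h_fb := ?_, e_eb := ?_,
      e_hb := ?_, e_fb := ?_, f_eb := ?_, f_hb := ?_, f_fb := ?_, eb_hb := ?_, eb_fb := ?_,
      hb_fb := ?_ } <;>
  · rintro ⟨p, k⟩
    ext1
    · simp [blockOp, polyE_apply, polyH_apply, polyF_apply, smul_eq_C_mul, C_two]
      try ring
    · funext i
      fin_cases i <;>
        simp [blockOp, kernelE, kernelH, kernelF, cocycleE, cocycleH, cocycleEb, cocycleHb,
          cocycleFb, layerShift, polyE_apply, polyH_apply, polyF_apply, smul_eq_C_mul, C_two] <;>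
        ring

end Polynomials

end Takiff

/-! ### The universal extension of a Verma module of `sl₂` -/

namespace Takiff

section PolynomialModules

open Polynomial

/-- The Verma module `M(c)` of `sl₂` with highest weight `c`, realized on polynomials in `f` and
regarded as a module over the Takiff algebra on which `sl₂ ⊗ x` acts by zero. -/
def PolyVerma (_c : ℂ) : Type := ℂ[X]

/-- The direct sum of the Verma modules `M(c)`, `M(c)`, `M(c + 2)`, `M(c - 2)`, the kernel of the
universal extension of `M(c)`. -/
def UnivKernel (_c : ℂ) : Type := Fin 4 → ℂ[X]

/-- The universal extension of `PolyVerma c` by modules of the same form, with kernel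
`UnivKernel c`. The layer `0` of the kernel deforms the highest weight `c`; the layers `1`, `2`, `3`
deform the zero action of `sl₂ ⊗ x`. -/
def UnivExt (_c : ℂ) : Type := ℂ[X] × (Fin 4 → ℂ[X])

variable (c : ℂ)

instance : AddCommGroup (PolyVerma c) := inferInstanceAs (AddCommGroup ℂ[X])
instance : Module ℂ (PolyVerma c) := inferInstanceAs (Module ℂ ℂ[X])
instance : Module UTakiff (PolyVerma c) := (polyOperators c).toModule
instance : IsScalarTower ℂ UTakiff (PolyVerma c) := (polyOperators c).isScalarTower

instance : AddCommGroup (UnivKernel c) := inferInstanceAs (AddCommGroup (Fin 4 → ℂ[X]))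
instance : Module ℂ (UnivKernel c) := inferInstanceAs (Module ℂ (Fin 4 → ℂ[X]))
instance : Module UTakiff (UnivKernel c) := (kernelOperators c).toModule
instance : IsScalarTower ℂ UTakiff (UnivKernel c) := (kernelOperators c).isScalarTower

instance : AddCommGroup (UnivExt c) := inferInstanceAs (AddCommGroup (ℂ[X] × (Fin 4 → ℂ[X])))
instance : Module ℂ (UnivExt c) := inferInstanceAs (Module ℂ (ℂ[X] × (Fin 4 → ℂ[X])))
instance : Module UTakiff (UnivExt c) := (univOperators c).toModule
instance : IsScalarTower ℂ UTakiff (UnivExt c) := (univOperators c).isScalarTower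

/-- A polynomial as an element of `PolyVerma c`. -/
def PolyVerma.of : ℂ[X] ≃ₗ[ℂ] PolyVerma c := LinearEquiv.refl ℂ _

/-- A family of polynomials as an element of `UnivKernel c`. -/
def UnivKernel.of : (Fin 4 → ℂ[X]) ≃ₗ[ℂ] UnivKernel c := LinearEquiv.refl ℂ _

/-- A pair as an element of `UnivExt c`. -/
def UnivExt.of : (ℂ[X] × (Fin 4 → ℂ[X])) ≃ₗ[ℂ] UnivExt c := LinearEquiv.refl ℂ _

namespace PolyVerma
variable (p : ℂ[X])
lemma E_smul : E • of c p = of c (polyE c p) := ((polyOperators c).smul_eq p).1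
lemma H_smul : H • of c p = of c (polyH c p) := ((polyOperators c).smul_eq p).2.1
lemma F_smul : F • of c p = of c (X * p) := ((polyOperators c).smul_eq p).2.2.1
lemma Eb_smul : Eb • of c p = 0 := ((polyOperators c).smul_eq p).2.2.2.1
lemma Hb_smul : Hb • of c p = 0 := ((polyOperators c).smul_eq p).2.2.2.2.1
lemma Fb_smul : Fb • of c p = 0 := ((polyOperators c).smul_eq p).2.2.2.2.2
end PolyVerma

namespace UnivKernel
variable (k : Fin 4 → ℂ[X])
lemma E_smul : E • of c k = of c (kernelE c k) := ((kernelOperators c).smul_eq k).1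
lemma H_smul : H • of c k = of c (kernelH c k) := ((kernelOperators c).smul_eq k).2.1
lemma F_smul : F • of c k = of c (kernelF k) := ((kernelOperators c).smul_eq k).2.2.1
lemma Eb_smul : Eb • of c k = 0 := ((kernelOperators c).smul_eq k).2.2.2.1
lemma Hb_smul : Hb • of c k = 0 := ((kernelOperators c).smul_eq k).2.2.2.2.1
lemma Fb_smul : Fb • of c k = 0 := ((kernelOperators c).smul_eq k).2.2.2.2.2
end UnivKernel

namespace UnivExt
variable (p : ℂ[X]) (k : Fin 4 → ℂ[X])
lemma E_smul : E • of c (p, k) = of c (polyE c p, cocycleE p + kernelE c k) :=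
  ((univOperators c).smul_eq (p, k)).1
lemma H_smul : H • of c (p, k) = of c (polyH c p, cocycleH p + kernelH c k) :=
  ((univOperators c).smul_eq (p, k)).2.1
lemma F_smul : F • of c (p, k) = of c (X * p, kernelF k) :=
  ((univOperators c).smul_eq (p, k)).2.2.1.trans
    (congrArg (of c) (Prod.ext rfl (zero_add (kernelF k))))
lemma Eb_smul : Eb • of c (p, k) = of c (0, cocycleEb c p) :=
  ((univOperators c).smul_eq (p, k)).2.2.2.1.trans
    (congrArg (of c) (Prod.ext rfl (add_zero (cocycleEb c p))))
lemma Hb_smul : Hb • of c (p, k) = of c (0, cocycleHb c p) :=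
  ((univOperators c).smul_eq (p, k)).2.2.2.2.1.trans
    (congrArg (of c) (Prod.ext rfl (add_zero (cocycleHb c p))))
lemma Fb_smul : Fb • of c (p, k) = of c (0, cocycleFb p) :=
  ((univOperators c).smul_eq (p, k)).2.2.2.2.2.trans
    (congrArg (of c) (Prod.ext rfl (add_zero (cocycleFb p))))
end UnivExt

/-- The inclusion of the kernel into the universal extension. -/
def univIncl : UnivKernel c →ₗ[UTakiff] UnivExt c :=
  homOfBasis (M := UnivKernel c) (N := UnivExt c)
    ((UnivExt.of c).toLinearMap ∘ₗ LinearMap.inr ℂ ℂ[X] (Fin 4 → ℂ[X]) ∘ₗ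
      (UnivKernel.of c).symm.toLinearMap)
    (fun k => ((UnivExt.E_smul c 0 k).trans (by simp; exact (UnivKernel.E_smul c k).symm)).symm)
    (fun k => ((UnivExt.H_smul c 0 k).trans (by simp; exact (UnivKernel.H_smul c k).symm)).symm)
    (fun k => ((UnivExt.F_smul c 0 k).trans (by simp; exact (UnivKernel.F_smul c k).symm)).symm)
    (fun k => ((UnivExt.Eb_smul c 0 k).trans (by simp; exact (UnivKernel.Eb_smul c k).symm)).symm)
    (fun k => ((UnivExt.Hb_smul c 0 k).trans (by simp; exact (UnivKernel.Hb_smul c k).symm)).symm)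
    (fun k => ((UnivExt.Fb_smul c 0 k).trans (by simp; exact (UnivKernel.Fb_smul c k).symm)).symm)

/-- The projection of the universal extension onto its quotient. -/
def univProj : UnivExt c →ₗ[UTakiff] PolyVerma c :=
  homOfBasis (M := UnivExt c) (N := PolyVerma c)
    ((PolyVerma.of c).toLinearMap ∘ₗ LinearMap.fst ℂ ℂ[X] (Fin 4 → ℂ[X]) ∘ₗ
      (UnivExt.of c).symm.toLinearMap)
    (fun x => (congrArg Prod.fst (UnivExt.E_smul c x.1 x.2)).trans (PolyVerma.E_smul c x.1).symm)
    (fun x => (congrArg Prod.fst (UnivExt.H_smul c x.1 x.2)).trans (PolyVerma.H_smul c x.1).symm)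
    (fun x => (congrArg Prod.fst (UnivExt.F_smul c x.1 x.2)).trans (PolyVerma.F_smul c x.1).symm)
    (fun x => (congrArg Prod.fst (UnivExt.Eb_smul c x.1 x.2)).trans (PolyVerma.Eb_smul c x.1).symm)
    (fun x => (congrArg Prod.fst (UnivExt.Hb_smul c x.1 x.2)).trans (PolyVerma.Hb_smul c x.1).symm)
    (fun x => (congrArg Prod.fst (UnivExt.Fb_smul c x.1 x.2)).trans (PolyVerma.Fb_smul c x.1).symm)

lemma univProj_of (p : ℂ[X]) (k : Fin 4 → ℂ[X]) :
    univProj c (UnivExt.of c (p, k)) = PolyVerma.of c p := rfl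

lemma univIncl_injective : Function.Injective (univIncl c) :=
  fun _ _ h => congrArg Prod.snd h

lemma univProj_surjective : Function.Surjective (univProj c) :=
  fun p => ⟨UnivExt.of c (p, 0), rfl⟩

lemma exact_univIncl_univProj : Function.Exact (univIncl c) (univProj c) := by
  intro x
  refine ⟨fun h => ⟨UnivKernel.of c x.2, Prod.ext (Eq.symm h) rfl⟩, ?_⟩
  rintro ⟨k, rfl⟩
  rfl

lemma mem_of_X_mul_mem {M : Type*} [AddCommGroup M] [Module ℂ M] {V : Submodule ℂ M}
    (φ : ℂ[X] →ₗ[ℂ] M) (hφ : ∀ p, φ p ∈ V → φ (X * p) ∈ V) (h1 : φ 1 ∈ V) (p : ℂ[X]) : φ p ∈ V := by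
  have : (⊤ : Submodule ℂ ℂ[X]) ≤ V.comap φ := by
    rw [← (Polynomial.basisMonomials ℂ).span_eq, Submodule.span_le]
    rintro _ ⟨n, rfl⟩
    rw [Polynomial.coe_basisMonomials]
    change φ (monomial n 1) ∈ V
    rw [Polynomial.monomial_one_right_eq_X_pow]
    induction n with
    | zero => simpa using h1
    | succ n ih =>
      rw [pow_succ']
      exact hφ _ ih
  exact this trivial

/-- `p ↦ p(f) v`. -/
def polyAct {M : Type*} [AddCommGroup M] [Module ℂ M] [Module UTakiff M]
    [IsScalarTower ℂ UTakiff M] (v : M) : ℂ[X] →ₗ[ℂ] M where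
  toFun p := aeval F p • v
  map_add' p q := by rw [map_add, add_smul]
  map_smul' a p := by rw [map_smul, smul_assoc, RingHom.id_apply]

section
variable {M : Type*} [AddCommGroup M] [Module ℂ M] [Module UTakiff M] [IsScalarTower ℂ UTakiff M]

lemma polyAct_X_mul (v : M) (p : ℂ[X]) : polyAct v (X * p) = F • polyAct v p := by
  simp [polyAct, mul_smul]

lemma polyAct_one (v : M) : polyAct v 1 = v := by simp [polyAct]

lemma mem_of_F_equivariant {N : Submodule UTakiff M} (φ : ℂ[X] →ₗ[ℂ] M)
    (hφ : ∀ p, φ (X * p) = F • φ p) (h1 : φ 1 ∈ N) (p : ℂ[X]) : φ p ∈ N :=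
  mem_of_X_mul_mem (V := N.restrictScalars ℂ) φ
    (fun p hp => by rw [hφ]; exact N.smul_mem F hp) h1 p

end

lemma PolyVerma.eq_top_of_one_mem {N : Submodule UTakiff (PolyVerma c)}
    (h : PolyVerma.of c 1 ∈ N) : N = ⊤ :=
  Submodule.eq_top_iff'.2 fun p =>
    mem_of_F_equivariant (PolyVerma.of c).toLinearMap (fun p => (PolyVerma.F_smul c p).symm) h p

/-- The inclusion of a layer of the kernel into the universal extension. -/
def UnivExt.layer (i : Fin 4) : ℂ[X] →ₗ[ℂ] UnivExt c :=
  (UnivExt.of c).toLinearMap ∘ₗ LinearMap.inr ℂ ℂ[X] (Fin 4 → ℂ[X]) ∘ₗ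
    LinearMap.single ℂ (fun _ => ℂ[X]) i

lemma UnivExt.layer_apply (i : Fin 4) (p : ℂ[X]) :
    UnivExt.layer c i p = UnivExt.of c (0, Pi.single i p) := rfl

lemma kernelF_single (i : Fin 4) (p : ℂ[X]) : kernelF (Pi.single i p) = Pi.single i (X * p) := by
  ext1 j
  by_cases h : j = i
  · subst h; simp [kernelF, polyF_apply]
  · simp [kernelF, polyF_apply, h]

lemma kernelE_single (i : Fin 4) (p : ℂ[X]) :
    kernelE c (Pi.single i p) = Pi.single i (polyE (c + layerShift i) p) := by
  ext1 j
  by_cases h : j = i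
  · subst h; simp [kernelE]
  · simp [kernelE, h]

lemma kernelH_single (i : Fin 4) (p : ℂ[X]) :
    kernelH c (Pi.single i p) = Pi.single i (polyH (c + layerShift i) p) := by
  ext1 j
  by_cases h : j = i
  · subst h; simp [kernelH]
  · simp [kernelH, h]

lemma UnivExt.of_eq_add_sum (p : ℂ[X]) (k : Fin 4 → ℂ[X]) :
    UnivExt.of c (p, k) = UnivExt.of c (p, 0) + ∑ i, UnivExt.layer c i (k i) := by
  simp only [UnivExt.layer, LinearMap.comp_apply]
  rw [← map_sum, ← map_sum]
  have h : ∑ i, LinearMap.single ℂ (fun _ : Fin 4 => ℂ[X]) i (k i) = k := Finset.univ_sum_single k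
  rw [h]
  simp [← map_add]

lemma UnivExt.F_smul_layer (i : Fin 4) (p : ℂ[X]) :
    F • UnivExt.layer c i p = UnivExt.layer c i (X * p) := by
  rw [layer_apply, UnivExt.F_smul, kernelF_single, mul_zero, layer_apply]

lemma UnivExt.eq_top {N : Submodule UTakiff (UnivExt c)}
    (h : UnivExt.of c (1, 0) ∈ N) (hk : ∀ i, UnivExt.layer c i 1 ∈ N) : N = ⊤ := by
  refine Submodule.eq_top_iff'.2 fun ⟨p, k⟩ => ?_
  change UnivExt.of c (p, k) ∈ N
  rw [UnivExt.of_eq_add_sum]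
  refine N.add_mem ?_ (N.sum_mem fun i _ => ?_)
  · refine mem_of_F_equivariant
      ((UnivExt.of c).toLinearMap ∘ₗ LinearMap.inl ℂ ℂ[X] (Fin 4 → ℂ[X])) (fun p => ?_) h p
    simp [UnivExt.F_smul]
  · exact mem_of_F_equivariant (UnivExt.layer c i) (fun p => (UnivExt.F_smul_layer c i p).symm)
      (hk i) (k i)

lemma polyE_one : polyE c 1 = 0 := by simp [polyE_apply]
lemma polyH_one : polyH c 1 = c • 1 := by simp [polyH_apply, smul_eq_C_mul]
lemma polyE_X : polyE c X = c • 1 := by simp [polyE_apply, smul_eq_C_mul]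
lemma polyH_X : polyH c X = (c - 2) • X := by
  simp [polyH_apply, smul_eq_C_mul, C_two]
  ring

lemma UnivExt.E_smul_one : E • UnivExt.of c (1, 0) = 0 := by
  rw [E_smul, polyE_one, map_zero, add_zero]
  have : cocycleE 1 = 0 := by
    ext1 i
    fin_cases i <;> simp [cocycleE]
  rw [this]
  exact map_zero (of c)

lemma UnivExt.H_smul_one :
    H • UnivExt.of c (1, 0) = c • UnivExt.of c (1, 0) + UnivExt.layer c 0 1 := by
  rw [H_smul, polyH_one, map_zero, add_zero, layer_apply, ← map_smul, ← map_add]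
  congr 1
  ext1
  · simp
  · ext1 i
    fin_cases i <;> simp [cocycleH]

lemma UnivExt.Eb_smul_one :
    Eb • UnivExt.of c (1, 0) = (-((c + 1) * (c + 2))) • UnivExt.layer c 2 1 := by
  rw [Eb_smul, layer_apply, ← map_smul]
  congr 1
  ext1
  · simp
  · ext1 i
    fin_cases i <;> simp [cocycleEb, polyE_one, smul_eq_C_mul]

lemma UnivExt.Hb_smul_one :
    Hb • UnivExt.of c (1, 0) =
      c • UnivExt.layer c 1 1 + (2 * (c + 1)) • UnivExt.layer c 2 X := by
  rw [Hb_smul, layer_apply, layer_apply, ← map_smul, ← map_smul, ← map_add]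
  congr 1
  ext1
  · simp
  · ext1 i
    fin_cases i <;> simp [cocycleHb, polyH_one, smul_eq_C_mul, C_two, mul_assoc]

lemma UnivExt.Fb_smul_one :
    Fb • UnivExt.of c (1, 0) =
      UnivExt.layer c 1 X + UnivExt.layer c 2 (X ^ 2) + UnivExt.layer c 3 1 := by
  rw [Fb_smul, layer_apply, layer_apply, layer_apply, ← map_add, ← map_add]
  congr 1
  ext1
  · simp
  · ext1 i
    fin_cases i <;> simp [cocycleFb, polyF_apply]

lemma UnivExt.E_smul_layer (i : Fin 4) (p : ℂ[X]) :
    E • UnivExt.layer c i p = UnivExt.layer c i (polyE (c + layerShift i) p) := by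
  rw [layer_apply, E_smul, map_zero, map_zero, zero_add, kernelE_single, layer_apply]

lemma UnivExt.H_smul_layer (i : Fin 4) (p : ℂ[X]) :
    H • UnivExt.layer c i p = UnivExt.layer c i (polyH (c + layerShift i) p) := by
  rw [layer_apply, H_smul, map_zero, map_zero, zero_add, kernelH_single, layer_apply]

lemma UnivExt.Eb_smul_layer (i : Fin 4) (p : ℂ[X]) : Eb • UnivExt.layer c i p = 0 := by
  rw [layer_apply, Eb_smul, map_zero]
  exact map_zero (of c)

lemma UnivExt.Hb_smul_layer (i : Fin 4) (p : ℂ[X]) : Hb • UnivExt.layer c i p = 0 := by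
  rw [layer_apply, Hb_smul, map_zero]
  exact map_zero (of c)

lemma UnivExt.Fb_smul_layer (i : Fin 4) (p : ℂ[X]) : Fb • UnivExt.layer c i p = 0 := by
  rw [layer_apply, Fb_smul, map_zero]
  exact map_zero (of c)

/-- The span of a set is stable under the Borel subalgebra if the images of the set are in it. -/
lemma borelStable_span {M : Type*} [AddCommGroup M] [Module ℂ M] [Module UTakiff M]
    [IsScalarTower ℂ UTakiff M] {S : Set M}
    (h : ∀ s ∈ S, H • s ∈ Submodule.span ℂ S ∧ Hb • s ∈ Submodule.span ℂ S ∧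
      E • s ∈ Submodule.span ℂ S ∧ Eb • s ∈ Submodule.span ℂ S) :
    BorelStable (Submodule.span ℂ S) := by
  have key (b : UTakiff) (hb : ∀ s ∈ S, b • s ∈ Submodule.span ℂ S) :
      ∀ v ∈ Submodule.span ℂ S, b • v ∈ Submodule.span ℂ S :=
    (Submodule.span_le (p := (Submodule.span ℂ S).comap (Algebra.lsmul ℂ ℂ M b))).2 hb
  exact ⟨key _ fun s hs => (h s hs).1, key _ fun s hs => (h s hs).2.1,
    key _ fun s hs => (h s hs).2.2.1, key _ fun s hs => (h s hs).2.2.2⟩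

/-- Generators of the universal extension whose span is stable under the Borel subalgebra. The
vector `z` of the layer `2` is needed, as it occurs in the image of the first generator under
`h ⊗ x`. -/
def UnivExt.borelGenerators : Set (UnivExt c) :=
  insert (UnivExt.of c (1, 0))
    (insert (UnivExt.layer c 2 X) (Set.range fun i => UnivExt.layer c i 1))

lemma UnivExt.borelStable_span_borelGenerators :
    BorelStable (Submodule.span ℂ (borelGenerators c)) := by
  have hX : layer c 2 X ∈ Submodule.span ℂ (borelGenerators c) :=
    Submodule.subset_span (by simp [borelGenerators])
  have h1 : of c (1, 0) ∈ Submodule.span ℂ (borelGenerators c) :=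
    Submodule.subset_span (by simp [borelGenerators])
  have hl (i : Fin 4) : layer c i 1 ∈ Submodule.span ℂ (borelGenerators c) :=
    Submodule.subset_span (by simp [borelGenerators])
  apply borelStable_span
  rintro s (rfl | rfl | ⟨i, rfl⟩)
  · rw [H_smul_one, Hb_smul_one, E_smul_one, Eb_smul_one]
    exact ⟨add_mem (Submodule.smul_mem _ _ h1) (hl _),
      add_mem (Submodule.smul_mem _ _ (hl _)) (Submodule.smul_mem _ _ hX), zero_mem _,
      Submodule.smul_mem _ _ (hl _)⟩
  · rw [H_smul_layer, Hb_smul_layer, E_smul_layer, Eb_smul_layer, polyH_X, polyE_X, map_smul,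
      map_smul]
    exact ⟨Submodule.smul_mem _ _ hX, zero_mem _, Submodule.smul_mem _ _ (hl _), zero_mem _⟩
  · dsimp only
    rw [H_smul_layer, Hb_smul_layer, E_smul_layer, Eb_smul_layer, polyH_one, polyE_one, map_smul,
      map_zero]
    exact ⟨Submodule.smul_mem _ _ (hl _), zero_mem _, zero_mem _, zero_mem _⟩

lemma UnivExt.span_borelGenerators : Submodule.span UTakiff (borelGenerators c) = ⊤ :=
  eq_top c (Submodule.subset_span (by simp [borelGenerators]))
    fun i => Submodule.subset_span (by simp [borelGenerators])

lemma UnivExt.finite_borelGenerators : (borelGenerators c).Finite :=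
  ((Set.finite_range _).insert _).insert _

instance UnivExt.module_finite : Module.Finite UTakiff (UnivExt c) :=
  ⟨Submodule.fg_def.2 ⟨_, finite_borelGenerators c, span_borelGenerators c⟩⟩

lemma UnivExt.locallyBorelFinite : LocallyBorelFinite (UnivExt c) :=
  locallyBorelFinite_of_span (span_borelGenerators c) fun _ hs =>
    fg_borelOrbit_of_mem (borelStable_span_borelGenerators c)
      (Submodule.fg_span (finite_borelGenerators c)) (Submodule.subset_span hs)

end PolynomialModules

end Takiff

/-! ### Universality of the extension -/

namespace Takiff

section PolynomialExtensions

open Polynomial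

lemma coeff_polyE (d : ℂ) (p : ℂ[X]) (n : ℕ) :
    (polyE d p).coeff n = (n + 1) * (d - n) * p.coeff (n + 1) := by
  rw [polyE_apply, coeff_sub, coeff_C_mul, coeff_derivative]
  cases n with
  | zero => simp
  | succ n =>
    rw [coeff_X_mul, coeff_derivative, coeff_derivative]
    push_cast
    ring

lemma coeff_polyH (d : ℂ) (p : ℂ[X]) (n : ℕ) : (polyH d p).coeff n = (d - 2 * n) * p.coeff n := by
  rw [polyH_apply, coeff_sub, coeff_C_mul, mul_assoc, ← C_two, coeff_C_mul]
  cases n with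
  | zero => simp
  | succ n =>
    rw [coeff_X_mul, coeff_derivative]
    push_cast
    ring

variable {c d : ℂ}

lemma eq_C_of_polyE_eq_zero (hd : ∀ n : ℤ, d ≠ n) {p : ℂ[X]} (h : polyE d p = 0) :
    p = C (p.coeff 0) := by
  ext n
  cases n with
  | zero => simp
  | succ n =>
    have h1 := coeff_polyE d p n
    rw [h, coeff_zero, eq_comm, mul_eq_zero, mul_eq_zero] at h1
    rw [coeff_C_succ]
    exact (h1.resolve_left (not_or.2 ⟨by exact_mod_cast n.succ_ne_zero,
      sub_ne_zero.2 (by exact_mod_cast hd n)⟩))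

lemma polyE_surjective (hd : ∀ n : ℤ, d ≠ n) : Function.Surjective (polyE d) := by
  rw [← LinearMap.range_eq_top, eq_top_iff, ← (Polynomial.basisMonomials ℂ).span_eq,
    Submodule.span_le]
  rintro _ ⟨n, rfl⟩
  have h1 : (n + 1 : ℂ) ≠ 0 := by exact_mod_cast n.succ_ne_zero
  have h2 : d - n ≠ 0 := sub_ne_zero.2 (by exact_mod_cast hd n)
  refine ⟨monomial (n + 1) ((n + 1 : ℂ) * (d - n))⁻¹, ?_⟩
  ext m
  rw [coeff_polyE, Polynomial.coe_basisMonomials, coeff_monomial, coeff_monomial]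
  by_cases h : n = m
  · subst h
    simp
    field_simp
  · simp [h]

/-- The vectors at which a linear map commutes with the basis vectors other than `f`. -/
def commutingPart {M N : Type*} [AddCommGroup M] [Module ℂ M] [Module UTakiff M]
    [IsScalarTower ℂ UTakiff M] [AddCommGroup N] [Module ℂ N] [Module UTakiff N]
    [IsScalarTower ℂ UTakiff N] (φ : M →ₗ[ℂ] N) : Submodule ℂ M where
  carrier := {m | ∀ u ∈ ({E, H, Eb, Hb, Fb} : Set UTakiff), φ (u • m) = u • φ m}
  zero_mem' u _ := by simp
  add_mem' ha hb u hu := by rw [smul_add, map_add, map_add, smul_add, ha u hu, hb u hu]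
  smul_mem' z m hm u hu := by
    rw [smul_comm u z m, map_smul, hm u hu, map_smul, smul_comm u z]

lemma F_smul_mem_commutingPart {M N : Type*} [AddCommGroup M] [Module ℂ M] [Module UTakiff M]
    [IsScalarTower ℂ UTakiff M] [AddCommGroup N] [Module ℂ N] [Module UTakiff N]
    [IsScalarTower ℂ UTakiff N] (φ : M →ₗ[ℂ] N) (hF : ∀ m, φ (F • m) = F • φ m) {m : M}
    (hm : m ∈ commutingPart φ) : F • m ∈ commutingPart φ := by
  have hE := hm E (by simp)
  have hH := hm H (by simp)
  have hEb := hm Eb (by simp)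
  have hHb := hm Hb (by simp)
  have hFb := hm Fb (by simp)
  rintro u (rfl | rfl | rfl | rfl | rfl)
  · rw [smul_smul_swap E_mul_F, hF, smul_smul_swap E_mul_F, map_add, hF, hE, hH]
  · rw [smul_smul_swap H_mul_F, hF, smul_smul_swap H_mul_F, map_add, hF, hH, smul_assoc, map_smul,
      hF, smul_assoc]
  · rw [smul_smul_swap Eb_mul_F, hF, smul_smul_swap Eb_mul_F, map_add, hF, hEb, hHb]
  · rw [smul_smul_swap Hb_mul_F, hF, smul_smul_swap Hb_mul_F, map_add, hF, hHb, smul_assoc,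
      map_smul, hFb, smul_assoc]
  · rw [smul_smul_comm' F_mul_Fb.symm, hF, hF, hFb, smul_smul_comm' F_mul_Fb]

lemma E_mul_Eb : E * Eb = Eb * E := by simpa [hi] using lo_mul_hi SlTwo.e SlTwo.e

lemma E_mul_Hb : E * Hb = Hb * E + (-2 : ℂ) • Eb := by
  rw [lo_mul_hi, ← lie_skew, SlTwo.lie_h_e, ← neg_smul, hi_smul]

/-- The sum of the layers with the weights `w`. -/
def layerSum (w : Fin 4 → ℂ) : (Fin 4 → ℂ[X]) →ₗ[ℂ] ℂ[X] := ∑ i, w i • LinearMap.proj i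

lemma layerSum_single (w : Fin 4 → ℂ) (i : Fin 4) (p : ℂ[X]) :
    layerSum w (Pi.single i p) = w i • p := by
  simp [layerSum, LinearMap.sum_apply, Pi.single_apply]

section Lift

variable {N : Type*} [AddCommGroup N] [Module ℂ N] [Module UTakiff N] [IsScalarTower ℂ UTakiff N]

/-- In an extension of `M(c)` by `M(d)`, the highest weight vector of the quotient lifts to a vector
killed by `e`, and, unless `d = c`, even to an eigenvector of `h`. -/
lemma exists_highestWeight_lift (hd : ∀ n : ℤ, d ≠ n) (i : PolyVerma d →ₗ[UTakiff] N)
    (q : N →ₗ[UTakiff] PolyVerma c) (hi : Function.Injective i) (hq : Function.Surjective q)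
    (hiq : Function.Exact i q) :
    ∃ (v : N) (w : ℂ), q v = PolyVerma.of c 1 ∧ w * (d - c) = 0 ∧ E • v = 0 ∧
      H • v = c • v + i (PolyVerma.of d (C w)) := by
  obtain ⟨v₀, hv₀⟩ := hq (PolyVerma.of c 1)
  obtain ⟨δ, hδ⟩ := (hiq (E • v₀)).1 (by
    rw [map_smul, hv₀, PolyVerma.E_smul, polyE_one, map_zero])
  obtain ⟨y, hy⟩ := polyE_surjective hd ((PolyVerma.of d).symm δ)
  have hy' : E • PolyVerma.of d y = δ := by rw [PolyVerma.E_smul, hy, LinearEquiv.apply_symm_apply]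
  have hqi (x) : q (i x) = 0 := (hiq _).2 ⟨x, rfl⟩
  set v₁ := v₀ - i (PolyVerma.of d y) with hv₁
  have hE : E • v₁ = 0 := by rw [hv₁, smul_sub, ← map_smul, hy', hδ, sub_self]
  have hqv : q v₁ = PolyVerma.of c 1 := by rw [hv₁, map_sub, hqi, sub_zero, hv₀]
  obtain ⟨β, hβ⟩ := (hiq (H • v₁ - c • v₁)).1 (by
    rw [map_sub, map_smul, map_smul_complex, hqv, PolyVerma.H_smul, polyH_one, map_smul, sub_self])
  have hEβ : polyE d ((PolyVerma.of d).symm β) = 0 := by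
    apply (PolyVerma.of d).injective
    apply hi
    rw [← PolyVerma.E_smul, LinearEquiv.apply_symm_apply, map_smul, hβ, map_zero, map_zero,
      smul_sub, smul_comm E c v₁, hE, smul_zero, sub_zero]
    have := smul_smul_swap H_mul_E v₁
    rw [hE, smul_assoc, hE, smul_zero, smul_zero, add_zero] at this
    exact this.symm
  obtain ⟨b, rfl⟩ : ∃ b, β = PolyVerma.of d (C b) :=
    ⟨_, ((PolyVerma.of d).symm_apply_eq).1 (eq_C_of_polyE_eq_zero hd hEβ)⟩
  have hH : H • v₁ = c • v₁ + i (PolyVerma.of d (C b)) := by rw [hβ]; abel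
  by_cases hcd : d = c
  · exact ⟨v₁, b, hqv, by simp [hcd], hE, hH⟩
  · have hcd' : d - c ≠ 0 := sub_ne_zero.2 hcd
    have hC (z : ℂ) : PolyVerma.of d (C z) = z • PolyVerma.of d 1 := by
      rw [← map_smul, smul_eq_C_mul, mul_one]
    obtain ⟨b, rfl⟩ : ∃ b', b = b' * (d - c) := ⟨b / (d - c), by field_simp⟩
    refine ⟨v₁ - i (PolyVerma.of d (C b)), 0, ?_, by simp, ?_, ?_⟩
    · rw [map_sub, hqi, sub_zero, hqv]
    · rw [smul_sub, hE, ← map_smul, hC, smul_comm, PolyVerma.E_smul, polyE_one]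
      simp
    · rw [smul_sub, hH, ← map_smul i H, hC, hC, hC, smul_comm, PolyVerma.H_smul, polyH_one,
        map_smul (PolyVerma.of d), zero_smul, map_zero]
      simp only [map_smul_complex]
      module

/-- The universal extension of `M(c)` maps to every extension of `M(c)` by some `M(d)`. For a lift
`v` of the highest weight vector as in `exists_highestWeight_lift`, the four vectors `(h - c) v`,
`ē v`, `h̄ v`, `f̄ v` lie in `M(d)`, and the relations determine them up to one scalar each: these
scalars `w₀`, `w₂`, `w₁`, `w₃` give the map on the layers of the kernel, where `w j` vanishes unless
the layer `j` has highest weight `d`. -/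
lemma exists_lift_univExt (hc : ∀ n : ℤ, c ≠ n) (hd : ∀ n : ℤ, d ≠ n)
    (i : PolyVerma d →ₗ[UTakiff] N)
    (q : N →ₗ[UTakiff] PolyVerma c) (hi : Function.Injective i) (hq : Function.Surjective q)
    (hiq : Function.Exact i q) :
    ∃ l : UnivExt c →ₗ[UTakiff] N, ∀ x, q (l x) = univProj c x := by
  obtain ⟨v, w₀, hqv, hw₀, hE, hH⟩ := exists_highestWeight_lift hd i q hi hq hiq
  have hqi (x) : q (i x) = 0 := (hiq _).2 ⟨x, rfl⟩
  let ι : ℂ[X] →ₗ[ℂ] N := toComplexLinear i ∘ₗ (PolyVerma.of d).toLinearMap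
  have hι : Function.Injective ι := hi.comp (PolyVerma.of d).injective
  have hιE (p) : E • ι p = ι (polyE d p) :=
    (map_smul i E _).symm.trans (congrArg i (PolyVerma.E_smul d p))
  have hιH (p) : H • ι p = ι (polyH d p) :=
    (map_smul i H _).symm.trans (congrArg i (PolyVerma.H_smul d p))
  have hιF (p) : F • ι p = ι (X * p) :=
    (map_smul i F _).symm.trans (congrArg i (PolyVerma.F_smul d p))
  have hιEb (p) : Eb • ι p = 0 :=
    (map_smul i Eb _).symm.trans ((congrArg i (PolyVerma.Eb_smul d p)).trans (map_zero i))
  have hιHb (p) : Hb • ι p = 0 :=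
    (map_smul i Hb _).symm.trans ((congrArg i (PolyVerma.Hb_smul d p)).trans (map_zero i))
  have hιFb (p) : Fb • ι p = 0 :=
    (map_smul i Fb _).symm.trans ((congrArg i (PolyVerma.Fb_smul d p)).trans (map_zero i))
  replace hH : H • v = c • v + ι (C w₀) := hH
  have hker (u : UTakiff) (hu : u • PolyVerma.of c 1 = 0) : ∃ p, ι p = u • v := by
    obtain ⟨p, hp⟩ := (hiq (u • v)).1 (by rw [map_smul, hqv, hu])
    exact ⟨p, hp⟩
  have hc0 : c ≠ 0 := by exact_mod_cast hc 0
  have hc1 : c + 1 ≠ 0 := fun h => hc (-1) (by push_cast; linear_combination h)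
  have hc2 : c + 2 ≠ 0 := fun h => hc (-2) (by push_cast; linear_combination h)
  obtain ⟨ε, hε⟩ := hker Eb (PolyVerma.Eb_smul c 1)
  obtain ⟨γ, hγ⟩ := hker Hb (PolyVerma.Hb_smul c 1)
  obtain ⟨a, ha⟩ := hker Fb (PolyVerma.Fb_smul c 1)
  -- `ē v` is a highest weight vector of weight `c + 2`
  have hEε : polyE d ε = 0 := hι (by
    rw [← hιE, hε, smul_smul_comm' E_mul_Eb, hE, smul_zero, map_zero])
  have hHε : polyH d ε = (c + 2) • ε := hι (by
    rw [← hιH, map_smul, hε, smul_smul_swap H_mul_Eb, hH, smul_add, hιEb, smul_comm, smul_assoc,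
      add_zero, ← add_smul])
  have hε0 := congrArg (fun p : ℂ[X] => p.coeff 0) hHε
  rw [eq_C_of_polyE_eq_zero hd hEε] at hε
  obtain ⟨w₂, hw₂⟩ : ∃ w₂, -((c + 1) * (c + 2)) * w₂ = ε.coeff 0 :=
    ⟨-(ε.coeff 0) / ((c + 1) * (c + 2)), by field_simp⟩
  simp only [coeff_polyH, coeff_smul, smul_eq_mul, Nat.cast_zero, mul_zero, sub_zero] at hε0
  rw [← hw₂] at hε0 hε
  have hw₂' : w₂ * (d - (c + 2)) = 0 := by
    have h : (c + 1) * (c + 2) * (w₂ * (d - (c + 2))) = 0 := by linear_combination -hε0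
    exact (mul_eq_zero.1 h).resolve_left (mul_ne_zero hc1 hc2)
  -- `h̄ v` has weight `c`, and its image under `e` is a multiple of `ē v`
  have hEγ : polyE d γ = C (2 * ((c + 1) * (c + 2)) * w₂) := hι (by
    rw [← hιE, hγ, smul_smul_swap E_mul_Hb, hE, smul_zero, zero_add, smul_assoc, ← hε, ← map_smul,
      smul_C]
    congr 2
    simp only [smul_eq_mul]
    ring)
  have hHγ : polyH d γ = c • γ := hι (by
    rw [← hιH, map_smul, hγ, smul_smul_comm' H_mul_Hb, hH, smul_add, hιHb, smul_comm, add_zero])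
  have hγ0 := congrArg (fun p : ℂ[X] => p.coeff 0) hHγ
  simp only [coeff_polyH, coeff_smul, smul_eq_mul, Nat.cast_zero, mul_zero, sub_zero] at hγ0
  have hγ' : polyE d (γ - (2 * (c + 1) * w₂) • X) = 0 := by
    rw [map_sub, map_smul, polyE_X, hEγ, smul_smul, smul_eq_C_mul, mul_one, ← C_sub, C_eq_zero]
    linear_combination -2 * (c + 1) * hw₂'
  have hγ'' := eq_C_of_polyE_eq_zero hd hγ'
  obtain ⟨w₁, hw₁⟩ : ∃ w₁, c * w₁ = γ.coeff 0 := ⟨γ.coeff 0 / c, by field_simp⟩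
  rw [coeff_sub, coeff_smul, coeff_X_zero, smul_zero, sub_zero, ← hw₁, sub_eq_iff_eq_add] at hγ''
  have hw₁' : w₁ * (d - c) = 0 := by
    have h : c * (w₁ * (d - c)) = 0 := by rw [← hw₁] at hγ0; linear_combination hγ0
    exact (mul_eq_zero.1 h).resolve_left hc0
  -- `f̄ v` has weight `c - 2`, and its image under `e` is `h̄ v`
  have hEa : polyE d a = γ := hι (by
    rw [← hιE, ha, smul_smul_swap E_mul_Fb, hE, smul_zero, zero_add, hγ])
  have hHa : polyH d a = (c - 2) • a := hι (by
    rw [← hιH, map_smul, ha, smul_smul_swap H_mul_Fb, hH, smul_add, hιFb, smul_comm, smul_assoc,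
      add_zero, ← add_smul, ← sub_eq_add_neg])
  have ha0 := congrArg (fun p : ℂ[X] => p.coeff 0) hHa
  simp only [coeff_polyH, coeff_smul, smul_eq_mul, Nat.cast_zero, mul_zero, sub_zero] at ha0
  have ha' : polyE d (a - (w₁ • X + w₂ • X ^ 2)) = 0 := by
    rw [map_sub, hEa, hγ'', map_add, map_smul, map_smul, polyE_X]
    have h2 : polyE d (X ^ 2) = (2 * (d - 1)) • X := by
      simp [polyE_apply, smul_eq_C_mul, C_two, C_sub]
      ring
    rw [h2]
    have e1 : C (c * w₁) = (c * w₁) • (1 : ℂ[X]) := by rw [smul_eq_C_mul, mul_one]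
    have e2 : w₁ * d = c * w₁ := by linear_combination hw₁'
    have e3 : w₂ * (2 * (d - 1)) = 2 * (c + 1) * w₂ := by linear_combination 2 * hw₂'
    rw [e1, smul_smul, smul_smul, e2, e3, sub_self]
  have ha'' := eq_C_of_polyE_eq_zero hd ha'
  set w₃ := a.coeff 0 with hw₃
  have : (a - (w₁ • X + w₂ • X ^ 2)).coeff 0 = w₃ := by simp [hw₃]
  rw [this, sub_eq_iff_eq_add] at ha''
  have hw₃' : w₃ * (d - (c - 2)) = 0 := by linear_combination ha0
  let w : Fin 4 → ℂ := ![w₀, w₁, w₂, w₃]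
  have hw (j : Fin 4) : w j * (d - (c + layerShift j)) = 0 := by
    fin_cases j
    · simpa [w, layerShift] using hw₀
    · simpa [w, layerShift] using hw₁'
    · simpa [w, layerShift] using hw₂'
    · simpa [w, layerShift, sub_eq_add_neg] using hw₃'
  let φ : UnivExt c →ₗ[ℂ] N :=
    (polyAct v).coprod (ι ∘ₗ layerSum w) ∘ₗ (UnivExt.of c).symm.toLinearMap
  have hφ0 (p : ℂ[X]) : φ (UnivExt.of c (p, 0)) = polyAct v p := by simp [φ]
  have hφl (j : Fin 4) (p : ℂ[X]) : φ (UnivExt.layer c j p) = w j • ι p := by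
    simp [φ, UnivExt.layer_apply, layerSum_single]
  have hsplit (V : Submodule ℂ (UnivExt c)) (h0 : ∀ p, UnivExt.of c (p, 0) ∈ V)
      (hl : ∀ j p, UnivExt.layer c j p ∈ V) (x : UnivExt c) : x ∈ V := by
    have := UnivExt.of_eq_add_sum c x.1 x.2
    change x = _ at this
    rw [this]
    exact V.add_mem (h0 _) (V.sum_mem fun j _ => hl j _)
  have hφF (x : UnivExt c) : φ (F • x) = F • φ x := by
    refine hsplit (LinearMap.eqLocus (φ ∘ₗ Algebra.lsmul ℂ ℂ _ F) (Algebra.lsmul ℂ ℂ _ F ∘ₗ φ))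
      (fun p => ?_) (fun j p => ?_) x
    · change φ (F • _) = F • φ _
      rw [hφ0, UnivExt.F_smul, map_zero, hφ0, polyAct_X_mul]
    · change φ (F • _) = F • φ _
      rw [UnivExt.F_smul_layer, hφl, hφl, smul_comm, hιF]
  have hone : UnivExt.of c (1, 0) ∈ commutingPart φ := by
    have hv : φ (UnivExt.of c (1, 0)) = v := by rw [hφ0, polyAct_one]
    rintro u (rfl | rfl | rfl | rfl | rfl)
    · rw [UnivExt.E_smul_one, map_zero, hv, hE]
    · rw [UnivExt.H_smul_one, map_add, map_smul, hv, hφl, hH, ← map_smul, smul_eq_C_mul, mul_one]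
      rfl
    · rw [UnivExt.Eb_smul_one, map_smul, hv, hφl, ← hε, ← map_smul, ← map_smul, smul_smul,
        smul_eq_C_mul, mul_one]
      rfl
    · rw [UnivExt.Hb_smul_one, map_add, map_smul, map_smul, hv, hφl, hφl, ← hγ, hγ'',
        ← map_smul, ← map_smul, ← map_smul, ← map_smul, smul_smul, smul_smul, smul_eq_C_mul,
        mul_one, ← map_add]
      rfl
    · rw [UnivExt.Fb_smul_one, map_add, map_add, hv, hφl, hφl, hφl, ← ha, ha'', map_add, map_add,
        map_smul, map_smul, add_comm]
      congr 1
      rw [← map_smul, smul_eq_C_mul, mul_one]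
      rfl
  have hlay (j : Fin 4) (p : ℂ[X]) : UnivExt.layer c j p ∈ commutingPart φ := by
    by_cases hwj : w j = 0
    · rintro u (rfl | rfl | rfl | rfl | rfl)
      · rw [UnivExt.E_smul_layer, hφl, hφl, hwj, zero_smul, zero_smul, smul_zero]
      · rw [UnivExt.H_smul_layer, hφl, hφl, hwj, zero_smul, zero_smul, smul_zero]
      · rw [UnivExt.Eb_smul_layer, hφl, hwj, zero_smul, smul_zero, map_zero]
      · rw [UnivExt.Hb_smul_layer, hφl, hwj, zero_smul, smul_zero, map_zero]
      · rw [UnivExt.Fb_smul_layer, hφl, hwj, zero_smul, smul_zero, map_zero]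
    · have hd' : c + layerShift j = d :=
        (sub_eq_zero.1 ((mul_eq_zero.1 (hw j)).resolve_left hwj)).symm
      rintro u (rfl | rfl | rfl | rfl | rfl)
      · rw [UnivExt.E_smul_layer, hφl, hφl, hd', smul_comm, hιE]
      · rw [UnivExt.H_smul_layer, hφl, hφl, hd', smul_comm, hιH]
      · rw [UnivExt.Eb_smul_layer, hφl, smul_comm, hιEb, smul_zero, map_zero]
      · rw [UnivExt.Hb_smul_layer, hφl, smul_comm, hιHb, smul_zero, map_zero]
      · rw [UnivExt.Fb_smul_layer, hφl, smul_comm, hιFb, smul_zero, map_zero]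
  have hcomm (x : UnivExt c) : x ∈ commutingPart φ := by
    refine hsplit _ (fun p => ?_) hlay x
    refine mem_of_X_mul_mem
      ((UnivExt.of c).toLinearMap ∘ₗ LinearMap.inl ℂ ℂ[X] (Fin 4 → ℂ[X])) (fun p hp => ?_) hone p
    have h := F_smul_mem_commutingPart φ hφF hp
    simpa [UnivExt.F_smul] using h
  refine ⟨homOfBasis φ (fun x => hcomm x E (by simp)) (fun x => hcomm x H (by simp)) hφF
    (fun x => hcomm x Eb (by simp)) (fun x => hcomm x Hb (by simp))
    (fun x => hcomm x Fb (by simp)), fun x => ?_⟩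
  change q (φ x) = univProj c x
  refine hsplit (LinearMap.eqLocus (toComplexLinear q ∘ₗ φ) (toComplexLinear (univProj c)))
      (fun p => ?_) (fun j p => ?_) x
  · change q (φ _) = univProj c _
    rw [hφ0, univProj_of]
    change q (aeval F p • v) = _
    rw [map_smul, hqv]
    have h := mem_of_X_mul_mem
      (V := LinearMap.eqLocus (polyAct (PolyVerma.of c 1)) (PolyVerma.of c).toLinearMap)
      LinearMap.id
      (fun p hp => by
        change polyAct _ (X * p) = PolyVerma.of c (X * p)
        rw [polyAct_X_mul, ← PolyVerma.F_smul]
        exact congrArg (F • ·) hp) (polyAct_one _) p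
    exact h
  · change q (φ _) = univProj c _
    have h0 : q (ι p) = 0 := hqi _
    rw [hφl, map_smul_complex, h0, smul_zero, UnivExt.layer_apply, univProj_of, map_zero]

end Lift

/-- Every homomorphism from the universal extension to some `M(d)` kills the kernel. As `sl₂ ⊗ x`
acts by zero on `M(d)`, the images of the generator under `ē`, `h̄`, `f̄` show that the layers `2`,
`1`, `3` are killed, in this order, since `c` is nonintegral. The generator is killed by `(h - c)²`,
and `h` has no Jordan blocks on `M(d)`, so that the layer `0`, generated by the image of `h - c`, is
killed too. -/
lemma comp_univIncl_eq_zero (hc : ∀ n : ℤ, c ≠ n) (hd : ∀ n : ℤ, d ≠ n)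
    (k : UnivExt c →ₗ[UTakiff] PolyVerma d) (x : UnivKernel c) : k (univIncl c x) = 0 := by
  have hc0 : c ≠ 0 := by exact_mod_cast hc 0
  have hc1 : c + 1 ≠ 0 := fun h => hc (-1) (by push_cast; linear_combination h)
  have hc2 : c + 2 ≠ 0 := fun h => hc (-2) (by push_cast; linear_combination h)
  obtain ⟨p, hp⟩ := (PolyVerma.of d).surjective (k (UnivExt.of c (1, 0)))
  have hstep {j : Fin 4} (h : k (UnivExt.layer c j 1) = 0) (p : ℂ[X]) :
      k (UnivExt.layer c j p) = 0 :=
    mem_of_F_equivariant (N := LinearMap.ker k) (UnivExt.layer c j)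
      (fun p => (UnivExt.F_smul_layer c j p).symm) h p
  have hE : polyE d p = 0 := (PolyVerma.of d).injective (by
    rw [← PolyVerma.E_smul, hp, ← map_smul, UnivExt.E_smul_one, map_zero, map_zero])
  have hEb := congrArg k (UnivExt.Eb_smul_one c)
  have hHb := congrArg k (UnivExt.Hb_smul_one c)
  have hFb := congrArg k (UnivExt.Fb_smul_one c)
  have hH := congrArg k (UnivExt.H_smul_one c)
  rw [map_smul, ← hp, PolyVerma.Eb_smul, map_smul_complex, eq_comm,
    smul_eq_zero_iff_right (neg_ne_zero.2 (mul_ne_zero hc1 hc2))] at hEb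
  have h2 := hstep hEb
  rw [map_smul, ← hp, PolyVerma.Hb_smul, map_add, map_smul_complex, map_smul_complex, h2, smul_zero,
    add_zero, eq_comm, smul_eq_zero_iff_right hc0] at hHb
  have h1 := hstep hHb
  rw [map_smul, ← hp, PolyVerma.Fb_smul, map_add, map_add, h1, h2, zero_add, zero_add,
    eq_comm] at hFb
  have h3 := hstep hFb
  obtain ⟨a, rfl⟩ : ∃ a, p = a • 1 := by
    refine ⟨p.coeff 0, ?_⟩
    rw [smul_eq_C_mul, mul_one]
    exact eq_C_of_polyE_eq_zero hd hE
  have hH0 : k (UnivExt.layer c 0 1) = ((d - c) * a) • PolyVerma.of d 1 := by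
    rw [map_smul, map_add, map_smul_complex, ← hp, PolyVerma.H_smul, map_smul (polyH d), polyH_one,
      map_smul, map_smul] at hH
    rw [eq_sub_of_add_eq' hH.symm, map_smul (PolyVerma.of d)]
    module
  have h0 : k (UnivExt.layer c 0 1) = 0 := by
    have h := congrArg k (UnivExt.H_smul_layer c 0 1)
    have hs : c + layerShift 0 = c := by simp [layerShift]
    rw [map_smul, hs, polyH_one, map_smul (UnivExt.layer c 0), map_smul_complex, hH0, smul_comm,
      PolyVerma.H_smul, polyH_one, map_smul, smul_smul, smul_smul, ← sub_eq_zero, ← sub_smul] at h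
    have h1 : PolyVerma.of d 1 ≠ 0 := (PolyVerma.of d).map_ne_zero_iff.2 one_ne_zero
    have h' : (d - c) * ((d - c) * a) = 0 := by
      have := (smul_eq_zero.1 h).resolve_right h1
      linear_combination this
    have h'' : (d - c) * a = 0 := by
      rcases mul_eq_zero.1 h' with h' | h'
      · rw [h', zero_mul]
      · exact h'
    rw [hH0, h'', zero_smul]
  have hall (j : Fin 4) (p : ℂ[X]) : k (UnivExt.layer c j p) = 0 := by
    fin_cases j
    exacts [hstep h0 p, h1 p, h2 p, h3 p]
  have hx := UnivExt.of_eq_add_sum c 0 x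
  change univIncl c x = UnivExt.of c 0 + _ at hx
  rw [hx, map_zero, zero_add, map_sum]
  exact Finset.sum_eq_zero fun j _ => hall j _

/-- The layers isomorphic to the module with highest weight `d`. -/
abbrev matchingLayers (c d : ℂ) : Type := {j : Fin 4 // c + layerShift j = d}

/-- The sum of the layers of highest weight `d`, with the weights `w`. -/
def matchingSum (w : matchingLayers c d → ℂ) : (Fin 4 → ℂ[X]) →ₗ[ℂ] ℂ[X] :=
  ∑ j, w j • LinearMap.proj j.1

/-- The homomorphism from the kernel to `M(d)` given by a weight for each layer isomorphic to it. -/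
def kernelHom (w : matchingLayers c d → ℂ) : UnivKernel c →ₗ[UTakiff] PolyVerma d :=
  homOfBasis (M := UnivKernel c) (N := PolyVerma d)
    ((PolyVerma.of d).toLinearMap ∘ₗ matchingSum w ∘ₗ (UnivKernel.of c).symm.toLinearMap)
    (fun x => by
      obtain ⟨k, rfl⟩ := (UnivKernel.of c).surjective x
      rw [UnivKernel.E_smul]
      simp only [LinearMap.comp_apply, LinearEquiv.coe_coe, LinearEquiv.symm_apply_apply,
        PolyVerma.E_smul]
      simp [matchingSum, kernelE, fun j : matchingLayers c d => j.2])
    (fun x => by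
      obtain ⟨k, rfl⟩ := (UnivKernel.of c).surjective x
      rw [UnivKernel.H_smul]
      simp only [LinearMap.comp_apply, LinearEquiv.coe_coe, LinearEquiv.symm_apply_apply,
        PolyVerma.H_smul]
      simp [matchingSum, kernelH, fun j : matchingLayers c d => j.2])
    (fun x => by
      obtain ⟨k, rfl⟩ := (UnivKernel.of c).surjective x
      rw [UnivKernel.F_smul]
      simp only [LinearMap.comp_apply, LinearEquiv.coe_coe, LinearEquiv.symm_apply_apply,
        PolyVerma.F_smul]
      simp [matchingSum, kernelF, polyF_apply, Finset.mul_sum])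
    (fun x => by
      rw [show Eb • x = 0 from UnivKernel.Eb_smul c x, map_zero]
      exact (PolyVerma.Eb_smul d _).symm)
    (fun x => by
      rw [show Hb • x = 0 from UnivKernel.Hb_smul c x, map_zero]
      exact (PolyVerma.Hb_smul d _).symm)
    (fun x => by
      rw [show Fb • x = 0 from UnivKernel.Fb_smul c x, map_zero]
      exact (PolyVerma.Fb_smul d _).symm)

lemma kernelHom_of (w : matchingLayers c d → ℂ) (k : Fin 4 → ℂ[X]) :
    kernelHom w (UnivKernel.of c k) = PolyVerma.of d (∑ j, w j • k j.1) := by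
  change PolyVerma.of d (matchingSum w k) = _
  simp [matchingSum]

lemma kernelHom_single (w : matchingLayers c d → ℂ) (j : Fin 4) (p : ℂ[X]) :
    kernelHom w (UnivKernel.of c (Pi.single j p)) =
      (if h : c + layerShift j = d then w ⟨j, h⟩ else 0) • PolyVerma.of d p := by
  rw [kernelHom_of, ← map_smul]
  congr 1
  split_ifs with h
  · rw [Finset.sum_eq_single ⟨j, h⟩ (fun b _ hb => by
      rw [Pi.single_eq_of_ne (fun hj => hb (Subtype.ext hj)), smul_zero]) (by simp)]
    simp
  · rw [zero_smul]
    refine Finset.sum_eq_zero fun b _ => ?_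
    rw [Pi.single_eq_of_ne (by rintro rfl; exact h b.2), smul_zero]

lemma exists_eq_kernelHom (hd : ∀ n : ℤ, d ≠ n) (k : UnivKernel c →ₗ[UTakiff] PolyVerma d) :
    ∃ w : matchingLayers c d → ℂ, k = kernelHom w := by
  have key (j : Fin 4) : ∃ a : ℂ, k (UnivKernel.of c (Pi.single j 1)) = a • PolyVerma.of d 1 ∧
      a * (d - (c + layerShift j)) = 0 := by
    obtain ⟨p, hp⟩ := (PolyVerma.of d).surjective (k (UnivKernel.of c (Pi.single j 1)))
    have hE : polyE d p = 0 := (PolyVerma.of d).injective (by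
      rw [← PolyVerma.E_smul, hp, ← map_smul, UnivKernel.E_smul, kernelE_single, polyE_one,
        Pi.single_zero, map_zero, map_zero, map_zero])
    have hH : polyH d p = (c + layerShift j) • p := (PolyVerma.of d).injective (by
      rw [← PolyVerma.H_smul, hp, ← map_smul, UnivKernel.H_smul, kernelH_single, polyH_one,
        Pi.single_smul, map_smul, map_smul_complex, map_smul, hp])
    have h0 := congrArg (fun p : ℂ[X] => p.coeff 0) hH
    simp only [coeff_polyH, coeff_smul, smul_eq_mul, Nat.cast_zero, mul_zero, sub_zero] at h0
    refine ⟨p.coeff 0, ?_, by linear_combination h0⟩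
    rw [← hp, ← map_smul, smul_eq_C_mul, mul_one]
    exact congrArg _ (eq_C_of_polyE_eq_zero hd hE)
  choose a ha ha' using key
  refine ⟨fun j => a j, ?_⟩
  have hone (j : Fin 4) : k (UnivKernel.of c (Pi.single j 1)) =
      kernelHom (fun j : matchingLayers c d => a j) (UnivKernel.of c (Pi.single j 1)) := by
    rw [ha, kernelHom_single]
    split_ifs with h
    · rfl
    · rw [(mul_eq_zero.1 (ha' j)).resolve_right (sub_ne_zero.2 (Ne.symm h))]
  have hp (j : Fin 4) (p : ℂ[X]) : UnivKernel.of c (Pi.single j p) ∈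
      LinearMap.eqLocus k (kernelHom (fun j : matchingLayers c d => a j)) := by
    refine mem_of_F_equivariant
      ((UnivKernel.of c).toLinearMap ∘ₗ LinearMap.single ℂ (fun _ => ℂ[X]) j) (fun p => ?_)
      (hone j) p
    simp [UnivKernel.F_smul, kernelF_single]
  ext x
  obtain ⟨x, rfl⟩ := (UnivKernel.of c).surjective x
  rw [← Finset.univ_sum_single x, map_sum]
  exact Submodule.sum_mem (LinearMap.eqLocus k _) fun j _ => hp j _

variable (c d) in
/-- The homomorphisms from the kernel to `M(d)` correspond to the weights of the matching layers. -/
def kernelHomEquiv (hd : ∀ n : ℤ, d ≠ n) :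
    (matchingLayers c d → ℂ) ≃ₗ[ℂ] (UnivKernel c →ₗ[UTakiff] PolyVerma d) :=
  LinearEquiv.ofBijective
    { toFun := kernelHom
      map_add' := fun w w' => by
        ext x
        obtain ⟨x, rfl⟩ := (UnivKernel.of c).surjective x
        rw [LinearMap.add_apply, kernelHom_of, kernelHom_of, kernelHom_of, ← map_add,
          ← Finset.sum_add_distrib]
        simp only [Pi.add_apply, add_smul]
      map_smul' := fun z w => by
        ext x
        obtain ⟨x, rfl⟩ := (UnivKernel.of c).surjective x
        rw [LinearMap.smul_apply, kernelHom_of, RingHom.id_apply, kernelHom_of, ← map_smul,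
          Finset.smul_sum]
        simp only [Pi.smul_apply, smul_eq_mul, mul_smul] }
    ⟨fun w w' h => by
      funext j
      have := LinearMap.congr_fun h (UnivKernel.of c (Pi.single j.1 1))
      change kernelHom w _ = kernelHom w' _ at this
      rw [kernelHom_single, kernelHom_single, dif_pos j.2, dif_pos j.2] at this
      exact smul_left_injective ℂ ((PolyVerma.of d).map_ne_zero_iff.2 one_ne_zero) this,
    fun k => by
      obtain ⟨w, rfl⟩ := exists_eq_kernelHom hd k
      exact ⟨w, rfl⟩⟩

/-- For nonintegral `d`, the module `M(d)` is simple, as `e` lowers the degree of a nonconstant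
polynomial by exactly one. -/
lemma PolyVerma.eq_bot_or_eq_top (hd : ∀ n : ℤ, d ≠ n) (N : Submodule UTakiff (PolyVerma d)) :
    N = ⊥ ∨ N = ⊤ := by
  refine or_iff_not_imp_left.2 fun hN => PolyVerma.eq_top_of_one_mem d ?_
  obtain ⟨x, hx, hx0⟩ := (Submodule.ne_bot_iff N).1 hN
  obtain ⟨p, rfl⟩ := (PolyVerma.of d).surjective x
  rw [(PolyVerma.of d).map_ne_zero_iff] at hx0
  obtain ⟨n, hn⟩ : ∃ n, p.natDegree ≤ n := ⟨_, le_rfl⟩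
  induction n generalizing p with
  | zero =>
    have hp := eq_C_of_natDegree_le_zero hn
    have h0 : p.coeff 0 ≠ 0 := fun h => hx0 (by rw [hp, h, C_0])
    have : PolyVerma.of d 1 = (p.coeff 0)⁻¹ • PolyVerma.of d p := by
      rw [← map_smul, smul_eq_C_mul]
      nth_rewrite 2 [hp]
      rw [← C_mul, inv_mul_cancel₀ h0, C_1]
    rw [this]
    exact N.smul_of_tower_mem _ hx
  | succ n ih =>
    by_cases hE : polyE d p = 0
    · refine ih p hx hx0 ?_
      rw [eq_C_of_polyE_eq_zero hd hE]
      simp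
    · refine ih (polyE d p) (PolyVerma.E_smul d p ▸ N.smul_mem E hx) hE ?_
      refine natDegree_le_iff_coeff_eq_zero.2 fun m hm => ?_
      rw [coeff_polyE, coeff_eq_zero_of_natDegree_lt (by omega), mul_zero]

end PolynomialExtensions

end Takiff

/-! ### Highest weight vectors and supports -/

namespace Takiff

section HighestWeight

open Polynomial

variable {M : Type*} [AddCommGroup M] [Module ℂ M] [Module UTakiff M] [IsScalarTower ℂ UTakiff M]

/-- The space spanned by the vectors obtained from `v` by applying `f` and `f ⊗ x` altogether `n`
times. -/
def lowered (v : M) : ℕ → Submodule ℂ M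
  | 0 => Submodule.span ℂ {v}
  | n + 1 =>
    (lowered v n).map (Algebra.lsmul ℂ ℂ M F) ⊔ (lowered v n).map (Algebra.lsmul ℂ ℂ M Fb)

/-- A highest weight vector of weight `μ`. -/
structure IsHighestWeight (v : M) (μ : Weight) : Prop where
  E_smul : E • v = 0
  Eb_smul : Eb • v = 0
  H_smul : H • v = μ.1 • v
  Hb_smul : Hb • v = μ.2 • v

namespace IsHighestWeight

variable {v : M} {μ : Weight}

lemma F_mem_lowered {n : ℕ} {w : M} (hw : w ∈ lowered v n) : F • w ∈ lowered v (n + 1) :=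
  Submodule.mem_sup_left ⟨w, hw, rfl⟩

lemma Fb_mem_lowered {n : ℕ} {w : M} (hw : w ∈ lowered v n) : Fb • w ∈ lowered v (n + 1) :=
  Submodule.mem_sup_right ⟨w, hw, rfl⟩

lemma lowered_succ_induction {n : ℕ} {V : Submodule ℂ M} (hF : ∀ w ∈ lowered v n, F • w ∈ V)
    (hFb : ∀ w ∈ lowered v n, Fb • w ∈ V) : ∀ w ∈ lowered v (n + 1), w ∈ V := by
  have : lowered v (n + 1) ≤ V := by
    refine sup_le ?_ ?_
    · rintro _ ⟨w, hw, rfl⟩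
      exact hF w hw
    · rintro _ ⟨w, hw, rfl⟩
      exact hFb w hw
  exact this

lemma H_smul_lowered (h : IsHighestWeight v μ) (n : ℕ) :
    ∀ w ∈ lowered v n, H • w = (μ.1 - 2 * n) • w := by
  induction n with
  | zero =>
    intro w hw
    obtain ⟨a, rfl⟩ := Submodule.mem_span_singleton.1 hw
    rw [smul_comm, h.H_smul, smul_comm]
    simp
  | succ n ih =>
    refine lowered_succ_induction (V := LinearMap.eqLocus (Algebra.lsmul ℂ ℂ M H)
      ((μ.1 - 2 * (n + 1 : ℕ)) • LinearMap.id)) (fun w hw => ?_) (fun w hw => ?_)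
    · change H • F • w = (μ.1 - 2 * (n + 1 : ℕ)) • F • w
      rw [smul_smul_swap H_mul_F, ih w hw, smul_comm, smul_assoc, ← add_smul]
      congr 1
      push_cast
      ring
    · change H • Fb • w = (μ.1 - 2 * (n + 1 : ℕ)) • Fb • w
      rw [smul_smul_swap H_mul_Fb, ih w hw, smul_comm, smul_assoc, ← add_smul]
      congr 1
      push_cast
      ring

lemma Hb_smul_lowered (h : IsHighestWeight v μ) (n : ℕ) :
    ∀ w ∈ lowered v n, Hb • w ∈ lowered v n := by
  induction n with
  | zero =>
    intro w hw
    obtain ⟨a, rfl⟩ := Submodule.mem_span_singleton.1 hw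
    rw [smul_comm, h.Hb_smul]
    exact Submodule.smul_mem _ _ (Submodule.smul_mem _ _ (Submodule.mem_span_singleton_self v))
  | succ n ih =>
    refine lowered_succ_induction (V := (lowered v (n + 1)).comap (Algebra.lsmul ℂ ℂ M Hb))
      (fun w hw => ?_) (fun w hw => ?_)
    · change Hb • F • w ∈ lowered v (n + 1)
      rw [smul_smul_swap Hb_mul_F, smul_assoc]
      exact add_mem (F_mem_lowered (ih w hw)) (Submodule.smul_mem _ _ (Fb_mem_lowered hw))
    · change Hb • Fb • w ∈ lowered v (n + 1)
      rw [smul_smul_comm' Hb_mul_Fb]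
      exact Fb_mem_lowered (ih w hw)

lemma raise_lowered (h : IsHighestWeight v μ) (n : ℕ) :
    ∀ w ∈ lowered v n,
      (E • w ∈ lowered v (n - 1) ∧ F • E • w ∈ lowered v n ∧ Fb • E • w ∈ lowered v n) ∧
      (Eb • w ∈ lowered v (n - 1) ∧ F • Eb • w ∈ lowered v n ∧ Fb • Eb • w ∈ lowered v n) := by
  induction n with
  | zero =>
    intro w hw
    obtain ⟨a, rfl⟩ := Submodule.mem_span_singleton.1 hw
    simp only [smul_comm _ a v, h.E_smul, h.Eb_smul, smul_zero, zero_mem, and_self]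
  | succ n ih =>
    have key : ∀ w ∈ lowered v (n + 1), E • w ∈ lowered v n ∧ Eb • w ∈ lowered v n := by
      refine lowered_succ_induction (V := (lowered v n).comap (Algebra.lsmul ℂ ℂ M E) ⊓
        (lowered v n).comap (Algebra.lsmul ℂ ℂ M Eb)) (fun w hw => ?_) (fun w hw => ?_)
      · change E • F • w ∈ lowered v n ∧ Eb • F • w ∈ lowered v n
        rw [smul_smul_swap E_mul_F, smul_smul_swap Eb_mul_F, h.H_smul_lowered _ w hw]
        exact ⟨add_mem (ih w hw).1.2.1 (Submodule.smul_mem _ _ hw),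
          add_mem (ih w hw).2.2.1 (h.Hb_smul_lowered _ w hw)⟩
      · change E • Fb • w ∈ lowered v n ∧ Eb • Fb • w ∈ lowered v n
        rw [smul_smul_swap E_mul_Fb, smul_smul_comm' Eb_mul_Fb]
        exact ⟨add_mem (ih w hw).1.2.2 (h.Hb_smul_lowered _ w hw), (ih w hw).2.2.2⟩
    intro w hw
    obtain ⟨h1, h2⟩ := key w hw
    exact ⟨⟨h1, F_mem_lowered h1, Fb_mem_lowered h1⟩, ⟨h2, F_mem_lowered h2, Fb_mem_lowered h2⟩⟩

/-- A module generated by a highest weight vector is the sum of the spaces of lowered vectors. -/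
lemma iSup_lowered_eq_top (h : IsHighestWeight v μ) (hv : Submodule.span UTakiff {v} = ⊤) :
    ⨆ n, lowered v n = ⊤ := by
  have key (u : UTakiff) (m : ℕ → ℕ) (hu : ∀ n, ∀ w ∈ lowered v n, u • w ∈ lowered v (m n)) :
      u ∈ stabilizer (⨆ n, lowered v n) := by
    have : ⨆ n, lowered v n ≤ (⨆ n, lowered v n).comap (Algebra.lsmul ℂ ℂ M u) :=
      iSup_le fun n w hw => (le_iSup (lowered v) (m n)) (hu n w hw)
    exact this
  have htop : stabilizer (⨆ n, lowered v n) = ⊤ :=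
    subalgebra_eq_top _ (key E (· - 1) fun n w hw => (h.raise_lowered n w hw).1.1)
      (key H id fun n w hw => by
        rw [h.H_smul_lowered n w hw]
        exact Submodule.smul_mem _ _ hw)
      (key F (· + 1) fun n w hw => F_mem_lowered hw)
      (key Eb (· - 1) fun n w hw => (h.raise_lowered n w hw).2.1)
      (key Hb id h.Hb_smul_lowered)
      (key Fb (· + 1) fun n w hw => Fb_mem_lowered hw)
  refine Submodule.eq_top_iff'.2 fun x => ?_
  obtain ⟨u, rfl⟩ := Submodule.mem_span_singleton.1 (hv ▸ Submodule.mem_top : x ∈ _)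
  have hu : u ∈ stabilizer (⨆ n, lowered v n) := htop ▸ Algebra.mem_top
  exact hu v ((le_iSup (lowered v) 0) (Submodule.mem_span_singleton_self v))

lemma aeval_H_smul {w : M} {a : ℂ} (h : H • w = a • w) (Q : ℂ[X]) :
    aeval H Q • w = Q.eval a • w := by
  induction Q using Polynomial.induction_on' with
  | add p q hp hq => rw [map_add, add_smul, hp, hq, eval_add, add_smul]
  | monomial n b =>
    have hn : H ^ n • w = a ^ n • w := by
      induction n with
      | zero => simp
      | succ n ih => rw [pow_succ, mul_smul, h, smul_comm, ih, smul_smul, pow_succ, mul_comm]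
    rw [aeval_monomial, mul_smul, hn, algebraMap_smul, eval_monomial, smul_smul]

/-- Modulo the line of the generator, every vector of a highest weight module is killed by a
polynomial in `h` which does not vanish at the highest weight. -/
lemma exists_lowerPoly (h : IsHighestWeight v μ) (hv : Submodule.span UTakiff {v} = ⊤) (x : M) :
    ∃ (a : ℂ) (Q : ℂ[X]), Q.eval μ.1 ≠ 0 ∧ aeval H Q • (x - a • v) = 0 := by
  have hx : x ∈ ⨆ n, lowered v n := h.iSup_lowered_eq_top hv ▸ Submodule.mem_top
  induction hx using Submodule.iSup_induction' with
  | mem n w hw =>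
    cases n with
    | zero =>
      obtain ⟨a, rfl⟩ := Submodule.mem_span_singleton.1 hw
      exact ⟨a, 1, by simp, by simp⟩
    | succ n =>
      refine ⟨0, X - C (μ.1 - 2 * (n + 1 : ℕ)), ?_, ?_⟩
      · rw [eval_sub, eval_X, eval_C, sub_sub_cancel]
        exact mul_ne_zero two_ne_zero (Nat.cast_ne_zero.2 n.succ_ne_zero)
      · rw [zero_smul, sub_zero, aeval_H_smul (h.H_smul_lowered _ w hw)]
        simp
  | zero => exact ⟨0, 1, by simp, by simp⟩
  | add x y _ _ hx hy =>
    obtain ⟨a, Q, hQ, hx⟩ := hx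
    obtain ⟨b, R, hR, hy⟩ := hy
    refine ⟨a + b, Q * R, by rw [eval_mul]; exact mul_ne_zero hQ hR, ?_⟩
    have : x + y - (a + b) • v = (x - a • v) + (y - b • v) := by module
    rw [this, smul_add, map_mul, mul_smul _ _ (y - _), hy, smul_zero, add_zero, ← map_mul,
      mul_comm, map_mul, mul_smul, hx, smul_zero]

/-- A homomorphism from a highest weight module to a simple polynomial module which maps generator
to generator kills every proper submodule. -/
lemma le_ker_of_ne_top {c : ℂ} (hc : ∀ n : ℤ, c ≠ n) (h : IsHighestWeight v (c, 0))
    (hv : Submodule.span UTakiff {v} = ⊤) (g : M →ₗ[UTakiff] PolyVerma c)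
    (hg : g v = PolyVerma.of c 1) {N : Submodule UTakiff M} (hN : N ≠ ⊤) :
    N ≤ LinearMap.ker g := by
  intro x hx
  by_contra hgx
  rw [LinearMap.mem_ker] at hgx
  have hspan : Submodule.span UTakiff {g x} = ⊤ :=
    (PolyVerma.eq_bot_or_eq_top hc _).resolve_left (by simpa using hgx)
  obtain ⟨u, hu⟩ := Submodule.mem_span_singleton.1
    (hspan ▸ Submodule.mem_top : PolyVerma.of c 1 ∈ Submodule.span UTakiff {g x})
  obtain ⟨a, Q, hQ, hQx⟩ := h.exists_lowerPoly hv (u • x)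
  have hH1 : H • PolyVerma.of c 1 = c • PolyVerma.of c 1 := by
    rw [PolyVerma.H_smul, polyH_one, map_smul]
  have h1 : aeval H Q • u • x = (Q.eval c * a) • v := by
    rw [smul_sub, sub_eq_zero, smul_comm _ a v, aeval_H_smul h.H_smul] at hQx
    rw [hQx, smul_smul, mul_comm]
  have h2 := congrArg g h1
  rw [map_smul, map_smul, map_smul_complex, hg, hu, aeval_H_smul hH1] at h2
  have h3 : Q.eval c * a ≠ 0 := by
    intro h0
    rw [h0, zero_smul, smul_eq_zero] at h2
    exact h2.elim hQ ((PolyVerma.of c).map_ne_zero_iff.2 one_ne_zero)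
  have hvN : v ∈ N := by
    have : (Q.eval c * a)⁻¹ • (aeval H Q • u • x) ∈ N :=
      N.smul_of_tower_mem _ (N.smul_mem _ (N.smul_mem _ hx))
    rwa [h1, smul_smul, inv_mul_cancel₀ h3, one_smul] at this
  refine hN (top_unique ?_)
  rw [← hv, Submodule.span_le, Set.singleton_subset_iff]
  exact hvN

/-- The homomorphism from the Verma module given by a highest weight vector. -/
def vermaLift (h : IsHighestWeight v μ) : Verma μ →ₗ[UTakiff] M :=
  (vermaIdeal μ).liftQ (LinearMap.toSpanSingleton UTakiff M v) (by
    rw [vermaIdeal, Submodule.span_le]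
    rintro u (rfl | rfl | rfl | rfl)
    · exact h.E_smul
    · exact h.Eb_smul
    · change (H - algebraMap ℂ UTakiff μ.1) • v = 0
      rw [sub_smul, algebraMap_smul, h.H_smul, sub_self]
    · change (Hb - algebraMap ℂ UTakiff μ.2) • v = 0
      rw [sub_smul, algebraMap_smul, h.Hb_smul, sub_self])

lemma vermaLift_mk (h : IsHighestWeight v μ) (u : UTakiff) :
    h.vermaLift ((vermaIdeal μ).mkQ u) = u • v := rfl

variable (μ) in
lemma verma : IsHighestWeight (M := Verma μ) ((vermaIdeal μ).mkQ 1) μ := by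
  have hz {u : UTakiff} (hu : u ∈ vermaIdeal μ) : u • (vermaIdeal μ).mkQ 1 = 0 := by
    rw [← map_smul, smul_eq_mul, mul_one, Submodule.mkQ_apply, Submodule.Quotient.mk_eq_zero]
    exact hu
  refine ⟨hz (Submodule.subset_span (by simp)), hz (Submodule.subset_span (by simp)), ?_, ?_⟩
  · have := hz (u := H - algebraMap ℂ UTakiff μ.1) (Submodule.subset_span (by simp))
    rwa [sub_smul, sub_eq_zero, algebraMap_smul] at this
  · have := hz (u := Hb - algebraMap ℂ UTakiff μ.2) (Submodule.subset_span (by simp))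
    rwa [sub_smul, sub_eq_zero, algebraMap_smul] at this

variable (μ) in
lemma span_verma : Submodule.span UTakiff {(vermaIdeal μ).mkQ 1} = ⊤ := by
  refine Submodule.eq_top_iff'.2 fun x => ?_
  obtain ⟨u, rfl⟩ := (vermaIdeal μ).mkQ_surjective x
  refine Submodule.mem_span_singleton.2 ⟨u, ?_⟩
  rw [← map_smul, smul_eq_mul, mul_one]

lemma polyVerma (c : ℂ) : IsHighestWeight (PolyVerma.of c 1) (c, 0) where
  E_smul := by rw [PolyVerma.E_smul, polyE_one, map_zero]
  Eb_smul := PolyVerma.Eb_smul c 1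
  H_smul := by rw [PolyVerma.H_smul, polyH_one, map_smul]
  Hb_smul := by rw [PolyVerma.Hb_smul, zero_smul]

end IsHighestWeight

variable {c : ℂ}

lemma vermaLift_polyVerma_mk_one (c : ℂ) :
    (IsHighestWeight.polyVerma c).vermaLift ((vermaIdeal (c, 0)).mkQ 1) = PolyVerma.of c 1 := by
  rw [IsHighestWeight.vermaLift_mk, one_smul]

lemma vermaLift_polyVerma_surjective (c : ℂ) :
    Function.Surjective (IsHighestWeight.polyVerma c).vermaLift := by
  rw [← LinearMap.range_eq_top]
  exact PolyVerma.eq_top_of_one_mem c ⟨_, vermaLift_polyVerma_mk_one c⟩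

lemma vermaRadical_eq_ker (hc : ∀ n : ℤ, c ≠ n) :
    vermaRadical (c, 0) = LinearMap.ker (IsHighestWeight.polyVerma c).vermaLift := by
  refine le_antisymm (sSup_le fun N hN => ?_) (le_sSup ?_)
  · exact (IsHighestWeight.verma (c, 0)).le_ker_of_ne_top hc (IsHighestWeight.span_verma _) _
      (vermaLift_polyVerma_mk_one c) hN
  · intro htop
    have h1 := vermaLift_polyVerma_mk_one c
    rw [LinearMap.ker_eq_top.1 htop, LinearMap.zero_apply, eq_comm] at h1
    exact (PolyVerma.of c).map_ne_zero_iff.2 one_ne_zero h1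

/-- For a non-integral weight vanishing on `h ⊗ x`, the simple module is the polynomial module. -/
def simpleModuleEquiv (hc : ∀ n : ℤ, c ≠ n) : simpleModule (c, 0) ≃ₗ[UTakiff] PolyVerma c :=
  (Submodule.quotEquivOfEq _ _ (vermaRadical_eq_ker hc)).trans
    (LinearMap.quotKerEquivOfSurjective _ (vermaLift_polyVerma_surjective c))

/-- A module without proper nonzero submodules that has a highest weight vector of weight `c` is
the polynomial module. -/
lemma nonempty_equiv_polyVerma (hc : ∀ n : ℤ, c ≠ n)
    (hM : ∀ N : Submodule UTakiff M, N = ⊥ ∨ N = ⊤) {v : M} (hv : v ≠ 0)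
    (h : IsHighestWeight v (c, 0)) : Nonempty (M ≃ₗ[UTakiff] PolyVerma c) := by
  have hspan : Submodule.span UTakiff {v} = ⊤ := (hM _).resolve_left (by simpa using hv)
  have hsurj : Function.Surjective h.vermaLift := by
    rw [← LinearMap.range_eq_top, ← top_le_iff, ← hspan, Submodule.span_le,
      Set.singleton_subset_iff]
    exact ⟨(vermaIdeal (c, 0)).mkQ 1, by rw [IsHighestWeight.vermaLift_mk, one_smul]⟩
  have hker : LinearMap.ker h.vermaLift ≠ ⊤ := by
    intro htop
    have h1 := h.vermaLift_mk 1
    rw [LinearMap.ker_eq_top.1 htop, LinearMap.zero_apply, one_smul] at h1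
    exact hv h1.symm
  have hle := (IsHighestWeight.verma (c, 0)).le_ker_of_ne_top hc (IsHighestWeight.span_verma _) _
      (vermaLift_polyVerma_mk_one c) hker
  let g : M →ₗ[UTakiff] PolyVerma c :=
    ((LinearMap.ker h.vermaLift).liftQ _ hle) ∘ₗ
      (LinearMap.quotKerEquivOfSurjective _ hsurj).symm.toLinearMap
  have hg (x) : g (h.vermaLift x) = (IsHighestWeight.polyVerma c).vermaLift x := by
    have : (LinearMap.quotKerEquivOfSurjective _ hsurj).symm (h.vermaLift x) =
        Submodule.Quotient.mk x := by
      rw [LinearEquiv.symm_apply_eq]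
      rfl
    change (LinearMap.ker h.vermaLift).liftQ _ hle
      ((LinearMap.quotKerEquivOfSurjective _ hsurj).symm (h.vermaLift x)) = _
    rw [this]
    rfl
  refine ⟨LinearEquiv.ofBijective g ⟨?_, fun p => ?_⟩⟩
  · rw [← LinearMap.ker_eq_bot]
    refine (hM _).resolve_right fun htop => ?_
    have h1 := hg ((vermaIdeal (c, 0)).mkQ 1)
    rw [LinearMap.ker_eq_top.1 htop, LinearMap.zero_apply, vermaLift_polyVerma_mk_one,
      eq_comm] at h1
    exact (PolyVerma.of c).map_ne_zero_iff.2 one_ne_zero h1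
  · obtain ⟨x, rfl⟩ := vermaLift_polyVerma_surjective c p
    exact ⟨_, hg x⟩

/-- A nonzero locally Borel-finite module with support in a root coset where `h ⊗ x` has weight zero
contains a highest weight vector: take a common eigenvector of `h` and `h ⊗ x` in a finite
dimensional Borel-stable subspace, for an eigenvalue of `h` of maximal real part. -/
lemma exists_isHighestWeight [Nontrivial M] (hM : LocallyBorelFinite M) {lam : Weight}
    (h0 : lam.2 = 0) (hsupp : weightSupport M ⊆ rootCoset lam) :
    ∃ (v : M) (c : ℂ), v ≠ 0 ∧ IsHighestWeight v (c, 0) ∧ (c, 0) ∈ rootCoset lam := by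
  obtain ⟨m, hm⟩ := exists_ne (0 : M)
  have hfin : FiniteDimensional ℂ (borelOrbit m) := Module.Finite.iff_fg.2 (hM m)
  have hst := borelStable_borelOrbit m
  have hnt : Nontrivial (borelOrbit m) := ⟨⟨m, mem_borelOrbit_self m⟩, 0, fun h =>
    hm (congrArg Subtype.val h)⟩
  let fH : Module.End ℂ (borelOrbit m) := (Algebra.lsmul ℂ ℂ M H).restrict hst.H
  let fHb : Module.End ℂ (borelOrbit m) := (Algebra.lsmul ℂ ℂ M Hb).restrict hst.Hb
  obtain ⟨c, hc, hmax⟩ := Set.exists_max_image {a | fH.HasEigenvalue a} Complex.re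
    (Module.End.finite_hasEigenvalue fH) (Module.End.exists_eigenvalue fH)
  have hmaps : Set.MapsTo fHb (fH.eigenspace c) (fH.eigenspace c) := by
    intro w hw
    rw [SetLike.mem_coe, Module.End.mem_eigenspace_iff] at hw ⊢
    have hw' : H • (w : M) = c • (w : M) := congrArg Subtype.val hw
    apply Subtype.ext
    change H • Hb • (w : M) = c • Hb • (w : M)
    rw [smul_smul_comm' H_mul_Hb, hw', smul_comm]
  have hnt' : Nontrivial (fH.eigenspace c) := Submodule.nontrivial_iff_ne_bot.2 hc
  obtain ⟨b, hb⟩ := Module.End.exists_eigenvalue (fHb.restrict hmaps)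
  obtain ⟨⟨⟨v, hvm⟩, hvc⟩, hvb⟩ := hb.exists_hasEigenvector
  have hv0 : v ≠ 0 := by
    rintro rfl
    exact hvb.2 rfl
  have hH : H • v = c • v := congrArg Subtype.val (Module.End.mem_eigenspace_iff.1 hvc)
  have hHb : Hb • v = b • v :=
    congrArg (fun w => ((w : fH.eigenspace c) : borelOrbit m).1) hvb.apply_eq_smul
  have hmem : (c, b) ∈ rootCoset lam := by
    refine hsupp ((Submodule.ne_bot_iff _).2 ⟨v, ⟨?_, ?_⟩, hv0⟩)
    · exact Module.End.mem_maxGenEigenspace _ _ _ |>.2 ⟨1, by simp [hH]⟩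
    · exact Module.End.mem_maxGenEigenspace _ _ _ |>.2 ⟨1, by simp [hHb]⟩
  obtain rfl : b = 0 := by
    obtain ⟨n, hn⟩ := hmem
    have := congrArg Prod.snd hn
    simpa [rootα, h0] using this
  have hraise (u : UTakiff) (hu : H * u = u * H + (2 : ℂ) • u) (hum : u • v ∈ borelOrbit m) :
      u • v = 0 := by
    by_contra hne
    have h2 : H • u • v = (c + 2) • u • v := by
      rw [smul_smul_swap hu, hH, smul_comm, smul_assoc, add_smul]
    have : fH.HasEigenvalue (c + 2) := by
      refine Module.End.hasEigenvalue_of_hasEigenvector (x := ⟨u • v, hum⟩)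
        ⟨Module.End.mem_eigenspace_iff.2 (Subtype.ext h2), fun h => hne (congrArg Subtype.val h)⟩
    have := hmax _ this
    norm_num at this
  exact ⟨v, c, hv0, ⟨hraise E H_mul_E (hst.E v hvm), hraise Eb H_mul_Eb (hst.Eb v hvm), hH,
    hHb⟩, hmem⟩

lemma weightSupport_polyVerma (c : ℂ) {ν : Weight} (hν : ν ∈ weightSupport (PolyVerma c)) :
    ∃ n : ℕ, ν = (c - 2 * n, 0) := by
  obtain ⟨x, ⟨hx1, hx2⟩, hx0⟩ := (Submodule.ne_bot_iff _).1 hν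
  obtain ⟨p, rfl⟩ := (PolyVerma.of c).surjective x
  rw [(PolyVerma.of c).map_ne_zero_iff] at hx0
  obtain ⟨k, hk⟩ := (Module.End.mem_maxGenEigenspace _ _ _).1 hx1
  obtain ⟨l, hl⟩ := (Module.End.mem_maxGenEigenspace _ _ _).1 hx2
  have e1 (j : ℕ) (q : ℂ[X]) :
      ((Algebra.lsmul ℂ ℂ (PolyVerma c) H - ν.1 • (1 : Module.End ℂ (PolyVerma c))) ^ j)
        (PolyVerma.of c q) =
      PolyVerma.of c (((polyH c - ν.1 • (1 : Module.End ℂ ℂ[X])) ^ j) q) := by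
    induction j generalizing q with
    | zero => rfl
    | succ j ih =>
      rw [pow_succ, pow_succ, Module.End.mul_apply, Module.End.mul_apply, ← ih]
      simp [PolyVerma.H_smul]
  have e2 (j : ℕ) (q : ℂ[X]) (n : ℕ) :
      (((polyH c - ν.1 • (1 : Module.End ℂ ℂ[X])) ^ j) q).coeff n =
        (c - 2 * n - ν.1) ^ j * q.coeff n := by
    induction j generalizing q with
    | zero => simp
    | succ j ih =>
      rw [pow_succ, Module.End.mul_apply, ih]
      simp [coeff_polyH]
      ring
  have e3 (j : ℕ) (y : PolyVerma c) :
      ((Algebra.lsmul ℂ ℂ (PolyVerma c) Hb - ν.2 • (1 : Module.End ℂ (PolyVerma c))) ^ j) y =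
        (-ν.2) ^ j • y := by
    induction j generalizing y with
    | zero => simp
    | succ j ih =>
      rw [pow_succ, Module.End.mul_apply, ih]
      have : Hb • y = 0 := PolyVerma.Hb_smul c y
      simp [this, pow_succ, mul_smul]
  rw [e1, (PolyVerma.of c).map_eq_zero_iff] at hk
  rw [e3] at hl
  have h1 := e2 k p p.natDegree
  rw [hk, coeff_zero, eq_comm, mul_eq_zero] at h1
  refine ⟨p.natDegree, Prod.ext ?_ ?_⟩
  · have h2 := eq_zero_of_pow_eq_zero (h1.resolve_right (leadingCoeff_ne_zero.2 hx0))
    exact (sub_eq_zero.1 h2).symm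
  · have h2 := (smul_eq_zero.1 hl).resolve_right ((PolyVerma.of c).map_ne_zero_iff.2 hx0)
    exact neg_eq_zero.1 (eq_zero_of_pow_eq_zero h2)

lemma weightSupport_subset_of_exact {A B D : Type*} [AddCommGroup A] [Module ℂ A]
    [Module UTakiff A] [IsScalarTower ℂ UTakiff A] [AddCommGroup B] [Module ℂ B]
    [Module UTakiff B] [IsScalarTower ℂ UTakiff B] [AddCommGroup D] [Module ℂ D]
    [Module UTakiff D] [IsScalarTower ℂ UTakiff D] (i : A →ₗ[UTakiff] B) (q : B →ₗ[UTakiff] D)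
    (hi : Function.Injective i) (hiq : Function.Exact i q) :
    weightSupport B ⊆ weightSupport A ∪ weightSupport D := by
  intro μ hμ
  obtain ⟨x, hx, hx0⟩ := (Submodule.ne_bot_iff _).1 hμ
  by_cases hq : q x = 0
  · obtain ⟨y, rfl⟩ := (hiq x).1 hq
    refine Or.inl ((Submodule.ne_bot_iff _).2 ⟨y, ⟨?_, ?_⟩, fun h => hx0 (by rw [h, map_zero])⟩)
    · exact (map_mem_maxGenEigenspace (toComplexLinear i) _ _ (fun a => map_smul i H a) _).2 hi hx.1
    · exact (map_mem_maxGenEigenspace (toComplexLinear i) _ _ (fun a => map_smul i Hb a) _).2 hi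
        hx.2
  · exact Or.inr ((Submodule.ne_bot_iff _).2 ⟨q x, map_mem_genWeightSpace q hx, hq⟩)

/-- The projection of the kernel of the universal extension to a layer. -/
def layerProj (c : ℂ) (j : Fin 4) : UnivKernel c →ₗ[UTakiff] PolyVerma (c + layerShift j) :=
  kernelHom (Pi.single ⟨j, rfl⟩ 1)

lemma layerProj_of (c : ℂ) (j : Fin 4) (k : Fin 4 → ℂ[X]) :
    layerProj c j (UnivKernel.of c k) = PolyVerma.of _ (k j) := by
  rw [layerProj, kernelHom_of, Finset.sum_eq_single ⟨j, rfl⟩ (fun b _ hb => by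
    rw [Pi.single_eq_of_ne hb, zero_smul]) (by simp), Pi.single_eq_same, one_smul]

lemma weightSupport_univKernel (c : ℂ) :
    weightSupport (UnivKernel c) ⊆ ⋃ j, weightSupport (PolyVerma (c + layerShift j)) := by
  intro μ hμ
  obtain ⟨x, hx, hx0⟩ := (Submodule.ne_bot_iff _).1 hμ
  obtain ⟨k, rfl⟩ := (UnivKernel.of c).surjective x
  rw [(UnivKernel.of c).map_ne_zero_iff, Function.ne_iff] at hx0
  obtain ⟨j, hj⟩ := hx0
  refine Set.mem_iUnion.2 ⟨j, (Submodule.ne_bot_iff _).2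
    ⟨_, map_mem_genWeightSpace (layerProj c j) hx, ?_⟩⟩
  rw [layerProj_of, (PolyVerma.of _).map_ne_zero_iff]
  exact hj

end HighestWeight

end Takiff

/-! ### Extensions in full subcategories of modules -/

namespace Takiff

section Blocks

attribute [local instance] ModuleCat.moduleOfAlgebraModule
  ModuleCat.isScalarTower_of_algebra_moduleCat

variable {P : ObjectProperty (ModuleCat.{0} UTakiff)} [P.ContainsZero]
  [P.IsClosedUnderSubobjects] [P.IsClosedUnderQuotients] [P.IsClosedUnderFiniteProducts]

instance : PreservesFiniteLimits P.ι :=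
  have := P.preservesKernels_ι
  Functor.preservesFiniteLimits_of_preservesKernels P.ι

instance : PreservesFiniteColimits P.ι :=
  have := P.preservesCokernels_ι
  Functor.preservesFiniteColimits_of_preservesCokernels P.ι

/-- Exactness in a full subcategory of modules closed under subobjects, quotients and finite
products is exactness of modules. -/
lemma shortExact_iff (S : ShortComplex P.FullSubcategory) :
    S.ShortExact ↔ Function.Injective S.f.hom ∧ Function.Exact S.f.hom S.g.hom ∧
      Function.Surjective S.g.hom := by
  constructor
  · intro h
    have h' := h.map_of_exact P.ι
    exact ⟨h'.moduleCat_injective_f,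
      (ShortComplex.ShortExact.moduleCat_exact_iff_function_exact _).1 h'.exact,
      h'.moduleCat_surjective_g⟩
  · rintro ⟨h1, h2, h3⟩
    have := (ModuleCat.mono_iff_injective S.f.hom).2 h1
    have := (ModuleCat.epi_iff_surjective S.g.hom).2 h3
    exact
    { exact := (S.exact_map_iff_of_faithful P.ι).1
        ((ShortComplex.ShortExact.moduleCat_exact_iff_function_exact (S.map P.ι)).2 h2)
      mono_f := P.ι.mono_of_mono_map (inferInstanceAs (Mono S.f.hom))
      epi_g := P.ι.epi_of_epi_map (inferInstanceAs (Epi S.g.hom)) }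

/-- Morphisms in a full subcategory of modules are linear maps. -/
def homEquiv (X Y : P.FullSubcategory) : (X ⟶ Y) ≃ₗ[ℂ] (X.obj →ₗ[UTakiff] Y.obj) where
  toFun f := f.hom.hom
  invFun g := P.homMk (ModuleCat.ofHom g)
  map_add' _ _ := rfl
  map_smul' c f := by
    ext x
    rfl
  left_inv _ := rfl
  right_inv _ := rfl

/-- Post-composition with an isomorphism, as a complex linear equivalence. -/
def postcompEquiv {A Y Z : Type*} [AddCommGroup A] [Module UTakiff A]
    [AddCommGroup Y] [Module ℂ Y] [Module UTakiff Y] [IsScalarTower ℂ UTakiff Y]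
    [AddCommGroup Z] [Module ℂ Z] [Module UTakiff Z] [IsScalarTower ℂ UTakiff Z]
    (e : Y ≃ₗ[UTakiff] Z) : (A →ₗ[UTakiff] Y) ≃ₗ[ℂ] (A →ₗ[UTakiff] Z) where
  toFun k := e.toLinearMap ∘ₗ k
  invFun k := e.symm.toLinearMap ∘ₗ k
  map_add' k l := LinearMap.comp_add _ _ _
  map_smul' a k := by
    ext x
    exact map_smul_complex e.toLinearMap a (k x)
  left_inv k := by
    ext x
    exact e.symm_apply_apply _
  right_inv k := by
    ext x
    exact e.apply_symm_apply _

/-- In every such subcategory that contains the universal extension of `M(c)`, the space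
`Ext¹(M(c), M(d))` has a basis indexed by the layers of the kernel with highest weight `d`. -/
theorem nonempty_extOne_equiv_matchingLayers {X Y : P.FullSubcategory} {c d : ℂ}
    (hc : ∀ n : ℤ, c ≠ n) (hd : ∀ n : ℤ, d ≠ n) (eX : X.obj ≃ₗ[UTakiff] PolyVerma c)
    (eY : Y.obj ≃ₗ[UTakiff] PolyVerma d) (hU : P (ModuleCat.of UTakiff (UnivExt c))) :
    Nonempty (ExtOne X Y ≃ₗ[ℂ] (matchingLayers c d → ℂ)) := by
  let ι : ModuleCat.of UTakiff (UnivKernel c) ⟶ ModuleCat.of UTakiff (UnivExt c) :=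
    ModuleCat.ofHom (univIncl c)
  have : Mono ι := (ModuleCat.mono_iff_injective ι).2 (univIncl_injective c)
  let K : P.FullSubcategory := ⟨ModuleCat.of UTakiff (UnivKernel c), P.prop_of_mono ι hU⟩
  let U : P.FullSubcategory := ⟨ModuleCat.of UTakiff (UnivExt c), hU⟩
  let S : ShortComplex P.FullSubcategory := ShortComplex.mk (X₁ := K) (X₂ := U) (X₃ := X)
    (P.homMk ι) (P.homMk (ModuleCat.ofHom (eX.symm.toLinearMap ∘ₗ univProj c))) (by
      ext x
      exact (congrArg eX.symm ((exact_univIncl_univProj c _).2 ⟨x, rfl⟩)).trans (map_zero _))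
  have hS : S.ShortExact := by
    refine (shortExact_iff S).2 ⟨univIncl_injective c, fun x => ?_,
      eX.symm.surjective.comp (univProj_surjective c)⟩
    exact (eX.symm.map_eq_zero_iff (x := univProj c x)).trans (exact_univIncl_univProj c x)
  suffices h : Nonempty (ExtOne X Y ≃ₗ[ℂ] (K ⟶ Y)) by
    obtain ⟨φ⟩ := h
    exact ⟨φ.trans ((homEquiv K Y).trans ((postcompEquiv eY).trans (kernelHomEquiv c d hd).symm))⟩
  refine nonempty_extOne_equiv_hom hS (fun N i p hip hN => ?_) (fun k => ?_)
  · obtain ⟨h1, h2, h3⟩ := (shortExact_iff _).1 hN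
    obtain ⟨l, hl⟩ := exists_lift_univExt hc hd (i.hom.hom ∘ₗ eY.symm.toLinearMap)
      (eX.toLinearMap ∘ₗ p.hom.hom) (h1.comp eY.symm.injective) (eX.surjective.comp h3) (by
        intro y
        refine (eX.map_eq_zero_iff (x := p.hom.hom y)).trans ((h2 y).trans ⟨?_, ?_⟩)
        · rintro ⟨z, rfl⟩
          exact ⟨eY z, congrArg i.hom.hom (eY.symm_apply_apply z)⟩
        · rintro ⟨z, rfl⟩
          exact ⟨eY.symm z, rfl⟩)
    refine ⟨P.homMk (ModuleCat.ofHom l), ?_⟩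
    ext x
    exact (eX.symm_apply_eq.2 (hl x).symm).symm
  · ext x
    have h := comp_univIncl_eq_zero hc hd (eY.toLinearMap ∘ₗ k.hom.hom) x
    exact (eY.map_eq_zero_iff (x := k.hom.hom (univIncl c x))).1 h

end Blocks

end Takiff

/-! ### The simple objects and the Gabriel quiver -/

namespace Takiff

section Counting

/-- The highest weights of the layers of `UnivKernel c`, in units of the root. -/
def layerDegree : Fin 4 → ℤ := ![0, 0, 1, -1]

lemma layerShift_eq (j : Fin 4) : layerShift j = 2 * (layerDegree j : ℂ) := by
  fin_cases j <;> simp [layerShift, layerDegree]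

/-- The number of arrows from the vertex `i` to the vertex `j` of `TwoLoopLine`. -/
def arrowCount (i j : ℤ) : ℕ := if j = i then 2 else if j = i + 1 ∨ j = i - 1 then 1 else 0

lemma card_layerDegree_eq (m : ℤ) :
    Fintype.card {j : Fin 4 // layerDegree j = m} = arrowCount 0 m := by
  by_cases h0 : m = 0
  · subst h0
    decide
  by_cases h1 : m = 1
  · subst h1
    decide
  by_cases h2 : m = -1
  · subst h2
    decide
  have : IsEmpty {j : Fin 4 // layerDegree j = m} := by
    refine ⟨fun ⟨j, hj⟩ => ?_⟩
    fin_cases j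
    exacts [h0 hj.symm, h0 hj.symm, h1 hj.symm, h2 hj.symm]
  rw [Fintype.card_eq_zero]
  simp [arrowCount, h0, h1, h2]

lemma arrowCount_sub (i j : ℤ) : arrowCount 0 (j - i) = arrowCount i j := by
  unfold arrowCount
  congr 1
  · simp [sub_eq_zero]
  · congr 1
    simp only [eq_iff_iff]
    omega

lemma nonempty_matchingLayers_equiv (c : ℂ) (i j : ℤ) :
    Nonempty (matchingLayers (c + 2 * i) (c + 2 * j) ≃ Fin (arrowCount i j)) := by
  have e : matchingLayers (c + 2 * i) (c + 2 * j) ≃ {k : Fin 4 // layerDegree k = j - i} := by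
    refine Equiv.subtypeEquivRight fun k => ?_
    rw [layerShift_eq, ← Int.cast_inj (α := ℂ)]
    push_cast
    constructor <;> intro h
    · linear_combination h / 2
    · linear_combination 2 * h
  exact ⟨e.trans (Fintype.equivFinOfCardEq
    ((card_layerDegree_eq _).trans (arrowCount_sub i j)))⟩

end Counting

section Simples

open Polynomial

lemma eq_of_polyVerma_equiv {c d : ℂ} (hd : ∀ n : ℤ, d ≠ n)
    (e : PolyVerma c ≃ₗ[UTakiff] PolyVerma d) : c = d := by
  obtain ⟨p, hp⟩ := (PolyVerma.of d).surjective (e (PolyVerma.of c 1))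
  have hE : PolyVerma.of d (polyE d p) = 0 := by
    rw [← PolyVerma.E_smul, hp, ← map_smul, PolyVerma.E_smul, polyE_one, map_zero, map_zero]
  have hpC := eq_C_of_polyE_eq_zero hd (((PolyVerma.of d).map_eq_zero_iff).1 hE)
  have hH : PolyVerma.of d (polyH d p) = PolyVerma.of d (c • p) := by
    rw [← PolyVerma.H_smul, map_smul, hp, ← map_smul, PolyVerma.H_smul, polyH_one, map_smul]
    exact map_smul_complex e.toLinearMap c _
  have h0 := congrArg (fun q : ℂ[X] => q.coeff 0) ((PolyVerma.of d).injective hH)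
  have hne : p.coeff 0 ≠ 0 := by
    intro h
    rw [hpC, h, C_0, map_zero] at hp
    exact (PolyVerma.of c).map_ne_zero_iff.2 one_ne_zero (e.map_eq_zero_iff.1 hp.symm)
  simp only [coeff_polyH, coeff_smul, smul_eq_mul, Nat.cast_zero, mul_zero, sub_zero] at h0
  exact (mul_right_cancel₀ hne h0).symm

lemma add_zsmul_root {lam : Weight} (h0 : lam.2 = 0) (n : ℤ) :
    lam + n • rootα = (lam.1 + 2 * n, 0) := by
  refine Prod.ext ?_ ?_
  · simp [rootα, mul_comm]
  · simp [rootα, h0]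

lemma add_two_mul_ne_intCast {c : ℂ} (hc : ∀ n : ℤ, c ≠ n) (m : ℤ) : ∀ n : ℤ, c + 2 * m ≠ n := by
  intro n h
  refine hc (n - 2 * m) ?_
  push_cast
  linear_combination h

end Simples

section Blocks

attribute [local instance] ModuleCat.moduleOfAlgebraModule
  ModuleCat.isScalarTower_of_algebra_moduleCat

lemma thickO_of_equiv {M : Type*} [AddCommGroup M] [Module ℂ M] [Module UTakiff M]
    [IsScalarTower ℂ UTakiff M] {X : ModuleCat.{0} UTakiff} (e : X ≃ₗ[UTakiff] M)
    (hfin : Module.Finite UTakiff M) (hM : LocallyBorelFinite M) : thickO X :=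
  ⟨Module.Finite.equiv e.symm, hM.of_injective e.toLinearMap e.injective⟩

lemma thickO_univExt (c : ℂ) : thickO (ModuleCat.of UTakiff (UnivExt c)) :=
  thickO_of_equiv (LinearEquiv.refl UTakiff (UnivExt c)) (UnivExt.module_finite c)
    (UnivExt.locallyBorelFinite c)

lemma weightSupport_subset_of_equiv {M : Type*} [AddCommGroup M] [Module ℂ M] [Module UTakiff M]
    [IsScalarTower ℂ UTakiff M] {X : ModuleCat.{0} UTakiff} (e : X ≃ₗ[UTakiff] M) :
    weightSupport X ⊆ weightSupport M :=
  weightSupport_subset_of_injective e.toLinearMap e.injective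

variable {lam : Weight}

lemma add_two_mul_mem_rootCoset {c : ℂ} (hc : (c, 0) ∈ rootCoset lam) (m : ℤ) :
    (c + 2 * m, 0) ∈ rootCoset lam := by
  obtain ⟨n, hn⟩ := hc
  refine ⟨n + m, ?_⟩
  rw [add_smul, ← add_assoc, ← hn]
  simp [rootα, mul_comm]

lemma weightSupport_polyVerma_subset {c : ℂ} (hc : (c, 0) ∈ rootCoset lam) :
    weightSupport (PolyVerma c) ⊆ rootCoset lam := by
  intro ν hν
  obtain ⟨n, rfl⟩ := weightSupport_polyVerma c hν
  have := add_two_mul_mem_rootCoset hc (-n)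
  simpa [sub_eq_add_neg] using this

lemma thickBlock_univExt {c : ℂ} (hc : (c, 0) ∈ rootCoset lam) :
    thickBlock (rootCoset lam) (ModuleCat.of UTakiff (UnivExt c)) := by
  refine ⟨thickO_univExt c, ?_⟩
  refine (weightSupport_subset_of_equiv (LinearEquiv.refl UTakiff (UnivExt c))).trans ?_
  refine (weightSupport_subset_of_exact _ _ (univIncl_injective c)
    (exact_univIncl_univProj c)).trans (Set.union_subset ?_ (weightSupport_polyVerma_subset hc))
  refine (weightSupport_univKernel c).trans (Set.iUnion_subset fun j => ?_)
  rw [layerShift_eq]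
  exact weightSupport_polyVerma_subset (add_two_mul_mem_rootCoset hc _)

lemma thickBlock_simpleModule {c : ℂ} (hn : ∀ n : ℤ, c ≠ n) (hc : (c, 0) ∈ rootCoset lam) :
    thickBlock (rootCoset lam) (simpleModule (c, 0)) :=
  ⟨thickO_simpleModule _,
    (weightSupport_subset_of_equiv (simpleModuleEquiv hn)).trans
      (weightSupport_polyVerma_subset hc)⟩

variable {P : ObjectProperty (ModuleCat.{0} UTakiff)} [P.ContainsZero]
  [P.IsClosedUnderSubobjects] [P.IsClosedUnderQuotients] [P.IsClosedUnderFiniteProducts]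

/-- As the subcategory is closed under submodules, its simple objects are the simple modules in
it. -/
theorem simple_iff_isSimpleModule (X : P.FullSubcategory) :
    Simple X ↔ IsSimpleModule UTakiff X.obj := by
  constructor
  · intro h
    have : Nontrivial (Submodule UTakiff X.obj) := by
      rw [Submodule.nontrivial_iff]
      by_contra hX
      rw [not_nontrivial_iff_subsingleton] at hX
      refine Simple.not_isZero X ((IsZero.iff_id_eq_zero X).2 ?_)
      ext x
      exact hX.elim _ _
    refine (isSimpleModule_iff UTakiff X.obj).2 ⟨fun N => or_iff_not_imp_left.2 fun hN => ?_⟩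
    let ι : ModuleCat.of UTakiff N ⟶ X.obj := ModuleCat.ofHom N.subtype
    have hι : Mono ι := (ModuleCat.mono_iff_injective ι).2 N.injective_subtype
    let K : P.FullSubcategory := ⟨ModuleCat.of UTakiff N, P.prop_of_mono ι X.property⟩
    let j : K ⟶ X := P.homMk ι
    have hj : Mono j := P.ι.mono_of_mono_map hι
    have hj0 : j ≠ 0 := by
      intro h0
      refine hN ((Submodule.eq_bot_iff N).2 fun x hx => ?_)
      exact congrArg (fun g : K ⟶ X => g.hom.hom ⟨x, hx⟩) h0
    have hiso := (Simple.mono_isIso_iff_nonzero j).2 hj0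
    have : IsIso ι := inferInstanceAs (IsIso (P.ι.map j))
    have hs : Function.Surjective ι.hom := (ModuleCat.epi_iff_surjective ι).1 inferInstance
    refine Submodule.eq_top_iff'.2 fun x => ?_
    obtain ⟨y, rfl⟩ := hs x
    exact y.2
  · intro h
    refine ⟨fun {Y} f hf => ⟨?_, fun hf0 => ?_⟩⟩
    · rintro hiso rfl
      have : Nontrivial X.obj := IsSimpleModule.nontrivial UTakiff X.obj
      obtain ⟨x, hx⟩ := exists_ne (0 : X.obj)
      refine hx ?_
      have h0 := IsIso.inv_hom_id (0 : Y ⟶ X)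
      rw [comp_zero] at h0
      exact (congrArg (fun g : X ⟶ X => g.hom.hom x) h0).symm
    · have hm : Mono f.hom := inferInstanceAs (Mono (P.ι.map f))
      have hr : LinearMap.range f.hom.hom ≠ ⊥ := by
        intro hr
        refine hf0 ?_
        ext x
        exact congrArg (fun g => g x) (LinearMap.range_eq_bot.1 hr)
      have he : Epi f.hom := (ModuleCat.epi_iff_surjective f.hom).2
        (LinearMap.range_eq_top.1 ((eq_bot_or_eq_top _).resolve_left hr))
      have : IsIso (P.ι.map f) := isIso_of_mono_of_epi f.hom
      exact isIso_of_reflects_iso f P.ι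

lemma nonempty_extOne_equiv {X Y : P.FullSubcategory} {c : ℂ} (hc : ∀ n : ℤ, c ≠ n) (i j : ℤ)
    (eX : X.obj ≃ₗ[UTakiff] PolyVerma (c + 2 * i)) (eY : Y.obj ≃ₗ[UTakiff] PolyVerma (c + 2 * j))
    (hU : P (ModuleCat.of UTakiff (UnivExt (c + 2 * i)))) :
    Nonempty (ExtOne X Y ≃ₗ[ℂ] (Fin (arrowCount i j) → ℂ)) := by
  obtain ⟨φ⟩ := nonempty_extOne_equiv_matchingLayers (add_two_mul_ne_intCast hc i)
    (add_two_mul_ne_intCast hc j) eX eY hU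
  obtain ⟨e⟩ := nonempty_matchingLayers_equiv c i j
  exact ⟨φ.trans (LinearEquiv.funCongrLeft ℂ ℂ e.symm)⟩

end Blocks

section Quiver

attribute [local instance] ModuleCat.moduleOfAlgebraModule
  ModuleCat.isScalarTower_of_algebra_moduleCat

variable {lam : Weight}

lemma root_translate_mem (h0 : lam.2 = 0) (n : ℤ) : (lam.1 + 2 * (n : ℂ), 0) ∈ rootCoset lam :=
  ⟨n, (add_zsmul_root h0 n).symm⟩

lemma nonempty_simpleModule_equiv (h0 : lam.2 = 0) (h1 : ∀ n : ℤ, lam.1 ≠ n) (n : ℤ) :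
    Nonempty (simpleModule (lam + n • rootα) ≃ₗ[UTakiff] PolyVerma (lam.1 + 2 * n)) := by
  rw [add_zsmul_root h0]
  exact ⟨simpleModuleEquiv (add_two_mul_ne_intCast h1 n)⟩

variable (h0 : lam.2 = 0) (h1 : ∀ n : ℤ, lam.1 ≠ n)

/-- The simple modules `L(λ + nα)` as objects of the block. -/
def simpleBlock (n : ℤ) : ThickBlock (rootCoset lam) :=
  ⟨simpleModule (lam + n • rootα), by
    rw [add_zsmul_root h0]
    exact thickBlock_simpleModule (add_two_mul_ne_intCast h1 n) (root_translate_mem h0 n)⟩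

lemma simple_simpleBlock (n : ℤ) : Simple (simpleBlock h0 h1 n) := by
  obtain ⟨e⟩ := nonempty_simpleModule_equiv h0 h1 n
  have : IsSimpleModule UTakiff (PolyVerma (lam.1 + 2 * n)) :=
    have : Nontrivial (Submodule UTakiff (PolyVerma (lam.1 + 2 * n))) :=
      (Submodule.nontrivial_iff _).2 (PolyVerma.of _).symm.toEquiv.nontrivial
    (isSimpleModule_iff _ _).2 ⟨PolyVerma.eq_bot_or_eq_top (add_two_mul_ne_intCast h1 n)⟩
  exact (simple_iff_isSimpleModule _).2 (IsSimpleModule.congr e)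

lemma eq_of_simpleBlock_iso {m n : ℤ} (e : simpleBlock h0 h1 m ≅ simpleBlock h0 h1 n) :
    m = n := by
  obtain ⟨em⟩ := nonempty_simpleModule_equiv h0 h1 m
  obtain ⟨en⟩ := nonempty_simpleModule_equiv h0 h1 n
  have e' := ((thickBlock (rootCoset lam)).ι.mapIso e).toLinearEquiv
  have h := eq_of_polyVerma_equiv (add_two_mul_ne_intCast h1 n) ((em.symm.trans e').trans en)
  rw [add_right_inj, mul_right_inj' two_ne_zero] at h
  exact_mod_cast h

lemma exists_iso_simpleBlock (S : ThickBlock (rootCoset lam)) (hS : Simple S) :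
    ∃ n : ℤ, Nonempty (simpleBlock h0 h1 n ≅ S) := by
  have hS' := (simple_iff_isSimpleModule S).1 hS
  have : Nontrivial S.obj := IsSimpleModule.nontrivial UTakiff S.obj
  obtain ⟨v, c, hv, hvc, n, hn⟩ := exists_isHighestWeight S.property.1.2 h0 S.property.2
  rw [add_zsmul_root h0] at hn
  obtain rfl : c = lam.1 + 2 * n := congrArg Prod.fst hn
  obtain ⟨e⟩ := nonempty_equiv_polyVerma (add_two_mul_ne_intCast h1 n) eq_bot_or_eq_top hv hvc
  obtain ⟨en⟩ := nonempty_simpleModule_equiv h0 h1 n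
  exact ⟨n, ⟨(thickBlock (rootCoset lam)).isoMk (en.trans e.symm).toModuleIso⟩⟩

/-- The vertex of the Gabriel quiver at a position of the line. -/
def vertex (i : TwoLoopLine) : GabrielQuiver (ThickBlock (rootCoset lam)) where
  isoClass := toSkeleton (simpleBlock h0 h1 i.pos)
  simple :=
    have := simple_simpleBlock h0 h1 i.pos
    Simple.of_iso (fromSkeletonToSkeletonIso _)

/-- The chosen representative of a vertex is isomorphic to the simple module it stands for. -/
def vertexRepIso (i : TwoLoopLine) : (vertex h0 h1 i).rep ≅ simpleBlock h0 h1 i.pos :=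
  fromSkeletonToSkeletonIso _

lemma vertex_bijective : Function.Bijective (vertex h0 h1) := by
  constructor
  · rintro ⟨i⟩ ⟨j⟩ hij
    have h : toSkeleton (simpleBlock h0 h1 i) = toSkeleton (simpleBlock h0 h1 j) :=
      congrArg GabrielQuiver.isoClass hij
    obtain ⟨e⟩ := toSkeleton_eq_toSkeleton_iff.1 h
    rw [eq_of_simpleBlock_iso h0 h1 e]
  · rintro ⟨S, hS⟩
    obtain ⟨n, hn⟩ := exists_iso_simpleBlock h0 h1 _ hS
    refine ⟨⟨n⟩, ?_⟩
    have h : toSkeleton (simpleBlock h0 h1 n) = S := toSkeleton_eq_iff.2 hn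
    subst h
    rfl

lemma nonempty_arrow_equiv (i j : TwoLoopLine) :
    Nonempty ((i ⟶ j) ≃ (vertex h0 h1 i ⟶ vertex h0 h1 j)) := by
  obtain ⟨ei⟩ := nonempty_simpleModule_equiv h0 h1 i.pos
  obtain ⟨ej⟩ := nonempty_simpleModule_equiv h0 h1 j.pos
  let r (k : TwoLoopLine) : (vertex h0 h1 k).rep.obj ≃ₗ[UTakiff]
      simpleModule (lam + k.pos • rootα) :=
    ((thickBlock (rootCoset lam)).ι.mapIso (vertexRepIso h0 h1 k)).toLinearEquiv
  obtain ⟨φ⟩ := nonempty_extOne_equiv h1 i.pos j.pos ((r i).trans ei) ((r j).trans ej)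
    (thickBlock_univExt (root_translate_mem h0 i.pos))
  have hr : Module.rank ℂ (ExtOne (vertex h0 h1 i).rep (vertex h0 h1 j).rep) =
      (arrowCount i.pos j.pos : Cardinal) := by
    have := φ.lift_rank_eq
    rw [rank_fin_fun, Cardinal.lift_natCast] at this
    simpa using this
  have e : (vertex h0 h1 i ⟶ vertex h0 h1 j) ≃ ULift.{1} (Fin (arrowCount i.pos j.pos)) := by
    refine Nonempty.some (Cardinal.eq.1 ?_)
    refine (Cardinal.mk_out _).trans (hr.trans ?_)
    simp
  exact ⟨(e.trans Equiv.ulift).symm⟩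

end Quiver

lemma arrowCount_self (i : ℤ) : arrowCount i i = 2 := if_pos rfl
lemma arrowCount_add_one (i : ℤ) : arrowCount i (i + 1) = 1 := by simp [arrowCount]
lemma arrowCount_sub_one (i : ℤ) : arrowCount i (i - 1) = 1 := by simp [arrowCount]

lemma nonempty_extOne_simpleO {lam : Weight} (h0 : lam.2 = 0) (h1 : ∀ n : ℤ, lam.1 ≠ n)
    (i j : ℤ) : Nonempty (ExtOne (simpleO (lam + i • rootα)) (simpleO (lam + j • rootα)) ≃ₗ[ℂ]
      (Fin (arrowCount i j) → ℂ)) := by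
  obtain ⟨ei⟩ := nonempty_simpleModule_equiv h0 h1 i
  obtain ⟨ej⟩ := nonempty_simpleModule_equiv h0 h1 j
  exact nonempty_extOne_equiv (X := simpleO _) (Y := simpleO _) h1 i j ei ej (thickO_univExt _)

end Takiff

theorem corollary25 (lam : Takiff.Weight) (h0 : lam.2 = 0) (h1 : ∀ n : ℤ, lam.1 ≠ n) :
    (∃ F : TwoLoopLine ≃ GabrielQuiver (Takiff.ThickBlock (Takiff.rootCoset lam)),
      (∀ i, Nonempty ((F i).rep.obj ≅ Takiff.simpleModule (lam + i.pos • Takiff.rootα))) ∧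
      ∀ i j, Nonempty ((i ⟶ j) ≃ (F i ⟶ F j))) ∧
    ∀ μ ∈ Takiff.rootCoset lam,
      Nonempty (ExtOne (Takiff.simpleO μ) (Takiff.simpleO μ) ≃ₗ[ℂ] (Fin 2 → ℂ)) ∧
      Nonempty (ExtOne (Takiff.simpleO μ) (Takiff.simpleO (μ + Takiff.rootα)) ≃ₗ[ℂ] ℂ) ∧
      Nonempty (ExtOne (Takiff.simpleO μ) (Takiff.simpleO (μ - Takiff.rootα)) ≃ₗ[ℂ] ℂ) ∧
      ∀ ν ∈ Takiff.rootCoset lam, ν ≠ μ → ν ≠ μ + Takiff.rootα → ν ≠ μ - Takiff.rootα →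
        Subsingleton (ExtOne (Takiff.simpleO μ) (Takiff.simpleO ν)) := by
  refine ⟨⟨Equiv.ofBijective _ (Takiff.vertex_bijective h0 h1), fun i =>
    ⟨(Takiff.thickBlock (Takiff.rootCoset lam)).ι.mapIso (Takiff.vertexRepIso h0 h1 i)⟩,
    Takiff.nonempty_arrow_equiv h0 h1⟩, ?_⟩
  rintro μ ⟨i, rfl⟩
  have key := Takiff.nonempty_extOne_simpleO h0 h1 i
  refine ⟨?_, ?_, ?_, ?_⟩
  · have h := key i
    rwa [Takiff.arrowCount_self] at h
  · have h := key (i + 1)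
    rw [Takiff.arrowCount_add_one, add_smul, one_smul, ← add_assoc] at h
    exact h.map fun φ => φ.trans (LinearEquiv.funUnique (Fin 1) ℂ ℂ)
  · have h := key (i - 1)
    rw [Takiff.arrowCount_sub_one, sub_smul, one_smul, ← add_sub_assoc] at h
    exact h.map fun φ => φ.trans (LinearEquiv.funUnique (Fin 1) ℂ ℂ)
  · rintro ν ⟨j, rfl⟩ hself hadd hsub
    obtain ⟨φ⟩ := key j
    have hj : Takiff.arrowCount i j = 0 := by
      rw [Takiff.arrowCount, if_neg, if_neg]
      · rintro (rfl | rfl)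
        · exact hadd (by rw [add_smul, one_smul, add_assoc])
        · exact hsub (by rw [sub_smul, one_smul, add_sub_assoc])
      · rintro rfl
        exact hself rfl
    have : IsEmpty (Fin (Takiff.arrowCount i j)) := by
      rw [hj]
      infer_instance
    exact φ.toEquiv.subsingleton

end
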